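/- Let $\mu\in(0,1)$, $\nu\in[0,1]$, $\omega\in\mathbb{R}$, $K,\rho>0$, $\gamma\ge 0$. For real parameters let $$E^{\gamma}_{\rho,\mu}(x)=\sum_{r=0}^{\infty}\frac{(\gamma)_r}{\Gamma(\rho r+\mu)}\frac{x^r}{r!},\qquad (\gamma)_r=\gamma(\gamma+1)\cdots(\gamma+r-1),$$ and let $$\mathbf{E}^{\gamma}_{\rho,\mu,\omega,0^+}f(t)=\int_0^t (t-y)^{\mu-1}E^{\gamma}_{\rho,\mu}\big(\omega(t-y)^\rho\big)f(y)\,dy$$ be the Prabhakar integral, with $\mathbf{E}^{0}_{\rho,0,\omega,0^+}f=f$. The Hilfer--Prabhakar derivative is $$\mathcal{D}^{\gamma,\mu,\nu}_{\rho,\omega,0^+}f=\mathbf{E}^{-\gamma\nu}_{\rho,\nu(1-\mu),\omega,0^+}\frac{d}{dt}\Big(\mathbf{E}^{-\gamma(1-\nu)}_{\rho,(1-\nu)(1-\mu),\omega,0^+}f\Big),$$ for $f\in L^1[0,b]$ with $\mathbf{E}^{-\gamma(1-\nu)}_{\rho,(1-\nu)(1-\mu),\omega,0^+}f\in AC[0,b]$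 for all $0<b<\infty$ (the value at $0$ being the limit at $0^+$), where the inner and outer integrals converge absolutely and the derivative $d/dt$ exists at every $t>0$. **(Convergence.)** For all $k\in\mathbb{R}$ and $t>0$ the series $$S(k,t)=\sum_{n=0}^{\infty}(-K)^n t^{\mu(n+1)-\nu(\mu-1)-1}E^{\gamma(n+1-\nu)}_{\rho,\mu(n+1)-\nu(\mu-1)}(\omega t^\rho)\,k^{2n}$$ converges absolutely, and so does the double series over $(n,r)$ obtained by inserting the series of the Mittag-Leffler functions. **(Solution.)** Let $g:\mathbb{R}\to\mathbb{R}$ be continuous and integrable, with integrable Fourier transform $\hat g(k)=\int_{\mathbb{R}}e^{ikx}g(x)\,dx$. Consider the Cauchy problem $$\begin{cases}\mathcal{D}^{\gamma,\mu,\nu}_{\rho,\omega,0^+}u(x,t)=K\,\dfrac{\partial^2}{\partial x^2}u(x,t), & t>0,\ x\in\mathbb{R},\\[4pt] \Big[\mathbf{E}^{-\gamma(1-\nu)}_{\rho,(1-\nu)(1-\mu),\omega,0^+}u(x,t)\Big]_{t=0^+}=g(x), & x\in\mathbb{R},\\[4pt] \lim_{x\to\pm\infty}u(x,t)=0, & t>0,\end{cases}$$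 where a solution is a real function $u$ such that $u(x,\cdot)$ is in the domain of $\mathcal{D}^{\gamma,\mu,\nu}_{\rho,\omega,0^+}$ for every $x$, $u(\cdot,t)\in C^2(\mathbb{R})$ for every $t>0$, and for every $T>0$ there is $h\in L^1(0,T)$ with $|u(x,t)|\le h(t)$ and $|u_{xx}(x,t)|\le h(t)$ for all $x\in\mathbb{R}$, $0<t<T$. Then this problem has a solution, the solution is unique on $\mathbb{R}\times(0,\infty)$, and it is given by $$u(x,t)=\int_{-\infty}^{+\infty}e^{-ikx}\,\hat g(k)\,\frac{1}{2\pi}\,S(k,t)\,dk,\qquad x\in\mathbb{R},\ t>0,$$ where the integral converges absolutely. -/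

import Mathlib

open Set Filter Topology MeasureTheory

noncomputable section

namespace HilferPrabhakar

/-- The `r`-th term of the three-parameter Mittag-Leffler series. The quotient
`Γ(γ + r) / Γ(γ)` is the rising factorial `γ (γ + 1) ⋯ (γ + r - 1)`, which also covers
the parameters at which `Γ(γ)` has a pole (for `γ = 0` only the term `r = 0` survives). -/
def mittagLefflerTerm (γ ρ μ x : ℝ) (r : ℕ) : ℝ :=
  (ascPochhammer ℝ r).eval γ / Real.Gamma (ρ * r + μ) * (x ^ r / (r.factorial : ℝ))

/-- The three-parameter (Prabhakar) Mittag-Leffler function `E^γ_{ρ,μ}(x)`. -/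
def mittagLeffler (γ ρ μ x : ℝ) : ℝ :=
  ∑' r : ℕ, mittagLefflerTerm γ ρ μ x r

/-- The kernel `e^γ_{ρ,μ,ω}(t) = t^{μ-1} E^γ_{ρ,μ}(ω t^ρ)`, used for `t > 0`. -/
def prabhakarKernel (γ ρ μ ω t : ℝ) : ℝ :=
  t ^ (μ - 1) * mittagLeffler γ ρ μ (ω * t ^ ρ)

/-- The Prabhakar integral `(𝐄^γ_{ρ,μ,ω,0⁺} f)(t)`, with the convention `𝐄^0_{ρ,0,ω,0⁺} f = f`. -/
def prabhakarIntegral (γ ρ μ ω : ℝ) (f : ℝ → ℝ) (t : ℝ) : ℝ :=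
  if μ = 0 ∧ γ = 0 then f t
  else ∫ y in (0 : ℝ)..t, prabhakarKernel γ ρ μ ω (t - y) * f y

/-- The integral defining `(𝐄^γ_{ρ,μ,ω,0⁺} f)(t)` converges absolutely. -/
def PrabhakarIntegrableAt (γ ρ μ ω : ℝ) (f : ℝ → ℝ) (t : ℝ) : Prop :=
  (μ = 0 ∧ γ = 0) ∨
    IntervalIntegrable (fun y => prabhakarKernel γ ρ μ ω (t - y) * f y) volume 0 t

/-- The inner integral `𝐄^{-γ(1-ν)}_{ρ,(1-ν)(1-μ),ω,0⁺} f` of the Hilfer-Prabhakar derivative. -/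
def innerIntegral (γ μ ν ρ ω : ℝ) (f : ℝ → ℝ) : ℝ → ℝ :=
  prabhakarIntegral (-γ * (1 - ν)) ρ ((1 - ν) * (1 - μ)) ω f

/-- The Hilfer-Prabhakar derivative
`𝐄^{-γν}_{ρ,ν(1-μ),ω,0⁺} (d/dt) 𝐄^{-γ(1-ν)}_{ρ,(1-ν)(1-μ),ω,0⁺} f`. -/
def hilferPrabhakarDeriv (γ μ ν ρ ω : ℝ) (f : ℝ → ℝ) : ℝ → ℝ :=
  prabhakarIntegral (-γ * ν) ρ (ν * (1 - μ)) ω (deriv (innerIntegral γ μ ν ρ ω f))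

/-- The domain of the Hilfer-Prabhakar derivative on the half-line: `f ∈ L¹[0,b]` and
`𝐄^{-γ(1-ν)}_{ρ,(1-ν)(1-μ),ω,0⁺} f ∈ AC[0,b]` for every finite `b`; the value at `0` of the latter
function is its limit at `0⁺`. In addition, the derivative is required to exist as a genuine
number at every `t > 0`. -/
structure HasHilferPrabhakarDeriv (γ μ ν ρ ω : ℝ) (f : ℝ → ℝ) : Prop where
  integrableOn : ∀ b > 0, IntegrableOn f (Ioc 0 b)
  inner_integrable : ∀ t > 0,
    PrabhakarIntegrableAt (-γ * (1 - ν)) ρ ((1 - ν) * (1 - μ)) ω f t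
  inner_ac : ∀ b > 0, ∃ w : ℝ → ℝ, AbsolutelyContinuousOnInterval w 0 b ∧
    EqOn w (innerIntegral γ μ ν ρ ω f) (Ioc 0 b)
  inner_diff : ∀ t > 0, DifferentiableAt ℝ (innerIntegral γ μ ν ρ ω f) t
  outer_integrable : ∀ t > 0,
    PrabhakarIntegrableAt (-γ * ν) ρ (ν * (1 - μ)) ω (deriv (innerIntegral γ μ ν ρ ω f)) t

/-- `u x t` is a (classical) solution of the Cauchy problem `𝓓^{γ,μ,ν}_{ρ,ω,0⁺} u = K u_xx`
for `t > 0`, with initial datum `g` for the inner Prabhakar integral and decay at `±∞`.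
The field `majorant` fixes the class of solutions: `u` and `u_xx` are bounded in `x`,
with bounds that are locally integrable in time up to `t = 0`. -/
structure IsSolution (γ μ ν ρ ω K : ℝ) (g : ℝ → ℝ) (u : ℝ → ℝ → ℝ) : Prop where
  time_regular : ∀ x, HasHilferPrabhakarDeriv γ μ ν ρ ω (fun t => u x t)
  space_regular : ∀ t > 0, ContDiff ℝ 2 (fun x => u x t)
  majorant : ∀ T > 0, ∃ h : ℝ → ℝ, IntegrableOn h (Ioo 0 T) ∧
    ∀ t ∈ Ioo 0 T, ∀ x, |u x t| ≤ h t ∧ |iteratedDeriv 2 (fun y => u y t) x| ≤ h t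
  equation : ∀ t > 0, ∀ x,
    hilferPrabhakarDeriv γ μ ν ρ ω (fun s => u x s) t
      = K * iteratedDeriv 2 (fun y => u y t) x
  initial : ∀ x,
    Tendsto (innerIntegral γ μ ν ρ ω (fun s => u x s)) (𝓝[>] 0) (𝓝 (g x))
  decay_top : ∀ t > 0, Tendsto (fun x => u x t) atTop (𝓝 0)
  decay_bot : ∀ t > 0, Tendsto (fun x => u x t) atBot (𝓝 0)

/-- The Fourier transform `ĝ(k) = ∫ e^{ikx} g(x) dx`, whose inverse is
`(2π)⁻¹ ∫ e^{-ikx} ĝ(k) dk`. -/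
def fourierHat (g : ℝ → ℝ) (k : ℝ) : ℂ :=
  ∫ x : ℝ, Complex.exp (Complex.I * k * x) * (g x : ℂ)

/-- The `n`-th term
`(-K)^n t^{μ(n+1)-ν(μ-1)-1} E^{γ(n+1-ν)}_{ρ,μ(n+1)-ν(μ-1)}(ω t^ρ) k^{2n}`. -/
def seriesTerm (γ μ ν ρ ω K k t : ℝ) (n : ℕ) : ℝ :=
  (-K) ^ n * t ^ (μ * (n + 1) - ν * (μ - 1) - 1)
    * mittagLeffler (γ * (n + 1 - ν)) ρ (μ * (n + 1) - ν * (μ - 1)) (ω * t ^ ρ) * k ^ (2 * n)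

/-- The `(n, r)`-th term of the double series obtained from `seriesTerm` by inserting the
Mittag-Leffler series. -/
def doubleSeriesTerm (γ μ ν ρ ω K k t : ℝ) (p : ℕ × ℕ) : ℝ :=
  (-K) ^ p.1 * t ^ (μ * (p.1 + 1) - ν * (μ - 1) - 1)
    * mittagLefflerTerm (γ * (p.1 + 1 - ν)) ρ (μ * (p.1 + 1) - ν * (μ - 1)) (ω * t ^ ρ) p.2
    * k ^ (2 * p.1)

/-- The integrand (in `k`) of the solution formula. -/
def solutionIntegrand (γ μ ν ρ ω K : ℝ) (g : ℝ → ℝ) (x t k : ℝ) : ℂ :=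
  Complex.exp (-(Complex.I * k * x)) * fourierHat g k
    * ((1 / (2 * Real.pi) * ∑' n : ℕ, seriesTerm γ μ ν ρ ω K k t n : ℝ) : ℂ)

end HilferPrabhakar

end

noncomputable section

namespace HilferPrabhakar


/-! ### Convolution on the half-line -/

/-! Taking Fourier transforms in `x` leaves, for each frequency `k`, a scalar Volterra problem in
time with parameter `l = K k²`. Write `a = e^γ_{ρ,μ,ω}`. Prabhakar kernels are series of power
kernels `t^{z-1}/Γ(z)`, and convolving two of them adds both parameters (Beta integral and
Chu-Vandermonde). Hence `p = ∑ (-l)^n e^{γ(n+1)}_{ρ,μ(n+1),ω}` satisfies `p = a - l a * p`, the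
outer integral sends `p` to the symbol `S`, and the inner integral sends `S` to `1 - l ∫ p`. Thus
`S` has initial value `1` and Hilfer-Prabhakar derivative `-l S`.

Existence. Since only `ĝ ∈ L¹` is known, `l p` and `l S` must be bounded uniformly in `l ≥ 0`, both
in `L¹(0,T)` and pointwise by `C / t`. For `γ = 0` the resolvent `p₀` of the fractional integral is
positive (`fractional_resolvent_pos`), which forces `l ∫ p₀ ≤ 1` and `t l p₀ ≤ 1`. In general `a =
a₀ + a₀ * m` with `a₀` the power kernel and `m` independent of `l`, so `r = l p` satisfies `r = r₀ +
n - n * r` with `r₀ = l p₀` and `n = r₀ * m`. A weight `e^{-σt}` makes `n` small in `L¹` and the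
bounds follow (`exists_bound_of_perturbation`). Boundedness of `k² S` then gives two space
derivatives, Fubini gives the equation, Fourier inversion the initial value, and Riemann-Lebesgue
the decay.

Uniqueness. The time primitive `Q` of the difference of two solutions is bounded and satisfies `Q =
κ * Q_xx` with `κ = K a`. Test it against the band-limited functions `bandCos p`, for which the
second derivative of `bandCos p` is `-bandCos (p + 2)`: each use of the equation costs a factor
`1/2` in a weighted norm, while the `L¹` norms of the test functions grow only quadratically. The
averages of `Q` against the nonnegative kernel `bandCos 0` therefore vanish at every centre and
scale, so `Q = 0` (`IsVolterraPair.eq_zero`). The inner integrals then agree for all `t > 0`, hence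
so do the second space derivatives by the equation, and an affine function of `x` tending to `0` is
zero. -/

/-- The convolution `∫_0^t f (t - y) g y dy` on the half-line. -/
def halfConv (f g : ℝ → ℝ) (t : ℝ) : ℝ := ∫ y in (0 : ℝ)..t, f (t - y) * g y

/-- The integral defining `halfConv f g t` converges absolutely. -/
def HalfConvAt (f g : ℝ → ℝ) (t : ℝ) : Prop :=
  IntervalIntegrable (fun y => f (t - y) * g y) volume 0 t

/-- Integrability on `(0, T]` for every `T`. -/
def LocInt (f : ℝ → ℝ) : Prop := ∀ T : ℝ, IntegrableOn f (Ioc 0 T)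

theorem halfConv_comm (f g : ℝ → ℝ) (t : ℝ) : halfConv f g t = halfConv g f t := by
  have := intervalIntegral.integral_comp_sub_left (a := 0) (b := t) (fun y => f (t - y) * g y) t
  simp only [sub_sub_cancel, sub_self, sub_zero] at this
  rw [halfConv, ← this, halfConv]
  simp only [mul_comm]

theorem HalfConvAt.symm {f g : ℝ → ℝ} {t : ℝ} (h : HalfConvAt f g t) : HalfConvAt g f t := by
  unfold HalfConvAt at *
  have := (h.comp_sub_left t).symm
  simpa [mul_comm] using this

theorem halfConv_congr {f f' g g' : ℝ → ℝ} {t : ℝ} (ht : 0 ≤ t) (hf : EqOn f f' (Ioo 0 t))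
    (hg : EqOn g g' (Ioo 0 t)) : halfConv f g t = halfConv f' g' t := by
  refine intervalIntegral.integral_congr_uIoo fun y hy => ?_
  rw [uIoo_of_le ht] at hy
  simp only [hg hy, hf (show t - y ∈ Ioo 0 t from ⟨by linarith [hy.2], by linarith [hy.1]⟩)]

theorem HalfConvAt.iff_integrableOn {f g : ℝ → ℝ} {t : ℝ} (ht : 0 ≤ t) :
    HalfConvAt f g t ↔ IntegrableOn (fun y => f (t - y) * g y) (Ioo 0 t) := by
  unfold HalfConvAt
  rw [intervalIntegrable_iff_integrableOn_Ioo_of_le ht]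

theorem halfConv_add_right {f g g' : ℝ → ℝ} {t : ℝ} (h : HalfConvAt f g t)
    (h' : HalfConvAt f g' t) :
    halfConv f (fun y => g y + g' y) t = halfConv f g t + halfConv f g' t := by
  unfold halfConv
  rw [← intervalIntegral.integral_add h h']
  simp [mul_add]

theorem halfConv_sub_right {f g g' : ℝ → ℝ} {t : ℝ} (h : HalfConvAt f g t)
    (h' : HalfConvAt f g' t) :
    halfConv f (fun y => g y - g' y) t = halfConv f g t - halfConv f g' t := by
  unfold halfConv
  rw [← intervalIntegral.integral_sub h h']
  simp [mul_sub]

theorem halfConv_const_mul_right (c : ℝ) (f g : ℝ → ℝ) (t : ℝ) :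
    halfConv f (fun y => c * g y) t = c * halfConv f g t := by
  unfold halfConv
  rw [← intervalIntegral.integral_const_mul]
  simp only [mul_left_comm]

theorem halfConv_const_mul_left (c : ℝ) (f g : ℝ → ℝ) (t : ℝ) :
    halfConv (fun y => c * f y) g t = c * halfConv f g t := by
  rw [halfConv_comm, halfConv_const_mul_right, halfConv_comm]

theorem halfConv_add_left {f f' g : ℝ → ℝ} {t : ℝ} (h : HalfConvAt f g t)
    (h' : HalfConvAt f' g t) :
    halfConv (fun y => f y + f' y) g t = halfConv f g t + halfConv f' g t := by
  rw [halfConv_comm, halfConv_add_right h.symm h'.symm, halfConv_comm g, halfConv_comm g]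

theorem halfConv_sub_left {f f' g : ℝ → ℝ} {t : ℝ} (h : HalfConvAt f g t)
    (h' : HalfConvAt f' g t) :
    halfConv (fun y => f y - f' y) g t = halfConv f g t - halfConv f' g t := by
  rw [halfConv_comm, halfConv_sub_right h.symm h'.symm, halfConv_comm g, halfConv_comm g]

theorem HalfConvAt.const_mul_right {f g : ℝ → ℝ} {t : ℝ} (c : ℝ) (h : HalfConvAt f g t) :
    HalfConvAt f (fun y => c * g y) t := by
  have := IntervalIntegrable.const_mul h c
  simpa [HalfConvAt, mul_left_comm] using this

theorem abs_halfConv_le {f g : ℝ → ℝ} {t : ℝ} (ht : 0 ≤ t) :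
    |halfConv f g t| ≤ halfConv (fun y => |f y|) (fun y => |g y|) t := by
  have := intervalIntegral.norm_integral_le_integral_norm (f := fun y => f (t - y) * g y)
    (μ := volume) ht
  simpa [halfConv, abs_mul] using this

theorem halfConv_nonneg {f g : ℝ → ℝ} {t : ℝ} (ht : 0 ≤ t) (hf : ∀ s ∈ Ioo 0 t, 0 ≤ f s)
    (hg : ∀ s ∈ Ioo 0 t, 0 ≤ g s) : 0 ≤ halfConv f g t := by
  unfold halfConv
  rw [intervalIntegral.integral_of_le ht, integral_Ioc_eq_integral_Ioo]
  refine setIntegral_nonneg measurableSet_Ioo fun y hy => ?_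
  exact mul_nonneg (hf _ ⟨by linarith [hy.2], by linarith [hy.1]⟩) (hg y hy)

theorem halfConv_one (f : ℝ → ℝ) (t : ℝ) : halfConv (fun _ => 1) f t = ∫ y in (0 : ℝ)..t, f y := by
  simp [halfConv]

/-! #### Comparison with the convolution on the line -/

/-- For functions vanishing on `(-∞, 0]` the integrand on the whole line lives on `(0, t)`, so
half-line statements follow from those for the convolution on the line. `U, V` are kept apart from
`u, v` because truncations agree with the original functions only on a bounded interval. -/
theorem mul_eq_indicator_Ioo {U V u v : ℝ → ℝ} {t : ℝ} (hU0 : ∀ y ≤ 0, U y = 0)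
    (hV0 : ∀ y ≤ 0, V y = 0) (hU : EqOn U u (Ioo 0 t)) (hV : EqOn V v (Ioo 0 t)) (y : ℝ) :
    U (t - y) * V y = indicator (Ioo 0 t) (fun y => u (t - y) * v y) y := by
  by_cases h : y ∈ Ioo 0 t
  · rw [indicator_of_mem h, hV h, hU ⟨by linarith [h.2], by linarith [h.1]⟩]
  · rw [indicator_of_notMem h]
    rcases le_or_gt y 0 with h0 | h0
    · rw [hV0 y h0, mul_zero]
    · rw [hU0 _ (by linarith [not_lt.1 fun h1 => h ⟨h0, h1⟩]), zero_mul]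

theorem convolution_eq_halfConv {U V u v : ℝ → ℝ} {t : ℝ} (ht : 0 ≤ t) (hU0 : ∀ y ≤ 0, U y = 0)
    (hV0 : ∀ y ≤ 0, V y = 0) (hU : EqOn U u (Ioo 0 t)) (hV : EqOn V v (Ioo 0 t)) :
    convolution U V (ContinuousLinearMap.mul ℝ ℝ) volume t = halfConv u v t := by
  rw [convolution_mul_swap]
  simp_rw [mul_eq_indicator_Ioo hU0 hV0 hU hV]
  rw [integral_indicator measurableSet_Ioo, halfConv, intervalIntegral.integral_of_le ht,
    integral_Ioc_eq_integral_Ioo]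

theorem convolutionExistsAt_iff_halfConvAt {U V u v : ℝ → ℝ} {t : ℝ} (ht : 0 ≤ t)
    (hU0 : ∀ y ≤ 0, U y = 0) (hV0 : ∀ y ≤ 0, V y = 0) (hU : EqOn U u (Ioo 0 t))
    (hV : EqOn V v (Ioo 0 t)) :
    ConvolutionExistsAt U V t (ContinuousLinearMap.mul ℝ ℝ) volume ↔ HalfConvAt u v t := by
  rw [convolutionExistsAt_iff_integrable_swap]
  simp only [ContinuousLinearMap.mul_apply']
  simp_rw [mul_eq_indicator_Ioo hU0 hV0 hU hV]
  rw [integrable_indicator_iff measurableSet_Ioo, HalfConvAt.iff_integrableOn ht]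

theorem convolution_eq_zero_of_nonpos {U V : ℝ → ℝ} {t : ℝ} (ht : t ≤ 0)
    (hU0 : ∀ y ≤ 0, U y = 0) (hV0 : ∀ y ≤ 0, V y = 0) :
    convolution U V (ContinuousLinearMap.mul ℝ ℝ) volume t = 0 := by
  rw [convolution_mul_swap]
  rw [← integral_zero ℝ ℝ]
  congr 1
  ext y
  rw [mul_eq_indicator_Ioo (u := U) (v := V) hU0 hV0 (fun _ _ => rfl) (fun _ _ => rfl),
    Ioo_eq_empty (not_lt.2 ht), indicator_empty]

theorem indicator_Ioc_eq_zero (f : ℝ → ℝ) (T : ℝ) : ∀ y ≤ 0, indicator (Ioc 0 T) f y = 0 :=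
  fun _ hy => indicator_of_notMem (fun h => not_lt.2 hy h.1) _

theorem eqOn_indicator_Ioc (f : ℝ → ℝ) {t T : ℝ} (h : t ≤ T) :
    EqOn (indicator (Ioc 0 T) f) f (Ioo 0 t) :=
  fun _ hy => indicator_of_mem (show _ ∈ Ioc 0 T from ⟨hy.1, hy.2.le.trans h⟩) _

theorem convolution_indicator (f g : ℝ → ℝ) {s T : ℝ} (hs : s ∈ Ioc 0 T) :
    convolution (indicator (Ioc 0 T) f) (indicator (Ioc 0 T) g)
      (ContinuousLinearMap.mul ℝ ℝ) volume s = halfConv f g s :=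
  convolution_eq_halfConv hs.1.le (indicator_Ioc_eq_zero _ _) (indicator_Ioc_eq_zero _ _)
    (eqOn_indicator_Ioc f hs.2) (eqOn_indicator_Ioc g hs.2)

theorem convolutionExistsAt_indicator (f g : ℝ → ℝ) {s T : ℝ} (hs : s ∈ Ioc 0 T) :
    ConvolutionExistsAt (indicator (Ioc 0 T) f) (indicator (Ioc 0 T) g) s
      (ContinuousLinearMap.mul ℝ ℝ) volume ↔ HalfConvAt f g s :=
  convolutionExistsAt_iff_halfConvAt hs.1.le (indicator_Ioc_eq_zero _ _)
    (indicator_Ioc_eq_zero _ _) (eqOn_indicator_Ioc f hs.2) (eqOn_indicator_Ioc g hs.2)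

/-! ### Convolution of locally integrable functions: existence almost everywhere, Young's
inequality, associativity. -/

theorem LocInt.integrable_indicator {f : ℝ → ℝ} (hf : LocInt f) (T : ℝ) :
    Integrable (indicator (Ioc 0 T) f) :=
  (integrable_indicator_iff measurableSet_Ioc).2 (hf T)

theorem LocInt.ae_halfConvAt {f g : ℝ → ℝ} (hf : LocInt f) (hg : LocInt g) :
    ∀ᵐ t, 0 < t → HalfConvAt f g t := by
  have h : ∀ n : ℕ, ∀ᵐ t, t ∈ Ioc (0 : ℝ) n → HalfConvAt f g t := fun n => by
    filter_upwards [(hf.integrable_indicator n).ae_convolution_exists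
      (ContinuousLinearMap.mul ℝ ℝ) (hg.integrable_indicator n)] with t ht h'
    exact (convolutionExistsAt_indicator f g h').1 ht
  filter_upwards [ae_all_iff.2 h] with t ht h0
  obtain ⟨n, hn⟩ := exists_nat_ge t
  exact ht n ⟨h0, hn⟩

theorem LocInt.conv {f g : ℝ → ℝ} (hf : LocInt f) (hg : LocInt g) :
    LocInt (halfConv f g) := fun T => by
  have h := (hf.integrable_indicator T).integrable_convolution (ContinuousLinearMap.mul ℝ ℝ)
    (hg.integrable_indicator T)
  exact (h.integrableOn (s := Ioc 0 T)).congr_fun (fun t ht => convolution_indicator f g ht)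
    measurableSet_Ioc

theorem LocInt.abs {f : ℝ → ℝ} (hf : LocInt f) : LocInt (fun t => |f t|) := fun T => (hf T).norm

theorem LocInt.add {f g : ℝ → ℝ} (hf : LocInt f) (hg : LocInt g) :
    LocInt (fun t => f t + g t) := fun T => (hf T).add (hg T)

theorem LocInt.sub {f g : ℝ → ℝ} (hf : LocInt f) (hg : LocInt g) :
    LocInt (fun t => f t - g t) := fun T => (hf T).sub (hg T)

theorem LocInt.const_mul {f : ℝ → ℝ} (hf : LocInt f) (c : ℝ) :
    LocInt (fun t => c * f t) := fun T => (hf T).const_mul c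

theorem LocInt.congr {f g : ℝ → ℝ} (hf : LocInt f) (h : EqOn f g (Ioi 0)) : LocInt g :=
  fun T => (hf T).congr_fun (fun _ ht => h ht.1) measurableSet_Ioc

theorem LocInt.intervalIntegrable {f : ℝ → ℝ} (hf : LocInt f) {s t : ℝ} (hs : 0 ≤ s)
    (ht : 0 ≤ t) : IntervalIntegrable f volume s t := by
  rw [intervalIntegrable_iff, uIoc]
  exact (hf (max s t)).mono_set (Ioc_subset_Ioc_left (le_min hs ht))

/-- Young's inequality on `(0, T]`: the convolution of the truncated absolute values has total
integral equal to the product, and dominates `|f * g|` on `(0, T]`. -/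
theorem LocInt.integral_abs_halfConv_le {f g : ℝ → ℝ} (hf : LocInt f) (hg : LocInt g) {T : ℝ}
    (hT : 0 ≤ T) :
    ∫ t in (0 : ℝ)..T, |halfConv f g t|
      ≤ (∫ t in (0 : ℝ)..T, |f t|) * ∫ t in (0 : ℝ)..T, |g t| := by
  have hF := hf.abs.integrable_indicator T
  have hG := hg.abs.integrable_indicator T
  have hint := integral_convolution (ContinuousLinearMap.mul ℝ ℝ) hF hG
  have hi := hF.integrable_convolution (ContinuousLinearMap.mul ℝ ℝ) hG
  simp only [ContinuousLinearMap.mul_apply', integral_indicator measurableSet_Ioc] at hint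
  rw [intervalIntegral.integral_of_le hT, intervalIntegral.integral_of_le hT,
    intervalIntegral.integral_of_le hT, ← hint]
  calc ∫ t in Ioc 0 T, |halfConv f g t|
      ≤ ∫ t in Ioc 0 T, convolution (indicator (Ioc 0 T) fun t => |f t|)
          (indicator (Ioc 0 T) fun t => |g t|) (ContinuousLinearMap.mul ℝ ℝ) volume t := by
        refine setIntegral_mono_on (hf.conv hg T).norm hi.integrableOn measurableSet_Ioc
          fun t ht => ?_
        rw [convolution_indicator _ _ ht]
        exact abs_halfConv_le ht.1.le
    _ ≤ _ := by
        refine setIntegral_le_integral hi (Eventually.of_forall fun t => ?_)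
        refine integral_nonneg fun y => ?_
        exact mul_nonneg (indicator_nonneg (fun _ _ => abs_nonneg _) _)
          (indicator_nonneg (fun _ _ => abs_nonneg _) _)

/-- Fubini at one fixed time. The hypothesis `H` is absolute convergence of the triple integral at
this `t`; it replaces the almost-everywhere conclusion by a pointwise one. -/
theorem halfConv_assoc {f g h : ℝ → ℝ} (hf : LocInt f) (hg : LocInt g) (hh : LocInt h) {t : ℝ}
    (ht : 0 < t) (H : HalfConvAt (fun y => |f y|) (halfConv (fun y => |g y|) fun y => |h y|) t) :
    halfConv (halfConv f g) h t = halfConv f (halfConv g h) t := by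
  have hn : ∀ u : ℝ → ℝ, (fun x => ‖indicator (Ioc 0 t) u x‖)
      = indicator (Ioc 0 t) fun x => |u x| := fun u => by
    ext x
    exact norm_indicator_eq_indicator_norm _ _
  have hmem : t ∈ Ioc 0 t := ⟨ht, le_rfl⟩
  have key := convolution_assoc (ContinuousLinearMap.mul ℝ ℝ) (ContinuousLinearMap.mul ℝ ℝ)
    (ContinuousLinearMap.mul ℝ ℝ) (ContinuousLinearMap.mul ℝ ℝ)
    (f := indicator (Ioc 0 t) f) (g := indicator (Ioc 0 t) g) (k := indicator (Ioc 0 t) h)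
    (ν := volume) (μ := volume) (x₀ := t) (fun x y z => by simp [mul_assoc])
    (hf.integrable_indicator t).aestronglyMeasurable
    (hg.integrable_indicator t).aestronglyMeasurable
    (hh.integrable_indicator t).aestronglyMeasurable
    ((hf.integrable_indicator t).ae_convolution_exists _ (hg.integrable_indicator t))
    ((hg.integrable_indicator t).norm.ae_convolution_exists _ (hh.integrable_indicator t).norm) ?_
  · have hz : ∀ u v : ℝ → ℝ, ∀ y ≤ 0, convolution (indicator (Ioc 0 t) u)
        (indicator (Ioc 0 t) v) (ContinuousLinearMap.mul ℝ ℝ) volume y = 0 := fun u v y hy =>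
      convolution_eq_zero_of_nonpos hy (indicator_Ioc_eq_zero _ _) (indicator_Ioc_eq_zero _ _)
    rwa [convolution_eq_halfConv ht.le (hz f g) (indicator_Ioc_eq_zero _ _)
        (fun s hs => convolution_indicator f g ⟨hs.1, hs.2.le⟩) (eqOn_indicator_Ioc h le_rfl),
      convolution_eq_halfConv ht.le (indicator_Ioc_eq_zero _ _) (hz g h)
        (eqOn_indicator_Ioc f le_rfl)
        (fun s hs => convolution_indicator g h ⟨hs.1, hs.2.le⟩)] at key
  · simp only [hn]
    refine (convolutionExistsAt_iff_halfConvAt ht.le (indicator_Ioc_eq_zero _ _) (fun y hy =>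
      convolution_eq_zero_of_nonpos hy (indicator_Ioc_eq_zero _ _) (indicator_Ioc_eq_zero _ _))
      (eqOn_indicator_Ioc _ le_rfl)
      (fun s hs => convolution_indicator _ _ ⟨hs.1, hs.2.le⟩)).2 H

theorem LocInt.ae_halfConv_assoc {f g h : ℝ → ℝ} (hf : LocInt f) (hg : LocInt g)
    (hh : LocInt h) :
    ∀ᵐ t, 0 < t → halfConv (halfConv f g) h t
      = halfConv f (halfConv g h) t := by
  filter_upwards [hf.abs.ae_halfConvAt (hg.abs.conv hh.abs)] with t ht h0
  exact halfConv_assoc hf hg hh h0 (ht h0)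



/-! ### An algebra of kernels in which convolutions exist at every point -/

/-- Local integrability on the half-line together with a bound `|f t| ≤ C_T / t` on `(0, T]`. -/
structure Good (f : ℝ → ℝ) : Prop where
  locInt : LocInt f
  bdd : ∀ T, ∃ C, ∀ t ∈ Ioc 0 T, t * |f t| ≤ C

theorem LocInt.comp_sub {f : ℝ → ℝ} (hf : LocInt f) {t : ℝ} (ht : 0 ≤ t) :
    IntervalIntegrable (fun y => f (t - y)) volume 0 t := by
  have := (hf.intervalIntegrable ht le_rfl).comp_sub_left t
  simpa using this

/-- From `t = (t - y) + y` one gets `t |f (t - y) g y| ≤ A |g y| + B |f (t - y)|`, and the right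
side is integrable. This makes the bound `C / t` stable under convolution and gives existence at
every point. -/
theorem halfConvAt_and_bound {f g : ℝ → ℝ} {t A B : ℝ} (ht : 0 < t) (hf : LocInt f)
    (hg : LocInt g) (hA : ∀ s ∈ Ioo 0 t, s * |f s| ≤ A) (hB : ∀ s ∈ Ioo 0 t, s * |g s| ≤ B) :
    HalfConvAt f g t ∧
      t * |halfConv f g t| ≤ A * (∫ s in (0 : ℝ)..t, |g s|) + B * ∫ s in (0 : ℝ)..t, |f s| := by
  have hfi := hf.comp_sub ht.le
  have hgi := hg.intervalIntegrable le_rfl ht.le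
  have hbi : IntervalIntegrable (fun y => A * |g y| + B * |f (t - y)|) volume 0 t :=
    (hgi.abs.const_mul A).add (hfi.abs.const_mul B)
  have hpt : ∀ y ∈ Ioo 0 t, ‖f (t - y) * g y‖ ≤ t⁻¹ * (A * |g y| + B * |f (t - y)|) := by
    intro y hy
    have h1 := mul_le_mul_of_nonneg_right
      (hA (t - y) ⟨by linarith [hy.2], by linarith [hy.1]⟩) (abs_nonneg (g y))
    have h2 := mul_le_mul_of_nonneg_right (hB y hy) (abs_nonneg (f (t - y)))
    rw [Real.norm_eq_abs, abs_mul, ← div_eq_inv_mul, le_div_iff₀ ht]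
    nlinarith
  have hint : HalfConvAt f g t := by
    rw [HalfConvAt.iff_integrableOn ht.le]
    have hb := (intervalIntegrable_iff_integrableOn_Ioo_of_le ht.le).1 (hbi.const_mul t⁻¹)
    refine Integrable.mono' hb ?_ ((ae_restrict_iff' measurableSet_Ioo).2
      (Eventually.of_forall hpt))
    exact ((intervalIntegrable_iff_integrableOn_Ioo_of_le ht.le).1 hfi).aestronglyMeasurable.mul
      ((intervalIntegrable_iff_integrableOn_Ioo_of_le ht.le).1 hgi).aestronglyMeasurable
  refine ⟨hint, ?_⟩
  have h1 : |halfConv f g t| ≤ ∫ y in (0 : ℝ)..t, t⁻¹ * (A * |g y| + B * |f (t - y)|) :=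
    (intervalIntegral.norm_integral_le_integral_norm ht.le).trans
      (intervalIntegral.integral_mono_on_of_le_Ioo ht.le hint.norm (hbi.const_mul _) hpt)
  rw [intervalIntegral.integral_const_mul, intervalIntegral.integral_add (hgi.abs.const_mul A)
    (hfi.abs.const_mul B), intervalIntegral.integral_const_mul,
    intervalIntegral.integral_const_mul] at h1
  have h2 := intervalIntegral.integral_comp_sub_left (a := 0) (b := t) (fun y => |f y|) t
  simp only [sub_self, sub_zero] at h2
  rw [h2, ← div_eq_inv_mul, le_div_iff₀ ht] at h1
  linarith

theorem Good.halfConvAt {f g : ℝ → ℝ} (hf : Good f) (hg : Good g) {t : ℝ} (ht : 0 < t) :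
    HalfConvAt f g t := by
  obtain ⟨A, hA⟩ := hf.bdd t
  obtain ⟨B, hB⟩ := hg.bdd t
  exact (halfConvAt_and_bound ht hf.locInt hg.locInt (fun s hs => hA s ⟨hs.1, hs.2.le⟩)
    (fun s hs => hB s ⟨hs.1, hs.2.le⟩)).1

theorem LocInt.integral_abs_mono {f : ℝ → ℝ} (hf : LocInt f) {t T : ℝ} (ht : 0 ≤ t)
    (h : t ≤ T) : ∫ s in (0 : ℝ)..t, |f s| ≤ ∫ s in (0 : ℝ)..T, |f s| :=
  intervalIntegral.integral_mono_interval le_rfl ht h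
    (Eventually.of_forall fun _ => abs_nonneg _)
    (hf.abs.intervalIntegrable le_rfl (ht.trans h))

theorem integral_abs_nonneg (f : ℝ → ℝ) {t : ℝ} (ht : 0 ≤ t) : 0 ≤ ∫ s in (0 : ℝ)..t, |f s| :=
  intervalIntegral.integral_nonneg ht fun _ _ => abs_nonneg _

theorem mul_abs_halfConv_le {f g : ℝ → ℝ} {t T A B : ℝ} (ht : t ∈ Ioc 0 T) (hf : LocInt f)
    (hg : LocInt g) (hA0 : 0 ≤ A) (hB0 : 0 ≤ B) (hA : ∀ s ∈ Ioc 0 T, s * |f s| ≤ A)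
    (hB : ∀ s ∈ Ioc 0 T, s * |g s| ≤ B) :
    t * |halfConv f g t| ≤ A * (∫ s in (0 : ℝ)..T, |g s|) + B * ∫ s in (0 : ℝ)..T, |f s| := by
  refine (halfConvAt_and_bound ht.1 hf hg (fun s hs => hA s ⟨hs.1, hs.2.le.trans ht.2⟩)
    (fun s hs => hB s ⟨hs.1, hs.2.le.trans ht.2⟩)).2.trans ?_
  exact add_le_add (mul_le_mul_of_nonneg_left (hg.integral_abs_mono ht.1.le ht.2) hA0)
    (mul_le_mul_of_nonneg_left (hf.integral_abs_mono ht.1.le ht.2) hB0)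

theorem Good.exists_nonneg_bound {f : ℝ → ℝ} (hf : Good f) (T : ℝ) :
    ∃ C, 0 ≤ C ∧ ∀ t ∈ Ioc 0 T, t * |f t| ≤ C := by
  obtain ⟨C, hC⟩ := hf.bdd T
  exact ⟨max C 0, le_max_right _ _, fun t ht => (hC t ht).trans (le_max_left _ _)⟩

theorem Good.conv {f g : ℝ → ℝ} (hf : Good f) (hg : Good g) : Good (halfConv f g) := by
  refine ⟨hf.locInt.conv hg.locInt, fun T => ?_⟩
  obtain ⟨A, hA0, hA⟩ := hf.exists_nonneg_bound T
  obtain ⟨B, hB0, hB⟩ := hg.exists_nonneg_bound T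
  exact ⟨_, fun t ht => mul_abs_halfConv_le ht hf.locInt hg.locInt hA0 hB0 hA hB⟩

theorem Good.abs {f : ℝ → ℝ} (hf : Good f) : Good (fun t => |f t|) :=
  ⟨hf.locInt.abs, fun T => by simpa using hf.bdd T⟩

theorem Good.add {f g : ℝ → ℝ} (hf : Good f) (hg : Good g) : Good (fun t => f t + g t) := by
  refine ⟨hf.locInt.add hg.locInt, fun T => ?_⟩
  obtain ⟨A, hA⟩ := hf.bdd T
  obtain ⟨B, hB⟩ := hg.bdd T
  refine ⟨A + B, fun t ht => ?_⟩
  calc t * |f t + g t| ≤ t * (|f t| + |g t|) :=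
        mul_le_mul_of_nonneg_left (abs_add_le _ _) ht.1.le
    _ ≤ A + B := by rw [mul_add]; exact add_le_add (hA t ht) (hB t ht)

theorem Good.const_mul {f : ℝ → ℝ} (hf : Good f) (c : ℝ) : Good (fun t => c * f t) := by
  refine ⟨hf.locInt.const_mul c, fun T => ?_⟩
  obtain ⟨A, hA⟩ := hf.bdd T
  refine ⟨|c| * A, fun t ht => ?_⟩
  rw [abs_mul, mul_left_comm]
  exact mul_le_mul_of_nonneg_left (hA t ht) (abs_nonneg c)

theorem Good.sub {f g : ℝ → ℝ} (hf : Good f) (hg : Good g) : Good (fun t => f t - g t) := by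
  simpa [sub_eq_add_neg] using hf.add (hg.const_mul (-1))

theorem Good.congr {f g : ℝ → ℝ} (hf : Good f) (h : EqOn f g (Ioi 0)) : Good g := by
  refine ⟨hf.locInt.congr h, fun T => ?_⟩
  obtain ⟨A, hA⟩ := hf.bdd T
  exact ⟨A, fun t ht => by rw [← h ht.1]; exact hA t ht⟩

theorem locInt_of_continuous {f : ℝ → ℝ} (hf : Continuous f) : LocInt f := fun T =>
  (hf.integrableOn_Icc (a := 0) (b := T)).mono_set Ioc_subset_Icc_self

theorem good_of_continuous {f : ℝ → ℝ} (hf : Continuous f) : Good f := by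
  refine ⟨locInt_of_continuous hf, fun T => ?_⟩
  obtain ⟨C, hC⟩ := (isCompact_Icc (a := (0 : ℝ)) (b := T)).exists_bound_of_continuousOn
    (f := fun t => t * |f t|) (by fun_prop)
  exact ⟨C, fun t ht => (le_abs_self _).trans (hC t ⟨ht.1.le, ht.2⟩)⟩

theorem good_one : Good (fun _ => 1) := good_of_continuous continuous_const

theorem LocInt.continuous_mul {f g : ℝ → ℝ} (hf : LocInt f) (hg : Continuous g) :
    LocInt (fun t => g t * f t) := fun T => by
  refine ((integrableOn_Icc_iff_integrableOn_Ioc (a := 0) (b := T)).2 (hf T)).continuousOn_mul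
    hg.continuousOn isCompact_Icc |>.mono_set Ioc_subset_Icc_self

theorem Good.continuous_mul {f g : ℝ → ℝ} (hf : Good f) (hg : Continuous g) :
    Good (fun t => g t * f t) := by
  refine ⟨hf.locInt.continuous_mul hg, fun T => ?_⟩
  obtain ⟨A, hA0, hA⟩ := hf.exists_nonneg_bound T
  obtain ⟨C, hC⟩ := (isCompact_Icc (a := (0 : ℝ)) (b := T)).exists_bound_of_continuousOn
    hg.continuousOn
  refine ⟨C * A, fun t ht => ?_⟩
  have h := hC t ⟨ht.1.le, ht.2⟩
  rw [abs_mul, mul_left_comm]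
  exact mul_le_mul h (hA t ht) (by have := ht.1; positivity) ((norm_nonneg _).trans h)

theorem Good.assoc {f g h : ℝ → ℝ} (hf : Good f) (hg : Good g) (hh : Good h) {t : ℝ}
    (ht : 0 < t) : halfConv (halfConv f g) h t = halfConv f (halfConv g h) t :=
  halfConv_assoc hf.locInt hg.locInt hh.locInt ht (hf.abs.halfConvAt (hg.abs.conv hh.abs) ht)

/-- Multiplication by the variable is a derivation of the convolution algebra. -/
theorem mul_halfConv {f g : ℝ → ℝ} {t : ℝ} (h : HalfConvAt (fun s => s * f s) g t)
    (h' : HalfConvAt f (fun s => s * g s) t) :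
    t * halfConv f g t = halfConv (fun s => s * f s) g t + halfConv f (fun s => s * g s) t := by
  unfold halfConv
  rw [← intervalIntegral.integral_add h h', ← intervalIntegral.integral_const_mul]
  congr 1
  ext y
  ring

/-- An exponential is multiplicative, so the weight `e^{-σt}` is an automorphism of the convolution
algebra. Equations may be weighted freely to make kernels small. -/
theorem halfConv_exp_mul (σ : ℝ) (f g : ℝ → ℝ) (t : ℝ) :
    halfConv (fun s => Real.exp (-σ * s) * f s) (fun s => Real.exp (-σ * s) * g s) t
      = Real.exp (-σ * t) * halfConv f g t := by
  unfold halfConv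
  rw [← intervalIntegral.integral_const_mul]
  congr 1
  ext y
  rw [show -σ * t = -σ * (t - y) + -σ * y by ring, Real.exp_add]
  ring

theorem LocInt.continuous_primitive {f : ℝ → ℝ} (hf : LocInt f) (T : ℝ) :
    ContinuousOn (fun t => ∫ s in (0 : ℝ)..t, f s) (Icc 0 T) := by
  rcases le_or_gt 0 T with h | h
  · have := intervalIntegral.continuousOn_primitive_interval (a := 0) (b := T) (f := f)
      (μ := volume) (by rw [uIcc_of_le h, integrableOn_Icc_iff_integrableOn_Ioc]; exact hf T)
    rwa [uIcc_of_le h] at this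
  · simp [Icc_eq_empty (not_le.2 h)]

theorem LocInt.abs_integral_le {f : ℝ → ℝ} (hf : LocInt f) {t T : ℝ} (ht : 0 ≤ t) (h : t ≤ T) :
    |∫ s in (0 : ℝ)..t, f s| ≤ ∫ s in (0 : ℝ)..T, |f s| :=
  (intervalIntegral.abs_integral_le_integral_abs ht).trans (hf.integral_abs_mono ht h)

theorem LocInt.good_primitive {f : ℝ → ℝ} (hf : LocInt f) :
    Good (fun t => ∫ s in (0 : ℝ)..t, f s) := by
  refine ⟨fun T => ?_, fun T => ⟨T * ∫ s in (0 : ℝ)..T, |f s|, fun t ht => ?_⟩⟩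
  · exact ((hf.continuous_primitive T).integrableOn_Icc).mono_set Ioc_subset_Icc_self
  · exact mul_le_mul ht.2 (hf.abs_integral_le ht.1.le ht.2) (abs_nonneg _) (ht.1.le.trans ht.2)



/-! ### Power kernels -/

/-- The kernel `t^{z-1} / Γ(z)` of fractional integration of order `z`. -/
def powKernel (z t : ℝ) : ℝ := t ^ (z - 1) / Real.Gamma z

theorem powKernel_nonneg {z t : ℝ} (hz : 0 < z) (ht : 0 ≤ t) : 0 ≤ powKernel z t :=
  div_nonneg (Real.rpow_nonneg ht _) (Real.Gamma_pos_of_pos hz).le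

theorem powKernel_pos {z t : ℝ} (hz : 0 < z) (ht : 0 < t) : 0 < powKernel z t :=
  div_pos (Real.rpow_pos_of_pos ht _) (Real.Gamma_pos_of_pos hz)

theorem mul_powKernel {z t : ℝ} (ht : 0 < t) : t * powKernel z t = t ^ z / Real.Gamma z := by
  rw [powKernel, ← mul_div_assoc]
  congr 1
  nth_rewrite 1 [← Real.rpow_one t]
  rw [← Real.rpow_add ht]
  congr 1
  ring

theorem powKernel_one {t : ℝ} : powKernel 1 t = 1 := by simp [powKernel]

theorem continuousOn_powKernel (z : ℝ) : ContinuousOn (powKernel z) (Ioi 0) := fun t ht =>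
  ((Real.continuousAt_rpow_const t _ (Or.inl (ne_of_gt ht))).div_const _).continuousWithinAt

theorem locInt_rpow {z : ℝ} (hz : 0 < z) : LocInt (fun t => t ^ (z - 1)) := fun T => by
  rcases le_or_gt 0 T with h | h
  · exact (intervalIntegrable_iff_integrableOn_Ioc_of_le h).1
      (intervalIntegral.intervalIntegrable_rpow' (by linarith))
  · simp [Ioc_eq_empty (not_lt.2 h.le)]

/-- Domination by `t^{z-1}` with `z > 0` near the origin. -/
theorem good_of_abs_le_rpow {f : ℝ → ℝ} {z : ℝ} (hz : 0 < z) (hf : ContinuousOn f (Ioi 0))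
    (h : ∀ T > 0, ∃ C, ∀ t ∈ Ioc 0 T, |f t| ≤ C * t ^ (z - 1)) : Good f := by
  refine ⟨fun T => ?_, fun T => ?_⟩
  · rcases le_or_gt T 0 with hT | hT
    · simp [Ioc_eq_empty (not_lt.2 hT)]
    obtain ⟨C, hC⟩ := h T hT
    exact Integrable.mono' ((locInt_rpow hz).const_mul C T)
      ((hf.mono Ioc_subset_Ioi_self).aestronglyMeasurable measurableSet_Ioc)
      ((ae_restrict_iff' measurableSet_Ioc).2 (Eventually.of_forall hC))
  · rcases le_or_gt T 0 with hT | hT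
    · exact ⟨0, fun t ht => absurd (ht.1.trans_le ht.2) (not_lt.2 hT)⟩
    obtain ⟨C, hC⟩ := h T hT
    refine ⟨|C| * T ^ z, fun t ht => ?_⟩
    have h1 : t * t ^ (z - 1) = t ^ z := by
      nth_rewrite 1 [← Real.rpow_one t]
      rw [← Real.rpow_add ht.1]
      congr 1
      ring
    calc t * |f t| ≤ t * (|C| * t ^ (z - 1)) := by
          refine mul_le_mul_of_nonneg_left ((hC t ht).trans ?_) ht.1.le
          exact mul_le_mul_of_nonneg_right (le_abs_self C) (Real.rpow_nonneg ht.1.le _)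
      _ = |C| * t ^ z := by rw [mul_left_comm, h1]
      _ ≤ |C| * T ^ z := mul_le_mul_of_nonneg_left
          (Real.rpow_le_rpow ht.1.le ht.2 hz.le) (abs_nonneg C)

theorem good_powKernel {z : ℝ} (hz : 0 < z) : Good (powKernel z) := by
  refine good_of_abs_le_rpow hz (continuousOn_powKernel z) fun T _ =>
    ⟨(Real.Gamma z)⁻¹, fun t ht => ?_⟩
  rw [abs_of_nonneg (powKernel_nonneg hz ht.1.le), powKernel, div_eq_inv_mul]

/-- This is the Beta integral, transferred from its complex form. -/
theorem halfConv_powKernel {z w t : ℝ} (hz : 0 < z) (hw : 0 < w) (ht : 0 < t) :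
    halfConv (powKernel z) (powKernel w) t = powKernel (z + w) t := by
  have hb := Complex.betaIntegral_scaled (w : ℂ) (z : ℂ) ht
  rw [Complex.betaIntegral_eq_Gamma_mul_div _ _ (by simpa) (by simpa)] at hb
  have hc : ((∫ y in (0 : ℝ)..t, y ^ (w - 1) * (t - y) ^ (z - 1) : ℝ) : ℂ)
      = ((t ^ (w + z - 1) * (Real.Gamma w * Real.Gamma z / Real.Gamma (w + z)) : ℝ) : ℂ) := by
    rw [← intervalIntegral.integral_ofReal]
    refine (intervalIntegral.integral_congr fun y hy => ?_).trans (hb.trans ?_)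
    · rw [uIcc_of_le ht.le] at hy
      rw [Complex.ofReal_mul, Complex.ofReal_cpow hy.1, Complex.ofReal_cpow (by linarith [hy.2])]
      push_cast
      rfl
    · rw [Complex.ofReal_mul, Complex.ofReal_cpow ht.le, Complex.Gamma_ofReal,
        Complex.Gamma_ofReal, ← Complex.ofReal_add, Complex.Gamma_ofReal]
      push_cast
      rfl
  have hr := Complex.ofReal_injective hc
  have hGz := (Real.Gamma_pos_of_pos hz).ne'
  have hGw := (Real.Gamma_pos_of_pos hw).ne'
  calc halfConv (powKernel z) (powKernel w) t
      = (Real.Gamma z)⁻¹ * (Real.Gamma w)⁻¹ *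
          ∫ y in (0 : ℝ)..t, y ^ (w - 1) * (t - y) ^ (z - 1) := by
        rw [halfConv, ← intervalIntegral.integral_const_mul]
        congr 1
        ext y
        simp only [powKernel]
        ring
    _ = powKernel (z + w) t := by
        rw [hr, powKernel, add_comm w z]
        field_simp

/-- The elementary bound behind all summations of power kernels. -/
theorem mul_powKernel_le {z σ t : ℝ} (hz : 0 < z) (hσ : 0 < σ) (ht : 0 < t) :
    t * powKernel z t ≤ Real.exp (2 * σ * t) * σ ^ (-z) := by
  rw [mul_powKernel ht, div_le_iff₀ (Real.Gamma_pos_of_pos hz)]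
  have hX : 0 < 2 * σ * t := by positivity
  -- `Γ(z + 1) ≥ X ^ z e^{-X}`
  have hΓ : (2 * σ * t) ^ z * Real.exp (-(2 * σ * t)) ≤ z * Real.Gamma z := by
    rw [← Real.Gamma_add_one hz.ne', Real.Gamma_eq_integral (by linarith)]
    have hi := Real.GammaIntegral_convergent (s := z + 1) (by linarith)
    have he : IntegrableOn (fun x => Real.exp (-x)) (Ioi (2 * σ * t)) := integrableOn_exp_neg_Ioi _
    -- Only the tail `x > 2σt` of the Gamma integral is kept; there `x ^ z` is at least `(2σt) ^ z`.
    calc (2 * σ * t) ^ z * Real.exp (-(2 * σ * t))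
        = ∫ x in Ioi (2 * σ * t), Real.exp (-x) * (2 * σ * t) ^ z := by
          rw [integral_mul_const, integral_exp_neg_Ioi, mul_comm]
      _ ≤ ∫ x in Ioi (2 * σ * t), Real.exp (-x) * x ^ (z + 1 - 1) := by
          refine setIntegral_mono_on (he.mul_const _) (hi.mono_set (Ioi_subset_Ioi hX.le))
            measurableSet_Ioi fun x hx => ?_
          rw [add_sub_cancel_right]
          exact mul_le_mul_of_nonneg_left (Real.rpow_le_rpow hX.le (le_of_lt hx) hz.le)
            (Real.exp_pos _).le
      _ ≤ ∫ x in Ioi 0, Real.exp (-x) * x ^ (z + 1 - 1) := by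
          refine setIntegral_mono_set hi ?_ (Ioi_subset_Ioi hX.le).eventuallyLE
          exact (ae_restrict_iff' measurableSet_Ioi).2 (Eventually.of_forall fun x hx =>
            mul_nonneg (Real.exp_pos _).le (Real.rpow_nonneg (le_of_lt hx) _))
  -- The factor `z` in `Γ(z + 1) = z Γ(z)` is absorbed by `2 ^ z`, which is why the exponential
  -- carries `2 * σ` rather than `σ`.
  have hz2 : z ≤ 2 ^ z := by
    have h1 := Real.add_one_le_exp (z * Real.log 2)
    have h2 : Real.exp (z * Real.log 2) = 2 ^ z := by
      rw [Real.rpow_def_of_pos two_pos, mul_comm]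
    have h3 := Real.add_one_le_exp (z - 1)
    have h4 := one_add_mul_self_le_rpow_one_add (s := 1) (by norm_num) (p := z)
    rcases le_or_gt 1 z with h | h
    · have := h4 h
      norm_num at this
      linarith
    · have : (1 : ℝ) ≤ 2 ^ z := Real.one_le_rpow (by norm_num) hz.le
      linarith
  have h2 : z * Real.Gamma z ≤ 2 ^ z * Real.Gamma z :=
    mul_le_mul_of_nonneg_right hz2 (Real.Gamma_pos_of_pos hz).le
  rw [Real.mul_rpow (by positivity) ht.le, Real.mul_rpow (by norm_num) hσ.le] at hΓ
  have h3 : σ ^ z * t ^ z * Real.exp (-(2 * σ * t)) ≤ Real.Gamma z := by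
    have h2z : (0 : ℝ) < 2 ^ z := Real.rpow_pos_of_pos two_pos _
    refine le_of_mul_le_mul_left ?_ h2z
    calc _ = 2 ^ z * σ ^ z * t ^ z * Real.exp (-(2 * σ * t)) := by ring
      _ ≤ _ := hΓ.trans h2
  have hσz : 0 < σ ^ z := Real.rpow_pos_of_pos hσ _
  calc t ^ z = Real.exp (2 * σ * t) * σ ^ (-z) *
        (σ ^ z * t ^ z * Real.exp (-(2 * σ * t))) := by
        rw [Real.rpow_neg hσ.le, Real.exp_neg]
        field_simp
    _ ≤ _ := mul_le_mul_of_nonneg_left h3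
        (mul_nonneg (Real.exp_pos _).le (Real.rpow_nonneg hσ.le _))

/-! ### Series of power kernels -/

/-- The series `∑ c_i t^{z_i - 1} / Γ(z_i)`. -/
def powSeries {ι : Type*} (c z : ι → ℝ) (t : ℝ) : ℝ := ∑' i, c i * powKernel (z i) t

/-- The exponents are bounded below by `z₀ > 0` and the Laplace transform `∑ |c_i| σ^{-z_i}`
converges. -/
structure LaplaceSummable {ι : Type*} (c z : ι → ℝ) (z₀ σ : ℝ) : Prop where
  pos : 0 < z₀
  sigma_pos : 0 < σ
  le : ∀ i, z₀ ≤ z i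
  summable : Summable fun i => |c i| * σ ^ (-z i)

section PowSeries

variable {ι κ : Type*} {c z : ι → ℝ} {d w : κ → ℝ} {z₀ w₀ σ : ℝ}

theorem LaplaceSummable.pos' (h : LaplaceSummable c z z₀ σ) (i : ι) : 0 < z i :=
  h.pos.trans_le (h.le i)

/-- The elementary bound is used at the endpoint `T` only. Passing from `T` to `t` costs `(t / T) ^
z i ≤ (t / T) ^ z₀`, so every term carries the same power of `t` at the origin and the remaining
factor is summable. -/
theorem LaplaceSummable.mul_abs_term_le (h : LaplaceSummable c z z₀ σ) {t T : ℝ}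
    (ht : t ∈ Ioc 0 T) (i : ι) :
    t * |c i * powKernel (z i) t|
      ≤ (t / T) ^ z₀ * (Real.exp (2 * σ * T) * (|c i| * σ ^ (-z i))) := by
  have hT := ht.1.trans_le ht.2
  have hz := h.pos' i
  have h1 := mul_powKernel_le hz h.sigma_pos hT
  rw [mul_powKernel hT] at h1
  have hq : t / T ≤ 1 := (div_le_one hT).2 ht.2
  have h2 : t ^ z i = (t / T) ^ z i * T ^ z i := by
    rw [← Real.mul_rpow (div_nonneg ht.1.le hT.le) hT.le, div_mul_cancel₀ _ hT.ne']
  have h3 : (t / T) ^ z i ≤ (t / T) ^ z₀ :=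
    Real.rpow_le_rpow_of_exponent_ge (div_pos ht.1 hT) hq (h.le i)
  rw [abs_mul, abs_of_nonneg (powKernel_nonneg hz ht.1.le), mul_left_comm, mul_powKernel ht.1, h2,
    mul_div_assoc]
  have h4 : 0 ≤ T ^ z i / Real.Gamma (z i) :=
    div_nonneg (Real.rpow_nonneg hT.le _) (Real.Gamma_pos_of_pos hz).le
  calc |c i| * ((t / T) ^ z i * (T ^ z i / Real.Gamma (z i)))
      ≤ |c i| * ((t / T) ^ z₀ * (Real.exp (2 * σ * T) * σ ^ (-z i))) :=
        mul_le_mul_of_nonneg_left (mul_le_mul h3 h1 h4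
          (Real.rpow_nonneg (div_nonneg ht.1.le hT.le) _)) (abs_nonneg _)
    _ = _ := by ring

theorem LaplaceSummable.abs_term_le (h : LaplaceSummable c z z₀ σ) {t T : ℝ}
    (ht : t ∈ Ioc 0 T) (i : ι) :
    |c i * powKernel (z i) t|
      ≤ T ^ (-z₀) * Real.exp (2 * σ * T) * t ^ (z₀ - 1) * (|c i| * σ ^ (-z i)) := by
  have hT := ht.1.trans_le ht.2
  have h1 := h.mul_abs_term_le ht i
  rw [mul_comm t, ← le_div_iff₀ ht.1] at h1
  refine h1.trans_eq ?_
  rw [Real.div_rpow ht.1.le hT.le, Real.rpow_neg hT.le, Real.rpow_sub ht.1, Real.rpow_one]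
  ring

theorem LaplaceSummable.summable_abs_term (h : LaplaceSummable c z z₀ σ) {t : ℝ} (ht : 0 < t) :
    Summable fun i => |c i * powKernel (z i) t| :=
  Summable.of_nonneg_of_le (fun _ => abs_nonneg _)
    (fun i => h.abs_term_le (T := t) ⟨ht, le_rfl⟩ i) (h.summable.mul_left _)

theorem LaplaceSummable.hasSum (h : LaplaceSummable c z z₀ σ) {t : ℝ} (ht : 0 < t) :
    HasSum (fun i => c i * powKernel (z i) t) (powSeries c z t) :=
  (h.summable_abs_term ht).of_abs.hasSum

theorem LaplaceSummable.abs_powSeries_le (h : LaplaceSummable c z z₀ σ) {t T : ℝ}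
    (ht : t ∈ Ioc 0 T) :
    |powSeries c z t| ≤ T ^ (-z₀) * Real.exp (2 * σ * T) * (∑' i, |c i| * σ ^ (-z i))
      * t ^ (z₀ - 1) := by
  have hs : Summable fun i => ‖c i * powKernel (z i) t‖ := by
    simpa only [Real.norm_eq_abs] using h.summable_abs_term ht.1
  have h1 : |powSeries c z t| ≤ ∑' i, |c i * powKernel (z i) t| := by
    simpa only [Real.norm_eq_abs, powSeries] using norm_tsum_le_tsum_norm hs
  refine h1.trans (((h.summable_abs_term ht.1).tsum_le_tsum (fun i => h.abs_term_le ht i)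
    (h.summable.mul_left _)).trans_eq ?_)
  rw [tsum_mul_left]
  ring

theorem LaplaceSummable.continuousOn (h : LaplaceSummable c z z₀ σ) :
    ContinuousOn (powSeries c z) (Ioi 0) := by
  intro t ht
  have ht0 : (0 : ℝ) < t := ht
  have hm : Icc (t / 2) (t + 1) ∈ 𝓝 t := Icc_mem_nhds (by linarith) (by linarith)
  obtain ⟨B, hB⟩ := (isCompact_Icc (a := t / 2) (b := t + 1)).exists_bound_of_continuousOn
    (f := fun s : ℝ => s ^ (z₀ - 1)) fun s hs =>
      (Real.continuousAt_rpow_const s _ (Or.inl (by linarith [hs.1]))).continuousWithinAt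
  have hc : ContinuousOn (powSeries c z) (Icc (t / 2) (t + 1)) := by
    refine continuousOn_tsum (u := fun i => (t + 1) ^ (-z₀) * Real.exp (2 * σ * (t + 1)) * B
      * (|c i| * σ ^ (-z i))) (fun i => ?_) (h.summable.mul_left _) fun i s hs => ?_
    · exact continuousOn_const.mul ((continuousOn_powKernel _).mono fun s hs =>
        show 0 < s by linarith [hs.1])
    · refine (h.abs_term_le (T := t + 1) ⟨by linarith [hs.1], hs.2⟩ i).trans ?_
      refine mul_le_mul_of_nonneg_right (mul_le_mul_of_nonneg_left
        ((le_abs_self _).trans (hB s hs)) (by positivity)) ?_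
      exact mul_nonneg (abs_nonneg _) (Real.rpow_nonneg h.sigma_pos.le _)
  exact (hc.continuousAt hm).continuousWithinAt

theorem LaplaceSummable.good (h : LaplaceSummable c z z₀ σ) : Good (powSeries c z) :=
  good_of_abs_le_rpow h.pos h.continuousOn fun _ _ => ⟨_, fun _ ht => h.abs_powSeries_le ht⟩

theorem LaplaceSummable.mul (h : LaplaceSummable c z z₀ σ) (h' : LaplaceSummable d w w₀ σ) :
    LaplaceSummable (fun p : ι × κ => c p.1 * d p.2) (fun p => z p.1 + w p.2) (z₀ + w₀) σ := by
  refine ⟨add_pos h.pos h'.pos, h.sigma_pos, fun p => add_le_add (h.le _) (h'.le _), ?_⟩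
  refine (h.summable.mul_of_nonneg h'.summable (fun i => ?_) fun i => ?_).congr fun p => ?_
  · exact mul_nonneg (abs_nonneg _) (Real.rpow_nonneg h.sigma_pos.le _)
  · exact mul_nonneg (abs_nonneg _) (Real.rpow_nonneg h.sigma_pos.le _)
  · rw [neg_add, Real.rpow_add h.sigma_pos, abs_mul]
    ring

/-- Convolution of two series of power kernels. -/
theorem LaplaceSummable.halfConv_eq [Countable ι] [Countable κ] (h : LaplaceSummable c z z₀ σ)
    (h' : LaplaceSummable d w w₀ σ) {t : ℝ} (ht : 0 < t) :
    halfConv (powSeries c z) (powSeries d w) t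
      = powSeries (fun p : ι × κ => c p.1 * d p.2) (fun p => z p.1 + w p.2) t := by
  have hi : ∀ p : ι × κ, HalfConvAt (powKernel (z p.1)) (powKernel (w p.2)) t := fun p =>
    (good_powKernel (h.pos' _)).halfConvAt (good_powKernel (h'.pos' _)) ht
  have key := hasSum_integral_of_summable_integral_norm (μ := volume.restrict (Ioo 0 t))
    (F := fun (p : ι × κ) y => c p.1 * powKernel (z p.1) (t - y) * (d p.2 * powKernel (w p.2) y))
    (fun p => ?_) ?_
  · have e1 : halfConv (powSeries c z) (powSeries d w) t = ∫ y in Ioo 0 t,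
        ∑' p : ι × κ, c p.1 * powKernel (z p.1) (t - y) * (d p.2 * powKernel (w p.2) y) := by
      rw [halfConv, intervalIntegral.integral_of_le ht.le, integral_Ioc_eq_integral_Ioo]
      refine setIntegral_congr_fun measurableSet_Ioo fun y hy => ?_
      have hy' : 0 < t - y := by linarith [hy.2]
      exact (tsum_mul_tsum_of_summable_norm (h.summable_abs_term hy')
        (h'.summable_abs_term hy.1))
    rw [e1, ← key.tsum_eq, powSeries]
    congr 1
    ext p
    rw [← halfConv_powKernel (h.pos' _) (h'.pos' _) ht, halfConv,
      intervalIntegral.integral_of_le ht.le, integral_Ioc_eq_integral_Ioo, ← integral_const_mul]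
    congr 1
    ext y
    ring
  · have := ((HalfConvAt.iff_integrableOn ht.le).1 (hi p)).const_mul (c p.1 * d p.2)
    refine this.congr (Eventually.of_forall fun y => ?_)
    simp only
    ring
  -- The power kernels are nonnegative, so the integrals of the norms are exactly the absolute terms
  -- of the product series.
  · refine ((h.mul h').summable_abs_term ht).congr fun p => ?_
    rw [abs_mul, abs_of_nonneg (powKernel_nonneg ((h.mul h').pos' p) ht.le),
      ← halfConv_powKernel (h.pos' _) (h'.pos' _) ht, halfConv,
      intervalIntegral.integral_of_le ht.le, integral_Ioc_eq_integral_Ioo, ← integral_const_mul]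
    refine setIntegral_congr_fun measurableSet_Ioo fun y hy => ?_
    have hy' : 0 ≤ t - y := by linarith [hy.2]
    simp only [Real.norm_eq_abs, abs_mul, abs_of_nonneg (powKernel_nonneg (h.pos' p.1) hy'),
      abs_of_nonneg (powKernel_nonneg (h'.pos' p.2) hy.1.le)]
    ring

end PowSeries



/-! ### Prabhakar kernels as series of power kernels -/

/-- The coefficient `(γ)_r / r!`. -/
def pochCoeff (γ : ℝ) (r : ℕ) : ℝ := (ascPochhammer ℝ r).eval γ / (r.factorial : ℝ)

theorem pochCoeff_zero (γ : ℝ) : pochCoeff γ 0 = 1 := by simp [pochCoeff]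

theorem pochCoeff_eq_multichoose (γ : ℝ) (r : ℕ) : pochCoeff γ r = Ring.multichoose γ r := by
  have h := Ring.factorial_nsmul_multichoose_eq_ascPochhammer γ r
  rw [Polynomial.ascPochhammer_smeval_eq_eval, nsmul_eq_mul] at h
  rw [pochCoeff, ← h, mul_div_cancel_left₀ _ (Nat.cast_ne_zero.2 r.factorial_ne_zero)]

/-- Reflection to the binomial coefficients of `-γ`, for which the Vandermonde identity is
available. -/
theorem choose_neg_eq (γ : ℝ) (r : ℕ) : Ring.choose (-γ) r = (-1) ^ r * pochCoeff γ r := by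
  rw [Ring.choose_neg, ← Ring.multichoose_eq, pochCoeff_eq_multichoose, Int.negOnePow_def]
  rcases Nat.even_or_odd r with h | h
  · simp [h.neg_one_pow]
  · simp [h.neg_one_pow]

/-- The Chu-Vandermonde identity for rising factorials. -/
theorem pochCoeff_add (γ δ : ℝ) (r : ℕ) :
    pochCoeff (γ + δ) r
      = ∑ p ∈ Finset.HasAntidiagonal.antidiagonal r, pochCoeff γ p.1 * pochCoeff δ p.2 := by
  have h := Ring.add_choose_eq r (Commute.all (-γ) (-δ))
  rw [← neg_add, choose_neg_eq] at h
  have h1 : ((-1 : ℝ) ^ r) * (-1) ^ r = 1 := by rw [← mul_pow]; simp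
  calc pochCoeff (γ + δ) r = (-1) ^ r * ((-1) ^ r * pochCoeff (γ + δ) r) := by
        rw [← mul_assoc, h1, one_mul]
    _ = _ := by
        rw [h, Finset.mul_sum]
        refine Finset.sum_congr rfl fun p hp => ?_
        rw [choose_neg_eq, choose_neg_eq]
        calc _ = (-1 : ℝ) ^ r * (-1) ^ (p.1 + p.2) * (pochCoeff γ p.1 * pochCoeff δ p.2) := by
              rw [pow_add]; ring
          _ = _ := by rw [Finset.HasAntidiagonal.mem_antidiagonal.1 hp, h1, one_mul]

theorem pochCoeff_succ (γ : ℝ) (r : ℕ) :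
    pochCoeff γ (r + 1) = pochCoeff γ r * ((γ + r) / (r + 1)) := by
  rw [pochCoeff, pochCoeff, ascPochhammer_succ_eval, Nat.factorial_succ]
  push_cast
  have := Nat.cast_ne_zero (R := ℝ).2 r.factorial_ne_zero
  field_simp

theorem abs_pochCoeff_le {γ c : ℝ} (h : |γ| ≤ c) (r : ℕ) : |pochCoeff γ r| ≤ pochCoeff c r := by
  induction r with
  | zero => simp [pochCoeff_zero]
  | succ r ih =>
    rw [pochCoeff_succ, pochCoeff_succ, abs_mul]
    refine mul_le_mul ih ?_ (abs_nonneg _) ((abs_nonneg _).trans ih)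
    rw [abs_div, abs_of_pos (show (0 : ℝ) < r + 1 by positivity)]
    refine div_le_div_of_nonneg_right ?_ (by positivity)
    refine (abs_add_le _ _).trans (add_le_add h ?_)
    simp

theorem pochCoeff_natCast_le (N r : ℕ) : pochCoeff N r ≤ 2 ^ (N + r) := by
  have h : pochCoeff (N : ℝ) r = ((N + r - 1).choose r : ℕ) := by
    rw [pochCoeff, ← ascPochhammer_eval_cast, ascPochhammer_nat_eq_ascFactorial,
      Nat.ascFactorial_eq_factorial_mul_choose', Nat.cast_mul,
      mul_div_cancel_left₀ _ (Nat.cast_ne_zero.2 r.factorial_ne_zero)]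
  rw [h]
  calc (((N + r - 1).choose r : ℕ) : ℝ) ≤ ((2 ^ (N + r - 1) : ℕ) : ℝ) :=
        Nat.cast_le.2 (Nat.choose_le_two_pow _ _)
    _ ≤ 2 ^ (N + r) := by
        push_cast
        exact pow_le_pow_right₀ (by norm_num) (Nat.sub_le _ _)

/-- Round `c` up to an integer `N` and bound a binomial coefficient by `2 ^ (N + r)`. The growth is
exponential in `c` as well as in `r`, so along `γ n + δ` it contributes only a geometric factor `(2
^ γ) ^ n`. -/
theorem abs_pochCoeff_le_two_rpow {γ c : ℝ} (h : |γ| ≤ c) (r : ℕ) :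
    |pochCoeff γ r| ≤ 2 ^ (c + 1) * 2 ^ r := by
  have hc : 0 ≤ c := (abs_nonneg _).trans h
  refine (abs_pochCoeff_le (h.trans (Nat.le_ceil c)) r).trans ((pochCoeff_natCast_le _ _).trans ?_)
  rw [pow_add, ← Real.rpow_natCast 2 ⌈c⌉₊]
  refine mul_le_mul_of_nonneg_right ?_ (by positivity)
  exact Real.rpow_le_rpow_of_exponent_le (by norm_num) (Nat.ceil_lt_add_one hc).le

/-! ### The double series and its algebra under convolution. -/

/-- Coefficients of the double series `∑ (-l)^n e^{γ n + δ}_{ρ, μ n + β, ω}`. -/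
def dblCoeff (γ δ ω l : ℝ) (p : ℕ × ℕ) : ℝ :=
  (-l) ^ p.1 * (pochCoeff (γ * p.1 + δ) p.2 * ω ^ p.2)

/-- Exponents of the double series `∑ (-l)^n e^{γ n + δ}_{ρ, μ n + β, ω}`. -/
def dblExp (μ β ρ : ℝ) (p : ℕ × ℕ) : ℝ := ρ * p.2 + (μ * p.1 + β)

/-- The resolvent-type series `∑ (-l)^n e^{γ n + δ}_{ρ, μ n + β, ω}(t)`. -/
def resolventSeries (γ δ μ β ρ ω l : ℝ) : ℝ → ℝ :=
  powSeries (dblCoeff γ δ ω l) (dblExp μ β ρ)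

/-- The Laplace-transformed double series is dominated by a product of two geometric series, whose
ratios are the quantities in `h1` and `h2`. -/
theorem laplaceSummable_dbl {γ δ μ β ρ ω l σ : ℝ} (hγ : 0 ≤ γ) (hμ : 0 < μ) (hβ : 0 < β)
    (hρ : 0 < ρ) (hσ : 0 < σ) (h1 : 2 * |ω| * σ ^ (-ρ) < 1) (h2 : |l| * 2 ^ γ * σ ^ (-μ) < 1) :
    LaplaceSummable (dblCoeff γ δ ω l) (dblExp μ β ρ) β σ := by
  refine ⟨hβ, hσ, fun p => ?_, ?_⟩
  · have : 0 ≤ ρ * (p.2 : ℝ) + μ * p.1 := by positivity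
    unfold dblExp
    linarith
  · have hs := (summable_geometric_of_lt_one (by positivity) h2).mul_of_nonneg
      (summable_geometric_of_lt_one (by positivity) h1) (fun n => by positivity)
      (fun n => by positivity)
    refine (hs.mul_left (2 ^ (|δ| + 1) * σ ^ (-β))).of_nonneg_of_le
      (fun p => by positivity) fun p => ?_
    have hc : |γ * p.1 + δ| ≤ γ * p.1 + |δ| :=
      (abs_add_le _ _).trans (by rw [abs_of_nonneg (by positivity)])
    have hb := abs_pochCoeff_le_two_rpow hc p.2
    have e1 : σ ^ (-dblExp μ β ρ p) = σ ^ (-β) * (σ ^ (-μ)) ^ p.1 * (σ ^ (-ρ)) ^ p.2 := by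
      rw [← Real.rpow_natCast (σ ^ (-μ)), ← Real.rpow_natCast (σ ^ (-ρ)), ← Real.rpow_mul hσ.le,
        ← Real.rpow_mul hσ.le, ← Real.rpow_add hσ, ← Real.rpow_add hσ, dblExp]
      congr 1
      ring
    have e2 : (2 : ℝ) ^ (γ * p.1 + |δ| + 1) = 2 ^ (|δ| + 1) * (2 ^ γ) ^ p.1 := by
      rw [← Real.rpow_natCast (2 ^ γ), ← Real.rpow_mul (by norm_num), ← Real.rpow_add (by norm_num)]
      congr 1
      ring
    rw [e2] at hb
    rw [e1, dblCoeff, abs_mul, abs_mul, abs_pow, abs_pow, abs_neg]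
    calc |l| ^ p.1 * (|pochCoeff (γ * p.1 + δ) p.2| * |ω| ^ p.2)
          * (σ ^ (-β) * (σ ^ (-μ)) ^ p.1 * (σ ^ (-ρ)) ^ p.2)
        ≤ |l| ^ p.1 * ((2 ^ (|δ| + 1) * (2 ^ γ) ^ p.1 * 2 ^ p.2) * |ω| ^ p.2)
          * (σ ^ (-β) * (σ ^ (-μ)) ^ p.1 * (σ ^ (-ρ)) ^ p.2) := by gcongr
      _ = _ := by simp only [mul_pow]; ring

theorem tendsto_const_mul_rpow_neg_atTop {a : ℝ} (ha : 0 < a) (C : ℝ) :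
    Tendsto (fun σ : ℝ => C * σ ^ (-a)) atTop (𝓝 0) := by
  simpa using (tendsto_rpow_neg_atTop ha).const_mul C

/-- Both ratios tend to `0` as `σ → ∞`. A single `σ` serves all `|l| ≤ L`, `δ` and `β`: this allows
two such series to be convolved and gives uniformity on compact sets of `l`. -/
theorem exists_laplaceSummable_dbl {γ μ ρ : ℝ} (hγ : 0 ≤ γ) (hμ : 0 < μ) (hρ : 0 < ρ)
    (ω L : ℝ) : ∃ σ > 0, ∀ l, |l| ≤ L → ∀ δ β, 0 < β →
      LaplaceSummable (dblCoeff γ δ ω l) (dblExp μ β ρ) β σ := by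
  have h1 := (tendsto_const_mul_rpow_neg_atTop hρ (2 * |ω|)).eventually_lt_const one_pos
  have h2 := (tendsto_const_mul_rpow_neg_atTop hμ (L * 2 ^ γ)).eventually_lt_const one_pos
  obtain ⟨σ, hσ, hσ1, hσ2⟩ := ((eventually_gt_atTop (0 : ℝ)).and (h1.and h2)).exists
  refine ⟨σ, hσ, fun l hl δ β hβ => laplaceSummable_dbl hγ hμ hβ hρ hσ hσ1 (lt_of_le_of_lt ?_ hσ2)⟩
  gcongr

theorem resolventSeries_hasSum {γ μ β ρ : ℝ} (hγ : 0 ≤ γ) (hμ : 0 < μ) (hρ : 0 < ρ)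
    (δ ω l : ℝ) (hβ : 0 < β) {t : ℝ} (ht : 0 < t) :
    HasSum (fun p => dblCoeff γ δ ω l p * powKernel (dblExp μ β ρ p) t)
      (resolventSeries γ δ μ β ρ ω l t) := by
  obtain ⟨σ, _, h⟩ := exists_laplaceSummable_dbl hγ hμ hρ ω |l|
  exact (h l le_rfl δ β hβ).hasSum ht

theorem good_resolventSeries {γ μ β ρ : ℝ} (hγ : 0 ≤ γ) (hμ : 0 < μ) (hρ : 0 < ρ)
    (δ ω l : ℝ) (hβ : 0 < β) : Good (resolventSeries γ δ μ β ρ ω l) := by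
  obtain ⟨σ, _, h⟩ := exists_laplaceSummable_dbl hγ hμ hρ ω |l|
  exact (h l le_rfl δ β hβ).good

theorem continuousOn_resolventSeries {γ μ β ρ : ℝ} (hγ : 0 ≤ γ) (hμ : 0 < μ) (hρ : 0 < ρ)
    (δ ω l : ℝ) (hβ : 0 < β) : ContinuousOn (resolventSeries γ δ μ β ρ ω l) (Ioi 0) := by
  obtain ⟨σ, _, h⟩ := exists_laplaceSummable_dbl hγ hμ hρ ω |l|
  exact (h l le_rfl δ β hβ).continuousOn

theorem prabhakar_term_eq (γ ρ μ ω : ℝ) {t : ℝ} (ht : 0 < t) (r : ℕ) :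
    t ^ (μ - 1) * mittagLefflerTerm γ ρ μ (ω * t ^ ρ) r
      = pochCoeff γ r * ω ^ r * powKernel (ρ * r + μ) t := by
  have : t ^ (ρ * r + μ - 1) = t ^ (μ - 1) * (t ^ ρ) ^ r := by
    rw [← Real.rpow_natCast (t ^ ρ), ← Real.rpow_mul ht.le, ← Real.rpow_add ht]
    congr 1
    ring
  rw [mittagLefflerTerm, pochCoeff, powKernel, this, mul_pow]
  ring

theorem prabhakarKernel_eq_tsum (γ ρ μ ω : ℝ) {t : ℝ} (ht : 0 < t) :
    prabhakarKernel γ ρ μ ω t = ∑' r : ℕ, pochCoeff γ r * ω ^ r * powKernel (ρ * r + μ) t := by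
  rw [prabhakarKernel, mittagLeffler, ← tsum_mul_left]
  congr 1
  ext r
  exact prabhakar_term_eq γ ρ μ ω ht r

theorem resolventSeries_eq_tsum {γ μ β ρ : ℝ} (hγ : 0 ≤ γ) (hμ : 0 < μ) (hρ : 0 < ρ)
    (δ ω l : ℝ) (hβ : 0 < β) {t : ℝ} (ht : 0 < t) :
    resolventSeries γ δ μ β ρ ω l t
      = ∑' n : ℕ, (-l) ^ n * prabhakarKernel (γ * n + δ) ρ (μ * n + β) ω t := by
  have h := resolventSeries_hasSum hγ hμ hρ δ ω l hβ ht
  rw [← h.tsum_eq, h.summable.tsum_prod]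
  congr 1
  ext n
  rw [prabhakarKernel_eq_tsum _ _ _ _ ht, ← tsum_mul_left]
  congr 1
  ext r
  simp only [dblCoeff, dblExp]
  ring

/-- At `l = 0` only `n = 0` survives, so facts about single Prabhakar kernels are special cases of
those about resolvent series; `γ` and `μ` then play no role and are set to `0` and `1` below. -/
theorem resolventSeries_zero {γ μ β ρ : ℝ} (hγ : 0 ≤ γ) (hμ : 0 < μ) (hρ : 0 < ρ)
    (δ ω : ℝ) (hβ : 0 < β) {t : ℝ} (ht : 0 < t) :
    resolventSeries γ δ μ β ρ ω 0 t = prabhakarKernel δ ρ β ω t := by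
  rw [resolventSeries_eq_tsum hγ hμ hρ δ ω 0 hβ ht, tsum_eq_single 0]
  · simp
  · intro n hn
    simp [hn]

theorem good_prabhakarKernel {ρ β : ℝ} (hρ : 0 < ρ) (δ ω : ℝ) (hβ : 0 < β) :
    Good (prabhakarKernel δ ρ β ω) :=
  (good_resolventSeries le_rfl one_pos hρ δ ω 0 hβ).congr fun _ ht =>
    resolventSeries_zero le_rfl one_pos hρ δ ω hβ ht

/-- Split off `n = 0` and reindex. As convolution with a Prabhakar kernel shifts the parameters in
the same way, this is the resolvent equation in disguise. -/
theorem resolventSeries_shift {γ μ β ρ : ℝ} (hγ : 0 ≤ γ) (hμ : 0 < μ) (hρ : 0 < ρ)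
    (δ ω l : ℝ) (hβ : 0 < β) {t : ℝ} (ht : 0 < t) :
    resolventSeries γ δ μ β ρ ω l t = prabhakarKernel δ ρ β ω t
      - l * resolventSeries γ (δ + γ) μ (β + μ) ρ ω l t := by
  have hs : Summable fun n : ℕ => (-l) ^ n * prabhakarKernel (γ * n + δ) ρ (μ * n + β) ω t := by
    refine (resolventSeries_hasSum hγ hμ hρ δ ω l hβ ht).summable.prod.congr fun n => ?_
    rw [prabhakarKernel_eq_tsum _ _ _ _ ht, ← tsum_mul_left]
    congr 1
    ext r
    simp only [dblCoeff, dblExp]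
    ring
  rw [resolventSeries_eq_tsum hγ hμ hρ δ ω l hβ ht, hs.tsum_eq_zero_add,
    resolventSeries_eq_tsum hγ hμ hρ _ ω l (add_pos hβ hμ) ht, ← tsum_mul_left, sub_eq_add_neg,
    ← tsum_neg]
  congr 1
  · simp
  · congr 1
    ext n
    push_cast
    rw [pow_succ, show γ * (n + 1) + δ = γ * n + (δ + γ) by ring,
      show μ * (n + 1) + β = μ * n + (β + μ) by ring]
    ring

theorem tsum_prod_eq_tsum_antidiagonal {f : ℕ × ℕ → ℝ} (hf : Summable f) :
    ∑' p, f p = ∑' m, ∑ p ∈ Finset.HasAntidiagonal.antidiagonal m, f p := by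
  rw [← (Finset.HasAntidiagonal.sigmaAntidiagonalEquivProd (A := ℕ)).tsum_eq f]
  have h : Summable fun x : (n : ℕ) × Finset.HasAntidiagonal.antidiagonal n =>
      f (Finset.HasAntidiagonal.sigmaAntidiagonalEquivProd x) :=
    (Finset.HasAntidiagonal.sigmaAntidiagonalEquivProd (A := ℕ)).summable_iff.2 hf
  rw [h.tsum_sigma]
  congr 1
  ext m
  rw [tsum_fintype, ← Finset.sum_coe_sort (Finset.HasAntidiagonal.antidiagonal m) f]
  rfl

/-- Convolution with a Prabhakar kernel shifts the parameters of a resolvent series. -/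
theorem halfConv_prabhakarKernel_resolventSeries {γ μ β ρ α : ℝ} (hγ : 0 ≤ γ) (hμ : 0 < μ)
    (hρ : 0 < ρ) (δ ε ω l : ℝ) (hβ : 0 < β) (hα : 0 < α) {t : ℝ} (ht : 0 < t) :
    halfConv (prabhakarKernel ε ρ α ω) (resolventSeries γ δ μ β ρ ω l) t
      = resolventSeries γ (δ + ε) μ (β + α) ρ ω l t := by
  obtain ⟨σ, hσ, h⟩ := exists_laplaceSummable_dbl hγ hμ hρ ω |l|
  have hd := h l le_rfl δ β hβ
  have hk : LaplaceSummable (fun r : ℕ => pochCoeff ε r * ω ^ r) (fun r : ℕ => ρ * r + α) α σ := by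
    have h0 := h 0 (by simp) ε α hα
    refine ⟨hα, hσ, fun r => by have : 0 ≤ ρ * (r : ℝ) := by positivity
                                linarith, ?_⟩
    refine (h0.summable.prod_factor 0).congr fun r => ?_
    simp [dblCoeff, dblExp]
  have e0 : EqOn (prabhakarKernel ε ρ α ω)
      (powSeries (fun r : ℕ => pochCoeff ε r * ω ^ r) (fun r : ℕ => ρ * r + α)) (Ioo 0 t) :=
    fun s hs => prabhakarKernel_eq_tsum ε ρ α ω hs.1
  rw [halfConv_congr ht.le e0 (fun _ _ => rfl), resolventSeries, hk.halfConv_eq hd ht]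
  have hprod := ((hk.mul hd).hasSum ht).summable
  have h' := resolventSeries_hasSum hγ hμ hρ (δ + ε) ω l (add_pos hβ hα) ht
  rw [← h'.tsum_eq, h'.summable.tsum_prod, powSeries]
  -- The product series is indexed by `(r, (n, m))`. Bringing `n` to the front lets the two
  -- Mittag-Leffler indices be summed along antidiagonals, where Chu-Vandermonde applies.
  let e : ℕ × ℕ × ℕ ≃ ℕ × ℕ × ℕ :=
    ⟨fun p => (p.2.1, p.1, p.2.2), fun p => (p.2.1, p.1, p.2.2), fun _ => rfl, fun _ => rfl⟩
  rw [← e.tsum_eq]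
  have hprod' := e.summable_iff.2 hprod
  have hprod'' := hprod'
  simp only [Function.comp_def] at hprod''
  rw [hprod''.tsum_prod]
  congr 1
  ext n
  rw [tsum_prod_eq_tsum_antidiagonal (hprod''.prod_factor n)]
  congr 1
  ext m
  rw [dblCoeff, show γ * ((n, m) : ℕ × ℕ).1 + (δ + ε) = ε + (γ * n + δ) by simp; ring,
    pochCoeff_add, Finset.sum_mul, Finset.mul_sum, Finset.sum_mul]
  refine Finset.sum_congr rfl fun p hp => ?_
  have hm : p.1 + p.2 = m := Finset.HasAntidiagonal.mem_antidiagonal.1 hp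
  subst hm
  simp only [e, Equiv.coe_fn_mk, dblCoeff, dblExp]
  push_cast
  rw [show ρ * (p.1 : ℝ) + α + (ρ * p.2 + (μ * n + β)) = ρ * (p.1 + p.2) + (μ * n + (β + α)) by
    ring]
  ring

/-- The semigroup property of Prabhakar kernels. -/
theorem halfConv_prabhakarKernel {β ρ α : ℝ} (hρ : 0 < ρ) (δ ε ω : ℝ) (hβ : 0 < β) (hα : 0 < α)
    {t : ℝ} (ht : 0 < t) :
    halfConv (prabhakarKernel ε ρ α ω) (prabhakarKernel δ ρ β ω) t
      = prabhakarKernel (δ + ε) ρ (β + α) ω t := by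
  rw [← resolventSeries_zero le_rfl one_pos hρ (δ + ε) ω (add_pos hβ hα) ht,
    ← halfConv_prabhakarKernel_resolventSeries le_rfl one_pos hρ δ ε ω 0 hβ hα ht]
  exact halfConv_congr ht.le (fun _ _ => rfl) fun s hs =>
    (resolventSeries_zero le_rfl one_pos hρ δ ω hβ hs.1).symm

theorem prabhakarKernel_zero (ρ β ω : ℝ) {t : ℝ} (ht : 0 < t) :
    prabhakarKernel 0 ρ β ω t = powKernel β t := by
  rw [prabhakarKernel_eq_tsum _ _ _ _ ht, tsum_eq_single 0]
  · simp [pochCoeff]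
  · intro n hn
    simp [pochCoeff, ascPochhammer_ne_zero_eval_zero _ hn]



/-! ### Resolvents of the fractional integral -/

/-- Solving `y + l a * y = x` through the resolvent `p` of `a`. -/
theorem eq_sub_halfConv_of_resolvent {a p x y : ℝ → ℝ} {l : ℝ} (ha : Good a) (hp : Good p)
    (hy : Good y) (hap : ∀ t > 0, p t = a t - l * halfConv a p t)
    (hxy : ∀ t > 0, x t = y t + l * halfConv a y t) {t : ℝ} (ht : 0 < t) :
    y t = x t - l * halfConv p x t := by
  have hay := ha.conv hy
  have hpa := hp.conv ha
  -- In fact `p * x = a * y`: expand `p * (y + l a * y)` and replace the first `p` by `a - l p * a`;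
  -- the terms `l p * a * y` cancel.
  have e1 : halfConv p x t = halfConv a y t := by
    rw [halfConv_congr ht.le (fun _ _ => rfl) (fun s hs => hxy s hs.1),
      halfConv_add_right (hp.halfConvAt hy ht) ((hp.halfConvAt hay ht).const_mul_right l),
      halfConv_const_mul_right, ← hp.assoc ha hy ht,
      halfConv_congr (f := p) (f' := fun s => a s - l * halfConv p a s) (g := y) (g' := y) ht.le
        (fun s hs => by simpa only [halfConv_comm p a] using hap s hs.1) (fun _ _ => rfl),
      halfConv_sub_left (ha.halfConvAt hy ht) ((hpa.const_mul l).halfConvAt hy ht),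
      halfConv_const_mul_left]
    ring
  rw [e1, hxy t ht]
  ring

section FractionalResolvent

variable {μ l : ℝ} {p : ℝ → ℝ}

/-- One has `(t₀ - s) t ≥ t₀ (t - s)`, and the negative exponent `μ - 1` reverses the inequality.
This is the form in which log-convexity of the kernel is used. -/
theorem powKernel_ratio {t t₀ s : ℝ} (hμ : 0 < μ) (hμ1 : μ < 1) (h0 : 0 ≤ s) (hs : s < t)
    (ht : t < t₀) : powKernel μ (t₀ - s) ≤ powKernel μ t₀ / powKernel μ t * powKernel μ (t - s) := by
  have hG := Real.Gamma_pos_of_pos hμ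
  have ht0 : 0 < t := h0.trans_lt hs
  have h1 : 0 < t - s := sub_pos.2 hs
  have h2 : 0 < t₀ - s := by linarith
  have h3 : 0 < t₀ := by linarith
  have key : (t₀ - s) ^ (μ - 1) * t ^ (μ - 1) ≤ t₀ ^ (μ - 1) * (t - s) ^ (μ - 1) := by
    rw [← Real.mul_rpow h2.le ht0.le, ← Real.mul_rpow h3.le h1.le]
    refine Real.rpow_le_rpow_of_nonpos (by positivity) ?_ (by linarith)
    nlinarith
  have ht' : 0 < t ^ (μ - 1) := Real.rpow_pos_of_pos ht0 _
  simp only [powKernel]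
  rw [div_div_div_cancel_right₀ hG.ne', ← mul_div_assoc]
  refine div_le_div_of_nonneg_right ?_ hG.le
  rw [div_mul_eq_mul_div, le_div_iff₀ ht']
  exact key

/-- The resolvent of the fractional integral is positive: the kernel is log-convex, so that the
resolvent cannot have a first zero. -/
theorem fractional_resolvent_pos (hμ : 0 < μ) (hμ1 : μ < 1) (hl : 0 ≤ l)
    (hp : Good p) (hc : ContinuousOn p (Ioi 0))
    (hr : ∀ t > 0, p t = powKernel μ t - l * halfConv (powKernel μ) p t)
    (h0 : ∀ᶠ t in 𝓝[>] 0, 0 < p t) {t : ℝ} (ht : 0 < t) : 0 < p t := by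
  by_contra hneg
  push Not at hneg
  obtain ⟨ε, hε, hεp⟩ := (mem_nhdsGT_iff_exists_Ioo_subset (a := (0 : ℝ))).1 h0
  have hε0 : (0 : ℝ) < ε := hε
  -- the first zero
  obtain ⟨t₀, ⟨⟨ht₀ε, ht₀t⟩, ht₀p⟩, hmin⟩ : ∃ t₀, (t₀ ∈ Icc (ε / 2) (max t ε) ∧ p t₀ ≤ 0) ∧
      ∀ s ∈ Icc (ε / 2) (max t ε), p s ≤ 0 → t₀ ≤ s := by
    have hcl : IsCompact (Icc (ε / 2) (max t ε) ∩ p ⁻¹' Iic 0) := by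
      refine (isCompact_Icc).of_isClosed_subset ?_ inter_subset_left
      exact (hc.mono fun s hs => show (0 : ℝ) < s by linarith [hs.1]).preimage_isClosed_of_isClosed
        isClosed_Icc isClosed_Iic
    have hmem : t ∈ Icc (ε / 2) (max t ε) ∩ p ⁻¹' Iic 0 := by
      refine ⟨⟨?_, le_max_left _ _⟩, hneg⟩
      by_contra hlt
      push Not at hlt
      exact absurd (hεp (show t ∈ Ioo 0 ε from ⟨ht, by linarith⟩)) (not_lt.2 hneg)
    obtain ⟨t₀, ht₀, hle⟩ := hcl.exists_isMinOn ⟨t, hmem⟩ continuousOn_id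
    exact ⟨t₀, ⟨ht₀.1, ht₀.2⟩, fun s hs hs' => hle ⟨hs, hs'⟩⟩
  have ht₀ : 0 < t₀ := by linarith
  have hpos : ∀ s, 0 < s → s < t₀ → 0 < p s := by
    intro s hs hst
    rcases lt_or_ge s ε with h | h
    · exact hεp ⟨hs, h⟩
    · by_contra hn
      push Not at hn
      exact absurd (hmin s ⟨by linarith, by linarith⟩ hn) (not_le.2 hst)
  have ha := good_powKernel hμ
  have hint := ha.halfConvAt hp ht₀
  -- the key inequality for `s < t₀`
  have key : ∀ s, 0 < s → s < t₀ → powKernel μ t₀ / powKernel μ s * p s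
      ≤ l * ∫ y in s..t₀, powKernel μ (t₀ - y) * p y := by
    intro s hs hst
    have hpk := powKernel_pos hμ hs
    have i1 : IntervalIntegrable (fun y => powKernel μ (t₀ - y) * p y) volume 0 s :=
      IntervalIntegrable.mono_set hint (by
        rw [uIcc_of_le hs.le, uIcc_of_le ht₀.le]; exact Icc_subset_Icc_right hst.le)
    have i2 : IntervalIntegrable (fun y => powKernel μ (t₀ - y) * p y) volume s t₀ :=
      IntervalIntegrable.mono_set hint (by
        rw [uIcc_of_le hst.le, uIcc_of_le ht₀.le]; exact Icc_subset_Icc_left hs.le)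
    have i3 := ha.halfConvAt hp hs
    have hsplit : halfConv (powKernel μ) p t₀ = (∫ y in (0 : ℝ)..s, powKernel μ (t₀ - y) * p y)
        + ∫ y in s..t₀, powKernel μ (t₀ - y) * p y :=
      (intervalIntegral.integral_add_adjacent_intervals i1 i2).symm
    -- The contribution of `(0, s)` to the convolution at `t₀` is compared with the whole
    -- convolution at `s`. The equation at `s`, multiplied by `powKernel μ t₀ / powKernel μ s`, then
    -- cancels it, leaving only the part over `(s, t₀)`.
    have hle : (∫ y in (0 : ℝ)..s, powKernel μ (t₀ - y) * p y)
        ≤ powKernel μ t₀ / powKernel μ s * halfConv (powKernel μ) p s := by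
      rw [halfConv, ← intervalIntegral.integral_const_mul]
      refine intervalIntegral.integral_mono_on_of_le_Ioo hs.le i1 (i3.const_mul _) fun y hy => ?_
      rw [← mul_assoc]
      exact mul_le_mul_of_nonneg_right (powKernel_ratio hμ hμ1 hy.1.le hy.2 hst)
        (hpos y hy.1 (hy.2.trans hst)).le
    have e1 := hr t₀ ht₀
    have e2 := hr s hs
    have e3 : powKernel μ t₀ / powKernel μ s * p s
        = powKernel μ t₀ - l * (powKernel μ t₀ / powKernel μ s * halfConv (powKernel μ) p s) := by
      rw [e2]
      field_simp
    have e4 := mul_le_mul_of_nonneg_left hle hl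
    rw [hsplit] at e1
    rw [e3]
    linarith
  -- contradiction at a maximum close to `t₀`
  have htend : Tendsto (fun s => l * ∫ y in s..t₀, powKernel μ (t₀ - y)) (𝓝[<] t₀) (𝓝 0) := by
    have h1 : ∀ s, ∫ y in s..t₀, powKernel μ (t₀ - y) = ∫ y in (0 : ℝ)..(t₀ - s), powKernel μ y :=
      fun s => by rw [intervalIntegral.integral_comp_sub_left]; simp
    simp_rw [h1]
    have h2 := (ha.locInt.continuous_primitive t₀).continuousWithinAt
      (show (0 : ℝ) ∈ Icc 0 t₀ from ⟨le_rfl, ht₀.le⟩)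
    have h3 : Tendsto (fun s => t₀ - s) (𝓝[<] t₀) (𝓝[Icc 0 t₀] 0) := by
      refine tendsto_nhdsWithin_iff.2 ⟨?_, ?_⟩
      · have : Tendsto (fun s => t₀ - s) (𝓝 t₀) (𝓝 (t₀ - t₀)) :=
          (by fun_prop : Continuous fun s => t₀ - s).tendsto t₀
        rw [sub_self] at this
        exact this.mono_left nhdsWithin_le_nhds
      · filter_upwards [Ioo_mem_nhdsLT ht₀] with s hs
        exact ⟨by linarith [hs.2], by linarith [hs.1]⟩
    have h4 := (h2.tendsto.comp h3).const_mul l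
    simpa using h4
  -- Two choices are made at once: the mass over `(s, t₀)` times `l` is below `1/2`, and `s > t₀ /
  -- 2`. At a maximum `y` of `p` on `[s, t₀]` the key inequality bounds `powKernel μ t₀ / powKernel
  -- μ y` strictly below `1/2`, whereas `t₀ / y ≤ 2` and `μ - 1 ≥ -1` make it at least `1/2`.
  obtain ⟨s, hs1, hs2⟩ := ((htend.eventually_lt_const
    (show (0 : ℝ) < 1 / 2 by norm_num)).and (Ioo_mem_nhdsLT (show t₀ / 2 < t₀ by linarith))).exists
  obtain ⟨y, hy, hymax⟩ := (isCompact_Icc (a := s) (b := t₀)).exists_isMaxOn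
    ⟨s, le_rfl, hs2.2.le⟩ (hc.mono fun y hy => show (0 : ℝ) < y by linarith [hy.1, hs2.1])
  have hs0 : 0 < s := by linarith [hs2.1]
  have hypos : 0 < p y := (hpos s hs0 hs2.2).trans_le (hymax ⟨le_rfl, hs2.2.le⟩)
  have hyt : y < t₀ := lt_of_le_of_ne hy.2 fun h => by rw [h] at hypos; linarith
  have hy0 : 0 < y := hs0.trans_le hy.1
  have hk := key y hy0 hyt
  have hfi : ∀ s', 0 < s' → s' ≤ t₀ →
      IntervalIntegrable (fun z => powKernel μ (t₀ - z)) volume s' t₀ := fun s' h1 h2 =>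
    (ha.locInt.comp_sub ht₀.le).mono_set (by
      rw [uIcc_of_le h2, uIcc_of_le ht₀.le]; exact Icc_subset_Icc_left h1.le)
  have b1 : ∫ z in y..t₀, powKernel μ (t₀ - z) * p z
      ≤ (∫ z in y..t₀, powKernel μ (t₀ - z)) * p y := by
    rw [← intervalIntegral.integral_mul_const]
    refine intervalIntegral.integral_mono_on_of_le_Ioo hyt.le ?_
      ((hfi y hy0 hyt.le).mul_const _) fun z hz => ?_
    · exact IntervalIntegrable.mono_set hint (by
        rw [uIcc_of_le hyt.le, uIcc_of_le ht₀.le]; exact Icc_subset_Icc_left hy0.le)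
    · exact mul_le_mul_of_nonneg_left (hymax ⟨hy.1.trans hz.1.le, hz.2.le⟩)
        (powKernel_nonneg hμ (by linarith [hz.2]))
  have b2 : ∫ z in y..t₀, powKernel μ (t₀ - z) ≤ ∫ z in s..t₀, powKernel μ (t₀ - z) := by
    refine intervalIntegral.integral_mono_interval hy.1 hyt.le le_rfl ?_ (hfi s hs0 hs2.2.le)
    refine (ae_restrict_iff' measurableSet_Ioc).2 (Eventually.of_forall fun z hz => ?_)
    exact powKernel_nonneg hμ (by linarith [hz.2])
  have b3 : (1 : ℝ) / 2 ≤ powKernel μ t₀ / powKernel μ y := by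
    rw [powKernel, powKernel, div_div_div_cancel_right₀ (Real.Gamma_pos_of_pos hμ).ne',
      ← Real.div_rpow ht₀.le hy0.le]
    have h1 : 1 ≤ t₀ / y := (one_le_div hy0).2 hyt.le
    have h2 : t₀ / y ≤ 2 := by rw [div_le_iff₀ hy0]; linarith [hy.1, hs2.1]
    calc (1 : ℝ) / 2 ≤ (t₀ / y)⁻¹ := by
          rw [one_div]; exact inv_anti₀ (by linarith) h2
      _ = (t₀ / y) ^ (-1 : ℝ) := (Real.rpow_neg_one _).symm
      _ ≤ (t₀ / y) ^ (μ - 1) := Real.rpow_le_rpow_of_exponent_le h1 (by linarith)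
  have c1 := mul_le_mul_of_nonneg_right b3 hypos.le
  have c2 := mul_le_mul_of_nonneg_left b1 hl
  have c3 := mul_le_mul_of_nonneg_left b2 (mul_nonneg hl hypos.le)
  have c4 := mul_lt_mul_of_pos_right hs1 hypos
  nlinarith

/-- The kernel is decreasing, so its convolution with `p` at `t` is at least `powKernel μ t * ∫ p`.
Positivity of `p t` in the resolvent equation bounds `l` times this convolution by `powKernel μ t`.
-/
theorem fractional_resolvent_integral_le (hμ : 0 < μ) (hμ1 : μ < 1)
    (hp : Good p) (hr : ∀ t > 0, p t = powKernel μ t - l * halfConv (powKernel μ) p t)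
    (hpos : ∀ t > 0, 0 < p t) (hl : 0 ≤ l) {t : ℝ} (ht : 0 < t) :
    l * ∫ s in (0 : ℝ)..t, p s ≤ 1 := by
  have ha := good_powKernel hμ
  have hk := powKernel_pos hμ ht
  have h1 : powKernel μ t * ∫ s in (0 : ℝ)..t, p s ≤ halfConv (powKernel μ) p t := by
    rw [halfConv, ← intervalIntegral.integral_const_mul]
    refine intervalIntegral.integral_mono_on_of_le_Ioo ht.le
      ((hp.locInt.intervalIntegrable le_rfl ht.le).const_mul _) (ha.halfConvAt hp ht)
      fun y hy => ?_
    refine mul_le_mul_of_nonneg_right ?_ (hpos y hy.1).le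
    refine div_le_div_of_nonneg_right ?_ (Real.Gamma_pos_of_pos hμ).le
    exact Real.rpow_le_rpow_of_nonpos (by linarith [hy.2]) (by linarith [hy.1]) (by linarith)
  have h2 := hr t ht
  have h3 := hpos t ht
  have h4 := mul_le_mul_of_nonneg_left h1 hl
  refine le_of_mul_le_mul_left ?_ hk
  calc _ = l * (powKernel μ t * ∫ s in (0 : ℝ)..t, p s) := by ring
    _ ≤ _ := by linarith

/-- Homogeneity of the kernel: multiplication by `t` raises its order by one, hence is an
integration up to the factor `μ`. -/
theorem mul_powKernel_eq (hμ : 0 < μ) {t : ℝ} (ht : 0 < t) :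
    t * powKernel μ t = μ * halfConv (fun _ => 1) (powKernel μ) t := by
  have h1 : halfConv (fun _ => 1) (powKernel μ) t = powKernel (1 + μ) t := by
    rw [← halfConv_powKernel one_pos hμ ht]
    exact halfConv_congr ht.le (fun s _ => powKernel_one.symm) fun _ _ => rfl
  rw [h1, mul_powKernel ht, powKernel, add_sub_cancel_left, add_comm,
    Real.Gamma_add_one hμ.ne']
  have := (Real.Gamma_pos_of_pos hμ).ne'
  field_simp

/-- Multiplication by `t` is a derivation, so with `κ = powKernel μ` the function `y = t p` solves
`y + l κ * y = μ (1 * p)`. Solving through the resolvent gives `t p = μ (∫ p - l p * (1 * p))`,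
where the subtracted term is nonnegative; then use `l ∫ p ≤ 1`. -/
theorem fractional_resolvent_mul_le (hμ : 0 < μ) (hμ1 : μ < 1)
    (hp : Good p) (hr : ∀ t > 0, p t = powKernel μ t - l * halfConv (powKernel μ) p t)
    (hpos : ∀ t > 0, 0 < p t) (hl : 0 ≤ l) {t : ℝ} (ht : 0 < t) : t * (l * p t) ≤ 1 := by
  have ha := good_powKernel hμ
  have hq := good_one.conv hp
  have hya := ha.continuous_mul continuous_id
  have hyp := hp.continuous_mul continuous_id
  simp only [id_eq] at hya hyp
  have hwa := good_one.conv ha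
  have h1 : ∀ s > 0, (μ * halfConv (fun _ => 1) p s)
      = s * p s + l * halfConv (powKernel μ) (fun y => y * p y) s := by
    intro s hs
    have e1 := mul_halfConv (hya.halfConvAt hp hs) (ha.halfConvAt hyp hs)
    have e2 : halfConv (fun y => y * powKernel μ y) p s
        = μ * halfConv (fun _ => 1) (halfConv (powKernel μ) p) s := by
      rw [halfConv_congr hs.le (fun y hy => mul_powKernel_eq hμ hy.1) (fun _ _ => rfl),
        halfConv_const_mul_left, good_one.assoc ha hp hs]
    have e3 : halfConv (fun _ => 1) p s = halfConv (fun _ => 1) (powKernel μ) s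
        - l * halfConv (fun _ => 1) (halfConv (powKernel μ) p) s := by
      rw [← halfConv_const_mul_right, ← halfConv_sub_right (good_one.halfConvAt ha hs)
        ((good_one.halfConvAt (ha.conv hp) hs).const_mul_right l)]
      exact halfConv_congr hs.le (fun _ _ => rfl) fun y hy => hr y hy.1
    have e4 := mul_powKernel_eq hμ hs
    have e5 := hr s hs
    have e6 : s * p s = s * powKernel μ s - l * (s * halfConv (powKernel μ) p s) := by
      rw [e5]; ring
    rw [e6, e1, e2, e4, e3]
    ring
  have h2 := eq_sub_halfConv_of_resolvent ha hp hyp hr h1 ht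
  have h3 : halfConv p (fun s => μ * halfConv (fun _ => 1) p s) t
      = μ * halfConv p (halfConv (fun _ => 1) p) t := halfConv_const_mul_right _ _ _ _
  have h4 : 0 ≤ halfConv p (halfConv (fun _ => 1) p) t :=
    halfConv_nonneg ht.le (fun s hs => (hpos s hs.1).le) fun s hs =>
      halfConv_nonneg hs.1.le (fun _ _ => zero_le_one) fun y hy => (hpos y hy.1).le
  have h5 := fractional_resolvent_integral_le hμ hμ1 hp hr hpos hl ht
  rw [halfConv_one, h3] at h2
  have h6 : t * (l * p t) = μ * (l * ∫ s in (0 : ℝ)..t, p s)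
      - μ * (l * l * halfConv p (halfConv (fun _ => 1) p) t) := by
    calc t * (l * p t) = l * (t * p t) := by ring
      _ = _ := by rw [h2]; ring
  have h7 : 0 ≤ μ * (l * l * halfConv p (halfConv (fun _ => 1) p) t) := by positivity
  have h8 : μ * (l * ∫ s in (0 : ℝ)..t, p s) ≤ μ * 1 := mul_le_mul_of_nonneg_left h5 hμ.le
  linarith

end FractionalResolvent

/-- The resolvent `t^{μ-1} E_{μ,μ}(-l t^μ)` of the fractional integral of order `μ` is a
nonnegative kernel of mass at most `1 / l`, bounded by `1 / (l t)`. -/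
theorem exists_fractional_resolvent {μ : ℝ} (hμ : 0 < μ) (hμ1 : μ < 1) {l : ℝ} (hl : 0 ≤ l) :
    ∃ p : ℝ → ℝ, Good p ∧ (∀ t > 0, p t = powKernel μ t - l * halfConv (powKernel μ) p t) ∧
      (∀ t > 0, 0 < p t) ∧ (∀ t > 0, l * ∫ s in (0 : ℝ)..t, p s ≤ 1) ∧
      ∀ t > 0, t * (l * p t) ≤ 1 := by
  -- The fractional case: `γ = δ = 0` and `ω = 0`, so `ρ = 1` is a dummy value.
  have hp := good_resolventSeries le_rfl hμ one_pos 0 0 l hμ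
  have hr : ∀ t > 0, resolventSeries 0 0 μ μ 1 0 l t = powKernel μ t
      - l * halfConv (powKernel μ) (resolventSeries 0 0 μ μ 1 0 l) t := by
    intro t ht
    rw [resolventSeries_shift le_rfl hμ one_pos 0 0 l hμ ht, prabhakarKernel_zero _ _ _ ht,
      ← halfConv_prabhakarKernel_resolventSeries le_rfl hμ one_pos 0 0 0 l hμ hμ ht]
    congr 2
    exact halfConv_congr ht.le (fun s hs => prabhakarKernel_zero _ _ _ hs.1) fun _ _ => rfl
  -- Near the origin the correction is `O(t ^ (2μ - 1))`, negligible against the leading term `t ^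
  -- (μ - 1) / Γ(μ)`.
  have h0 : ∀ᶠ t in 𝓝[>] (0 : ℝ), 0 < resolventSeries 0 0 μ μ 1 0 l t := by
    obtain ⟨σ, _, h⟩ := exists_laplaceSummable_dbl (le_refl (0 : ℝ)) hμ one_pos 0 |l|
    obtain ⟨C, hC⟩ : ∃ C, ∀ t ∈ Ioc (0 : ℝ) 1,
        |resolventSeries 0 0 μ (μ + μ) 1 0 l t| ≤ C * t ^ (μ + μ - 1) :=
      ⟨_, fun t ht => (h l le_rfl 0 (μ + μ) (by linarith)).abs_powSeries_le ht⟩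
    have ht0 : Tendsto (fun t : ℝ => l * (C * t ^ μ)) (𝓝[>] 0) (𝓝 0) := by
      have : Tendsto (fun t : ℝ => t ^ μ) (𝓝 0) (𝓝 (0 ^ μ)) :=
        (Real.continuousAt_rpow_const 0 μ (Or.inr hμ.le)).tendsto
      rw [Real.zero_rpow hμ.ne'] at this
      simpa using ((this.mono_left nhdsWithin_le_nhds).const_mul C).const_mul l
    filter_upwards [Ioc_mem_nhdsGT one_pos, ht0.eventually_lt_const
      (inv_pos.2 (Real.Gamma_pos_of_pos hμ))] with t ht hlt
    rw [resolventSeries_shift le_rfl hμ one_pos 0 0 l hμ ht.1, prabhakarKernel_zero _ _ _ ht.1,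
      add_zero]
    have h1 := mul_le_mul_of_nonneg_left ((le_abs_self _).trans (hC t ht)) hl
    have h2 : t ^ (μ + μ - 1) = t ^ μ * t ^ (μ - 1) := by
      rw [← Real.rpow_add ht.1]; congr 1; ring
    have h3 : 0 < t ^ (μ - 1) := Real.rpow_pos_of_pos ht.1 _
    have h4 := mul_lt_mul_of_pos_right hlt h3
    rw [h2] at h1
    rw [powKernel, div_eq_inv_mul]
    nlinarith
  have hpos : ∀ t > 0, 0 < resolventSeries 0 0 μ μ 1 0 l t := fun t ht =>
    fractional_resolvent_pos hμ hμ1 hl hp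
      (continuousOn_resolventSeries le_rfl hμ one_pos 0 0 l hμ) hr h0 ht
  exact ⟨_, hp, hr, hpos,
    fun t ht => fractional_resolvent_integral_le hμ hμ1 hp hr hpos hl ht,
    fun t ht => fractional_resolvent_mul_le hμ hμ1 hp hr hpos hl ht⟩



/-! ### Bounds that are uniform in the spectral parameter -/

/-- A family of kernels in the algebra `Good` with bounds independent of the index. -/
structure UnifGood {ι : Type*} (Φ : ι → ℝ → ℝ) : Prop where
  good : ∀ i, Good (Φ i)
  bound : ∀ T > 0, ∃ C, 0 ≤ C ∧ ∀ i, ∫ t in (0 : ℝ)..T, |Φ i t| ≤ C ∧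
    ∀ t ∈ Ioc 0 T, t * |Φ i t| ≤ C

theorem UnifGood.conv {ι : Type*} {Φ : ι → ℝ → ℝ} (h : UnifGood Φ) {κ : ℝ → ℝ} (hκ : Good κ) :
    UnifGood fun i => halfConv κ (Φ i) := by
  refine ⟨fun i => hκ.conv (h.good i), fun T hT => ?_⟩
  obtain ⟨C, hC0, hC⟩ := h.bound T hT
  obtain ⟨A, hA0, hA⟩ := hκ.exists_nonneg_bound T
  have hI := integral_abs_nonneg κ hT.le
  refine ⟨(A + ∫ t in (0 : ℝ)..T, |κ t|) * C, by positivity, fun i => ⟨?_, fun t ht => ?_⟩⟩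
  · refine (hκ.locInt.integral_abs_halfConv_le (h.good i).locInt hT.le).trans ?_
    exact mul_le_mul (le_add_of_nonneg_left hA0) (hC i).1 (integral_abs_nonneg _ hT.le)
      (by positivity)
  · refine (mul_abs_halfConv_le ht hκ.locInt (h.good i).locInt hA0 hC0 hA (hC i).2).trans ?_
    have := mul_le_mul_of_nonneg_left (hC i).1 hA0
    linarith

theorem UnifGood.sub {ι : Type*} {Φ Ψ : ι → ℝ → ℝ} (h : UnifGood Φ) (h' : UnifGood Ψ) :
    UnifGood fun i t => Φ i t - Ψ i t := by
  refine ⟨fun i => (h.good i).sub (h'.good i), fun T hT => ?_⟩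
  obtain ⟨C, hC0, hC⟩ := h.bound T hT
  obtain ⟨D, hD0, hD⟩ := h'.bound T hT
  refine ⟨C + D, by positivity, fun i => ⟨?_, fun t ht => ?_⟩⟩
  · have hi := ((h.good i).locInt.abs.intervalIntegrable le_rfl hT.le)
    have hi' := ((h'.good i).locInt.abs.intervalIntegrable le_rfl hT.le)
    refine le_trans ?_ (add_le_add (hC i).1 (hD i).1)
    rw [← intervalIntegral.integral_add hi hi']
    refine intervalIntegral.integral_mono_on hT.le
      (((h.good i).locInt.sub (h'.good i).locInt).abs.intervalIntegrable le_rfl hT.le)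
      (hi.add hi') fun t _ => abs_sub _ _
  · have h1 := mul_le_mul_of_nonneg_left (abs_sub (Φ i t) (Ψ i t)) ht.1.le
    have h2 := (hC i).2 t ht
    have h3 := (hD i).2 t ht
    rw [mul_add] at h1
    linarith

theorem UnifGood.const {f : ℝ → ℝ} (hf : Good f) (ι : Type*) : UnifGood fun _ : ι => f := by
  refine ⟨fun _ => hf, fun T hT => ?_⟩
  obtain ⟨A, hA0, hA⟩ := hf.exists_nonneg_bound T
  have hI := integral_abs_nonneg f hT.le
  exact ⟨A + ∫ t in (0 : ℝ)..T, |f t|, by positivity, fun _ => ⟨by linarith, fun t ht =>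
    (hA t ht).trans (by linarith)⟩⟩

theorem UnifGood.congr {ι : Type*} {Φ Ψ : ι → ℝ → ℝ} (h : UnifGood Φ)
    (he : ∀ i, EqOn (Φ i) (Ψ i) (Ioi 0)) : UnifGood Ψ := by
  refine ⟨fun i => (h.good i).congr (he i), fun T hT => ?_⟩
  obtain ⟨C, hC0, hC⟩ := h.bound T hT
  refine ⟨C, hC0, fun i => ⟨?_, fun t ht => by rw [← he i ht.1]; exact (hC i).2 t ht⟩⟩
  rw [intervalIntegral.integral_of_le hT.le]
  have := (hC i).1
  rw [intervalIntegral.integral_of_le hT.le] at this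
  rwa [setIntegral_congr_fun measurableSet_Ioc fun t ht => by rw [← he i ht.1]]

/-- Dominated convergence as `σ → ∞`: the weight tends to `0` at every `t > 0`, so any locally
integrable kernel acquires small mass on `(0, T]`. -/
theorem exists_exp_weight {m : ℝ → ℝ} (hm : LocInt m) {T : ℝ} (hT : 0 < T) {ε : ℝ} (hε : 0 < ε) :
    ∃ σ ≥ 0, ∫ t in (0 : ℝ)..T, |Real.exp (-σ * t) * m t| ≤ ε := by
  have hlim : Tendsto (fun σ : ℝ => ∫ t in (0 : ℝ)..T, |Real.exp (-σ * t) * m t|) atTop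
      (𝓝 (∫ t in (0 : ℝ)..T, (0 : ℝ))) := by
    refine intervalIntegral.tendsto_integral_filter_of_dominated_convergence (fun t => |m t|)
      ?_ ?_ (hm.abs.intervalIntegrable le_rfl hT.le) ?_
    · refine Eventually.of_forall fun σ => ?_
      rw [uIoc_of_le hT.le]
      exact ((hm.continuous_mul (g := fun t => Real.exp (-σ * t)) (by fun_prop)).abs
        T).aestronglyMeasurable
    · filter_upwards [eventually_ge_atTop 0] with σ hσ
      refine Eventually.of_forall fun t ht => ?_
      rw [uIoc_of_le hT.le] at ht
      rw [Real.norm_eq_abs, abs_abs, abs_mul, abs_of_pos (Real.exp_pos _)]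
      refine mul_le_of_le_one_left (abs_nonneg _) (Real.exp_le_one_iff.2 ?_)
      have := mul_nonneg hσ ht.1.le
      linarith
    · refine Eventually.of_forall fun t ht => ?_
      rw [uIoc_of_le hT.le] at ht
      have h1 : Tendsto (fun σ : ℝ => Real.exp (-σ * t)) atTop (𝓝 0) := by
        refine Real.tendsto_exp_atBot.comp ?_
        simp_rw [neg_mul]
        exact tendsto_neg_atTop_atBot.comp (tendsto_id.atTop_mul_const ht.1)
      simpa using (h1.mul_const (m t)).abs
  simp only [intervalIntegral.integral_zero] at hlim
  obtain ⟨σ, hσ, hσ0⟩ := ((hlim.eventually_lt_const hε).and (eventually_ge_atTop 0)).exists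
  exact ⟨σ, hσ0, hσ.le⟩

/-- A priori bounds for `r = r₀ + n - n * r` with `n = r₀ * m`, depending only on `m`, when `r₀` has
mass at most one and `t r₀ ≤ 1`. -/
theorem exists_bound_of_perturbation {m : ℝ → ℝ} (hm : Good m) {T : ℝ} (hT : 0 < T) :
    ∃ C, 0 ≤ C ∧ ∀ r₀ r : ℝ → ℝ, Good r₀ → Good r → ∫ t in (0 : ℝ)..T, |r₀ t| ≤ 1 →
      (∀ t ∈ Ioc 0 T, t * |r₀ t| ≤ 1) →
      (∀ t > 0, r t = r₀ t + halfConv r₀ m t - halfConv (halfConv r₀ m) r t) →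
      ∫ t in (0 : ℝ)..T, |r t| ≤ C ∧ ∀ t ∈ Ioc 0 T, t * |r t| ≤ C := by
  -- The weight is chosen from `m` and `T` alone, before `r₀` and `r` appear; this is the source of
  -- uniformity.
  obtain ⟨σ, hσ, hσm⟩ := exists_exp_weight hm.locInt hT (show (0 : ℝ) < 1 / 2 by norm_num)
  obtain ⟨M, hM0, hM⟩ := hm.exists_nonneg_bound T
  refine ⟨Real.exp (σ * T) * (2 * (1 + 4 * (M + 1 / 2))), by positivity,
    fun r₀ r hr₀ hr hI hS hE => ?_⟩
  have hw : Continuous fun t : ℝ => Real.exp (-σ * t) := by fun_prop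
  have hle1 : ∀ t ∈ Ioc 0 T, Real.exp (-σ * t) ≤ 1 := fun t ht => Real.exp_le_one_iff.2 (by
    have := mul_nonneg hσ ht.1.le
    linarith)
  have hwabs : ∀ (f : ℝ → ℝ), ∀ t ∈ Ioc 0 T, |Real.exp (-σ * t) * f t| ≤ |f t| := fun f t ht => by
    rw [abs_mul, abs_of_pos (Real.exp_pos _)]
    exact mul_le_of_le_one_left (abs_nonneg _) (hle1 t ht)
  set R : ℝ → ℝ := fun t => Real.exp (-σ * t) * r t with hR
  set R₀ : ℝ → ℝ := fun t => Real.exp (-σ * t) * r₀ t with hR₀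
  set m' : ℝ → ℝ := fun t => Real.exp (-σ * t) * m t with hm'
  have gR : Good R := hr.continuous_mul hw
  have gR₀ : Good R₀ := hr₀.continuous_mul hw
  have gm' : Good m' := hm.continuous_mul hw
  have gN : Good (halfConv R₀ m') := gR₀.conv gm'
  have hEw : ∀ t > 0, R t = R₀ t + halfConv R₀ m' t - halfConv (halfConv R₀ m') R t := by
    intro t ht
    have e1 : halfConv (halfConv R₀ m') R t
        = Real.exp (-σ * t) * halfConv (halfConv r₀ m) r t := by
      rw [← halfConv_exp_mul]
      exact halfConv_congr ht.le (fun s _ => halfConv_exp_mul σ r₀ m s) fun _ _ => rfl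
    rw [e1, halfConv_exp_mul, hR, hR₀]
    simp only
    rw [hE t ht]
    ring
  have hI₀ : ∫ t in (0 : ℝ)..T, |R₀ t| ≤ 1 := by
    refine le_trans ?_ hI
    refine intervalIntegral.integral_mono_on_of_le_Ioo hT.le
      (gR₀.locInt.abs.intervalIntegrable le_rfl hT.le)
      (hr₀.locInt.abs.intervalIntegrable le_rfl hT.le) fun t ht => hwabs r₀ t ⟨ht.1, ht.2.le⟩
  have hS₀ : ∀ t ∈ Ioc 0 T, t * |R₀ t| ≤ 1 := fun t ht =>
    (mul_le_mul_of_nonneg_left (hwabs r₀ t ht) ht.1.le).trans (hS t ht)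
  have hSm : ∀ t ∈ Ioc 0 T, t * |m' t| ≤ M := fun t ht =>
    (mul_le_mul_of_nonneg_left (hwabs m t ht) ht.1.le).trans (hM t ht)
  have hIN : ∫ t in (0 : ℝ)..T, |halfConv R₀ m' t| ≤ 1 / 2 := by
    refine (gR₀.locInt.integral_abs_halfConv_le gm'.locInt hT.le).trans ?_
    calc _ ≤ 1 * (1 / 2 : ℝ) := mul_le_mul hI₀ hσm (integral_abs_nonneg _ hT.le) zero_le_one
      _ = _ := one_mul _
  have hSN : ∀ t ∈ Ioc 0 T, t * |halfConv R₀ m' t| ≤ M + 1 / 2 := fun t ht => by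
    refine (mul_abs_halfConv_le ht gR₀.locInt gm'.locInt zero_le_one hM0 hS₀ hSm).trans ?_
    have := mul_le_mul_of_nonneg_left hI₀ hM0
    linarith
  -- With `I` the weighted `L¹` norm, the equation gives `I ≤ 1 + 1/2 + I/2`.
  have hIR : ∫ t in (0 : ℝ)..T, |R t| ≤ 3 := by
    have gNR := gN.conv gR
    have i1 := gR₀.locInt.abs.intervalIntegrable le_rfl hT.le
    have i2 := gN.locInt.abs.intervalIntegrable le_rfl hT.le
    have i3 := gNR.locInt.abs.intervalIntegrable le_rfl hT.le
    have h1 : ∫ t in (0 : ℝ)..T, |R t| ≤ ∫ t in (0 : ℝ)..T,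
        (|R₀ t| + |halfConv R₀ m' t| + |halfConv (halfConv R₀ m') R t|) := by
      refine intervalIntegral.integral_mono_on_of_le_Ioo hT.le
        (gR.locInt.abs.intervalIntegrable le_rfl hT.le) ((i1.add i2).add i3) fun t ht => ?_
      rw [hEw t ht.1]
      exact (abs_sub _ _).trans (add_le_add (abs_add_le _ _) le_rfl)
    rw [intervalIntegral.integral_add (i1.add i2) i3, intervalIntegral.integral_add i1 i2] at h1
    have h2 := gN.locInt.integral_abs_halfConv_le gR.locInt hT.le
    have h3 := mul_le_mul_of_nonneg_right hIN (integral_abs_nonneg R hT.le)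
    linarith
  -- One pass through the equation halves the dependence on an a priori pointwise bound `Q`; `4 * (M
  -- + 1/2)` collects the bound of `n` and that bound times the mass `3` of `R`.
  have step : ∀ Q, 0 ≤ Q → (∀ t ∈ Ioc 0 T, t * |R t| ≤ Q) →
      ∀ t ∈ Ioc 0 T, t * |R t| ≤ 1 + 4 * (M + 1 / 2) + Q / 2 := by
    intro Q hQ0 hQ t ht
    have h1 := mul_abs_halfConv_le ht gN.locInt gR.locInt (by positivity) hQ0 hSN hQ
    have h2 : (M + 1 / 2) * ∫ s in (0 : ℝ)..T, |R s| ≤ (M + 1 / 2) * 3 :=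
      mul_le_mul_of_nonneg_left hIR (by positivity)
    have h3 := mul_le_mul_of_nonneg_left hIN hQ0
    have h4 : |R t| ≤ |R₀ t| + |halfConv R₀ m' t| + |halfConv (halfConv R₀ m') R t| := by
      rw [hEw t ht.1]
      exact (abs_sub _ _).trans (add_le_add (abs_add_le _ _) le_rfl)
    have h5 := mul_le_mul_of_nonneg_left h4 ht.1.le
    have h6 := hS₀ t ht
    have h7 := hSN t ht
    rw [mul_add, mul_add] at h5
    linarith
  have hSR : ∀ t ∈ Ioc 0 T, t * |R t| ≤ 2 * (1 + 4 * (M + 1 / 2)) := by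
    obtain ⟨Q₀, hQ₀, hQ⟩ := gR.exists_nonneg_bound T
    set S : Set ℝ := (fun t => t * |R t|) '' Ioc 0 T with hSdef
    have hbdd : BddAbove S := ⟨Q₀, by rintro _ ⟨t, ht, rfl⟩; exact hQ t ht⟩
    have hne : S.Nonempty := ⟨_, mem_image_of_mem _ ⟨hT, le_rfl⟩⟩
    have hle : ∀ t ∈ Ioc 0 T, t * |R t| ≤ sSup S := fun t ht =>
      le_csSup hbdd (mem_image_of_mem _ ht)
    have h0 : 0 ≤ sSup S := (mul_nonneg hT.le (abs_nonneg _)).trans (hle T ⟨hT, le_rfl⟩)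
    -- The supremum is finite because `R` is `Good`, so it may be inserted as its own bound and
    -- absorbed.
    have h1 : sSup S ≤ 1 + 4 * (M + 1 / 2) + sSup S / 2 :=
      csSup_le hne (by rintro _ ⟨t, ht, rfl⟩; exact step _ h0 hle t ht)
    intro t ht
    have := hle t ht
    linarith
  have hrR : ∀ t ∈ Ioc 0 T, |r t| ≤ Real.exp (σ * T) * |R t| := by
    intro t ht
    rw [hR]
    simp only
    rw [abs_mul, abs_of_pos (Real.exp_pos _), ← mul_assoc, ← Real.exp_add]
    refine le_mul_of_one_le_left (abs_nonneg _) (Real.one_le_exp ?_)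
    have := mul_le_mul_of_nonneg_left ht.2 hσ
    linarith
  constructor
  · have i1 := gR.locInt.abs.intervalIntegrable le_rfl hT.le
    have h1 : ∫ t in (0 : ℝ)..T, |r t| ≤ ∫ t in (0 : ℝ)..T, Real.exp (σ * T) * |R t| :=
      intervalIntegral.integral_mono_on_of_le_Ioo hT.le
        (hr.locInt.abs.intervalIntegrable le_rfl hT.le) (i1.const_mul _)
        fun t ht => hrR t ⟨ht.1, ht.2.le⟩
    rw [intervalIntegral.integral_const_mul] at h1
    refine h1.trans (mul_le_mul_of_nonneg_left ?_ (Real.exp_pos _).le)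
    linarith
  · intro t ht
    calc t * |r t| ≤ t * (Real.exp (σ * T) * |R t|) :=
          mul_le_mul_of_nonneg_left (hrR t ht) ht.1.le
      _ = Real.exp (σ * T) * (t * |R t|) := by ring
      _ ≤ _ := mul_le_mul_of_nonneg_left (hSR t ht) (Real.exp_pos _).le

/-! ### From the fractional kernel to the Prabhakar kernel: perturbation and uniform bounds. -/

/-- The kernel `∑_{r ≥ 1} (γ)_r / r! ω^r t^{ρ r - 1} / Γ(ρ r)`, i.e. the Prabhakar kernel of order
`0` without its Dirac mass. -/
def regularKernel (γ ρ ω : ℝ) : ℝ → ℝ :=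
  powSeries (fun r : ℕ => pochCoeff γ (r + 1) * ω ^ (r + 1)) (fun r : ℕ => ρ * (r + 1 : ℕ))

theorem laplaceSummable_regularKernel {ρ : ℝ} (hρ : 0 < ρ) (γ ω : ℝ) : ∃ σ,
    LaplaceSummable (fun r : ℕ => pochCoeff γ (r + 1) * ω ^ (r + 1))
      (fun r : ℕ => ρ * (r + 1 : ℕ)) ρ σ := by
  obtain ⟨σ, hσ, h⟩ := exists_laplaceSummable_dbl (le_refl (0 : ℝ)) one_pos hρ ω 0
  have h0 := h 0 (by simp) γ ρ hρ
  refine ⟨σ, hρ, hσ, fun r => ?_, ?_⟩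
  · push_cast
    nlinarith [(Nat.cast_nonneg r : (0 : ℝ) ≤ r)]
  -- The series in `h0` has exponents larger by `ρ`; the factor `σ ^ ρ` corrects this.
  · have h1 := ((summable_nat_add_iff 1).2 (h0.summable.prod_factor 0)).mul_left (σ ^ ρ)
    refine h1.congr fun r => ?_
    simp only [dblCoeff, dblExp, pow_zero, one_mul, Nat.cast_zero, mul_zero, zero_add]
    rw [mul_left_comm, ← Real.rpow_add hσ]
    congr 2
    push_cast
    ring

/-- The term `r = 0` is the power kernel, and each later term is the power kernel convolved with one
of order `ρ r > 0`. The singular part of the kernel therefore does not depend on `γ`, `ρ` or `ω`. -/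
theorem prabhakarKernel_eq_perturbation {μ ρ : ℝ} (hμ : 0 < μ) (hρ : 0 < ρ) (γ ω : ℝ) {t : ℝ}
    (ht : 0 < t) : prabhakarKernel γ ρ μ ω t
      = powKernel μ t + halfConv (powKernel μ) (regularKernel γ ρ ω) t := by
  obtain ⟨σ, h⟩ := laplaceSummable_regularKernel hρ γ ω
  -- The single power kernel is viewed as a one-term series, so that the product formula for series
  -- applies.
  have h0 : LaplaceSummable (fun _ : Unit => (1 : ℝ)) (fun _ => μ) μ σ :=
    ⟨hμ, h.sigma_pos, fun _ => le_rfl, Summable.of_finite⟩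
  have e0 : EqOn (powKernel μ) (powSeries (fun _ : Unit => (1 : ℝ)) (fun _ => μ)) (Ioo 0 t) :=
    fun s _ => by simp [powSeries]
  rw [halfConv_congr ht.le e0 (fun _ _ => rfl), regularKernel, h0.halfConv_eq h ht,
    prabhakarKernel_eq_tsum _ _ _ _ ht]
  have hs : Summable fun r : ℕ => pochCoeff γ r * ω ^ r * powKernel (ρ * r + μ) t := by
    have := ((resolventSeries_hasSum (le_refl (0 : ℝ)) one_pos hρ γ ω 0 hμ ht).summable).prod_factor
      0
    refine this.congr fun r => ?_
    simp [dblCoeff, dblExp]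
  rw [hs.tsum_eq_zero_add, powSeries, ← (Equiv.uniqueProd ℕ Unit).symm.tsum_eq]
  congr 1
  · simp [pochCoeff_zero]
  · congr 1
    ext r
    simp [add_comm]

theorem good_regularKernel {ρ : ℝ} (hρ : 0 < ρ) (γ ω : ℝ) : Good (regularKernel γ ρ ω) := by
  obtain ⟨σ, h⟩ := laplaceSummable_regularKernel hρ γ ω
  exact h.good

theorem resolvent_equation {γ μ ρ : ℝ} (hγ : 0 ≤ γ) (hμ : 0 < μ) (hρ : 0 < ρ) (ω l : ℝ) {t : ℝ}
    (ht : 0 < t) : resolventSeries γ γ μ μ ρ ω l t = prabhakarKernel γ ρ μ ω t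
      - l * halfConv (prabhakarKernel γ ρ μ ω) (resolventSeries γ γ μ μ ρ ω l) t := by
  rw [halfConv_prabhakarKernel_resolventSeries hγ hμ hρ γ γ ω l hμ hμ ht,
    ← resolventSeries_shift hγ hμ hρ γ ω l hμ ht]

/-- The rescaled resolvent is a perturbation of that of the fractional integral. -/
theorem resolvent_perturbation {γ μ ρ : ℝ} (hγ : 0 ≤ γ) (hμ : 0 < μ) (hρ : 0 < ρ) (ω l : ℝ)
    {p₀ : ℝ → ℝ} (hp₀ : Good p₀)
    (hr₀ : ∀ t > 0, p₀ t = powKernel μ t - l * halfConv (powKernel μ) p₀ t) {t : ℝ} (ht : 0 < t) :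
    l * resolventSeries γ γ μ μ ρ ω l t = l * p₀ t
      + halfConv (fun s => l * p₀ s) (regularKernel γ ρ ω) t
      - halfConv (halfConv (fun s => l * p₀ s) (regularKernel γ ρ ω))
          (fun s => l * resolventSeries γ γ μ μ ρ ω l s) t := by
  set p := resolventSeries γ γ μ μ ρ ω l with hpdef
  set m := regularKernel γ ρ ω with hmdef
  have hp : Good p := good_resolventSeries hγ hμ hρ γ ω l hμ
  have hm : Good m := good_regularKernel hρ γ ω
  have ha := good_powKernel hμ
  have hamp := ha.conv (hm.conv hp)
  -- `p + l a₀ * p = a₀ + a₀ * (m - l m * p)`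
  set x : ℝ → ℝ := fun s => m s - l * halfConv m p s with hx
  have gx : Good x := hm.sub ((hm.conv hp).const_mul l)
  have hax := ha.conv gx
  have h1 : ∀ s > 0, powKernel μ s + halfConv (powKernel μ) x s
      = p s + l * halfConv (powKernel μ) p s := by
    intro s hs
    have e1 := resolvent_equation hγ hμ hρ ω l hs
    have e2 : halfConv (prabhakarKernel γ ρ μ ω) p s
        = halfConv (powKernel μ) p s + halfConv (powKernel μ) (halfConv m p) s := by
      rw [halfConv_congr hs.le (fun y hy => prabhakarKernel_eq_perturbation hμ hρ γ ω hy.1)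
        (fun _ _ => rfl), halfConv_add_left (ha.halfConvAt hp hs)
        ((ha.conv hm).halfConvAt hp hs), ha.assoc hm hp hs]
    have e3 : halfConv (powKernel μ) x s
        = halfConv (powKernel μ) m s - l * halfConv (powKernel μ) (halfConv m p) s := by
      rw [hx, halfConv_sub_right (ha.halfConvAt hm hs)
        ((ha.halfConvAt (hm.conv hp) hs).const_mul_right l), halfConv_const_mul_right]
    rw [← hpdef, e2, prabhakarKernel_eq_perturbation hμ hρ γ ω hs] at e1
    rw [e3, e1]
    ring
  have h2 := eq_sub_halfConv_of_resolvent ha hp₀ hp hr₀ h1 ht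
  -- `a₀ - l p₀ * a₀ = p₀`
  have h3 : ∀ s > 0, powKernel μ s - l * halfConv p₀ (powKernel μ) s = p₀ s := fun s hs => by
    rw [halfConv_comm]; exact (hr₀ s hs).symm
  have h4 : p t = p₀ t + halfConv p₀ x t := by
    have e : halfConv p₀ x t
        = halfConv (powKernel μ) x t - l * halfConv p₀ (halfConv (powKernel μ) x) t := by
      rw [halfConv_congr (f := p₀) (f' := fun s => powKernel μ s - l * halfConv p₀ (powKernel μ) s)
          (g := x) (g' := x) ht.le (fun s hs => (h3 s hs.1).symm) (fun _ _ => rfl),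
        halfConv_sub_left (ha.halfConvAt gx ht) (((hp₀.conv ha).const_mul l).halfConvAt gx ht),
        halfConv_const_mul_left, hp₀.assoc ha gx ht]
    rw [h2, halfConv_add_right (hp₀.halfConvAt ha ht) (hp₀.halfConvAt hax ht), e]
    linarith [h3 t ht]
  rw [h4, hx, halfConv_sub_right (hp₀.halfConvAt hm ht)
    ((hp₀.halfConvAt (hm.conv hp) ht).const_mul_right l), halfConv_const_mul_right,
    halfConv_congr (f := halfConv (fun s => l * p₀ s) m) (f' := fun s => l * halfConv p₀ m s)
      ht.le (fun s _ => halfConv_const_mul_left l p₀ m s) (fun _ _ => rfl),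
    halfConv_const_mul_left, halfConv_const_mul_left, halfConv_const_mul_right,
    hp₀.assoc hm hp ht]
  ring

/-- The rescaled fractional resolvent `r₀ = l p₀` has mass at most one and satisfies `t r₀ ≤ 1` for
every `l`, while `regularKernel` does not involve `l`. The perturbation bound is therefore the same
for all indices. -/
theorem unifGood_mul_resolvent {ι : Type*} {γ μ ρ : ℝ} (hγ : 0 ≤ γ) (hμ : 0 < μ) (hμ1 : μ < 1)
    (hρ : 0 < ρ) (ω : ℝ) (l : ι → ℝ) (hl : ∀ i, 0 ≤ l i) :
    UnifGood fun i t => l i * resolventSeries γ γ μ μ ρ ω (l i) t := by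
  have hg : ∀ i, Good fun t => l i * resolventSeries γ γ μ μ ρ ω (l i) t := fun i =>
    (good_resolventSeries hγ hμ hρ γ ω (l i) hμ).const_mul _
  refine ⟨hg, fun T hT => ?_⟩
  obtain ⟨C, hC0, hC⟩ := exists_bound_of_perturbation (good_regularKernel hρ γ ω) hT
  refine ⟨C, hC0, fun i => ?_⟩
  obtain ⟨p₀, hp₀, hr₀, hpos, hI, hS⟩ := exists_fractional_resolvent hμ hμ1 (hl i)
  have habs : ∀ t > 0, |l i * p₀ t| = l i * p₀ t := fun t ht =>
    abs_of_nonneg (mul_nonneg (hl i) (hpos t ht).le)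
  refine hC (fun t => l i * p₀ t) _ (hp₀.const_mul _) (hg i) ?_ (fun t ht => ?_) fun t ht =>
    resolvent_perturbation hγ hμ hρ ω (l i) hp₀ hr₀ ht
  · refine le_trans (le_of_eq ?_) (hI T hT)
    rw [← intervalIntegral.integral_const_mul, intervalIntegral.integral_of_le hT.le,
      intervalIntegral.integral_of_le hT.le]
    exact setIntegral_congr_fun measurableSet_Ioc fun t ht => habs t ht.1
  · rw [habs t ht.1]
    exact hS t ht.1

/-- Dividing the preceding bound by `l` would fail near `l = 0`; the resolvent equation `p = a - a *
(l p)` is used instead. -/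
theorem unifGood_resolvent {ι : Type*} {γ μ ρ : ℝ} (hγ : 0 ≤ γ) (hμ : 0 < μ) (hμ1 : μ < 1)
    (hρ : 0 < ρ) (ω : ℝ) (l : ι → ℝ) (hl : ∀ i, 0 ≤ l i) :
    UnifGood fun i => resolventSeries γ γ μ μ ρ ω (l i) := by
  have ha := good_prabhakarKernel hρ γ ω hμ
  refine ((UnifGood.const ha ι).sub
    ((unifGood_mul_resolvent hγ hμ hμ1 hρ ω l hl).conv ha)).congr fun i t ht => ?_
  simp only
  rw [halfConv_const_mul_right]
  exact (resolvent_equation hγ hμ hρ ω (l i) ht).symm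



/-! ### Superposition of kernels -/

/-- Weierstrass test on a compact neighbourhood: for `|l'| ≤ L` the terms are dominated by those at
`L = |l| + 1`, since `l` enters only through powers. -/
theorem continuousOn_uncurry_resolventSeries {γ μ β ρ : ℝ} (hγ : 0 ≤ γ) (hμ : 0 < μ) (hρ : 0 < ρ)
    (δ ω : ℝ) (hβ : 0 < β) :
    ContinuousOn (fun q : ℝ × ℝ => resolventSeries γ δ μ β ρ ω q.1 q.2) (univ ×ˢ Ioi 0) := by
  rintro ⟨l, t⟩ ⟨-, ht⟩
  have ht0 : (0 : ℝ) < t := ht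
  set L := |l| + 1 with hL
  have hL0 : 0 ≤ L := by positivity
  obtain ⟨σ, hσ, h⟩ := exists_laplaceSummable_dbl hγ hμ hρ ω L
  have hd := h L (abs_of_nonneg hL0).le δ β hβ
  have hm : Icc (-L) L ×ˢ Icc (t / 2) (t + 1) ∈ 𝓝 (l, t) := by
    refine prod_mem_nhds (Icc_mem_nhds ?_ ?_) (Icc_mem_nhds (by linarith) (by linarith))
    · linarith [neg_abs_le l]
    · linarith [le_abs_self l]
  obtain ⟨B, hB⟩ := (isCompact_Icc (a := t / 2) (b := t + 1)).exists_bound_of_continuousOn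
    (f := fun s : ℝ => s ^ (β - 1)) fun s hs =>
      (Real.continuousAt_rpow_const s _ (Or.inl (by linarith [hs.1]))).continuousWithinAt
  have hc : ContinuousOn (fun q : ℝ × ℝ => resolventSeries γ δ μ β ρ ω q.1 q.2)
      (Icc (-L) L ×ˢ Icc (t / 2) (t + 1)) := by
    refine continuousOn_tsum (u := fun i => (t + 1) ^ (-β) * Real.exp (2 * σ * (t + 1)) * B
      * (|dblCoeff γ δ ω L i| * σ ^ (-dblExp μ β ρ i))) (fun i => ?_) (hd.summable.mul_left _)
      fun i q hq => ?_
    · refine ContinuousOn.mul (Continuous.continuousOn ?_) ?_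
      · simp only [dblCoeff]
        fun_prop
      · exact (continuousOn_powKernel _).comp continuousOn_snd fun q hq =>
          show (0 : ℝ) < q.2 by linarith [hq.2.1]
    · have hle : |dblCoeff γ δ ω q.1 i| ≤ |dblCoeff γ δ ω L i| := by
        have e : ∀ l, |dblCoeff γ δ ω l i|
            = |l| ^ i.1 * |pochCoeff (γ * i.1 + δ) i.2 * ω ^ i.2| := fun l => by
          rw [dblCoeff, abs_mul, abs_pow, abs_neg]
        rw [e, e, abs_of_nonneg hL0]
        exact mul_le_mul_of_nonneg_right
          (pow_le_pow_left₀ (abs_nonneg _) (abs_le.2 ⟨hq.1.1, hq.1.2⟩) _) (abs_nonneg _)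
      have hz := powKernel_nonneg (hd.pos' i) (show 0 ≤ q.2 by linarith [hq.2.1])
      calc ‖dblCoeff γ δ ω q.1 i * powKernel (dblExp μ β ρ i) q.2‖
          ≤ |dblCoeff γ δ ω L i * powKernel (dblExp μ β ρ i) q.2| := by
            rw [Real.norm_eq_abs, abs_mul, abs_mul]
            exact mul_le_mul_of_nonneg_right hle (abs_nonneg _)
        _ ≤ _ := hd.abs_term_le (T := t + 1) ⟨by linarith [hq.2.1], hq.2.2⟩ i
        _ ≤ _ := by
            refine mul_le_mul_of_nonneg_right (mul_le_mul_of_nonneg_left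
              ((le_abs_self _).trans (hB _ hq.2)) (by positivity)) ?_
            exact mul_nonneg (abs_nonneg _) (Real.rpow_nonneg hσ.le _)
  exact (hc.continuousAt hm).continuousWithinAt

/-- The superposition `∫ w k * Φ k t dk` of a family of kernels. -/
def superpose (w : ℝ → ℝ) (Φ : ℝ → ℝ → ℝ) (t : ℝ) : ℝ := ∫ k, w k * Φ k t

section Superposition

variable {w : ℝ → ℝ} {Φ : ℝ → ℝ → ℝ}

theorem UnifGood.abs {ι : Type*} {Φ : ι → ℝ → ℝ} (h : UnifGood Φ) :
    UnifGood fun i t => |Φ i t| :=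
  ⟨fun i => (h.good i).abs, by simpa using h.bound⟩

theorem continuous_slice (hc : ContinuousOn (fun q : ℝ × ℝ => Φ q.1 q.2) (univ ×ˢ Ioi 0)) {t : ℝ}
    (ht : 0 < t) : Continuous fun k => Φ k t := by
  rw [← continuousOn_univ]
  exact hc.comp (f := fun k : ℝ => (k, t)) (by fun_prop) fun k _ => ⟨mem_univ _, ht⟩

theorem integrable_superpose (hw : Integrable w) (hΦ : UnifGood Φ)
    (hc : ContinuousOn (fun q : ℝ × ℝ => Φ q.1 q.2) (univ ×ˢ Ioi 0)) {t : ℝ} (ht : 0 < t) :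
    Integrable fun k => w k * Φ k t := by
  obtain ⟨C, _, hC⟩ := hΦ.bound t ht
  refine (hw.norm.mul_const (C / t)).mono'
    (hw.aestronglyMeasurable.mul (continuous_slice hc ht).aestronglyMeasurable)
    (Eventually.of_forall fun k => ?_)
  rw [norm_mul]
  refine mul_le_mul_of_nonneg_left ?_ (norm_nonneg _)
  rw [le_div_iff₀ ht, mul_comm]
  exact (hC k).2 t ⟨ht, le_rfl⟩

theorem continuousOn_superpose (hw : Integrable w) (hΦ : UnifGood Φ)
    (hc : ContinuousOn (fun q : ℝ × ℝ => Φ q.1 q.2) (univ ×ˢ Ioi 0)) :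
    ContinuousOn (superpose w Φ) (Ioi 0) := by
  intro t ht
  have ht0 : (0 : ℝ) < t := ht
  obtain ⟨C, hC0, hC⟩ := hΦ.bound (t + 1) (by linarith)
  refine ContinuousAt.continuousWithinAt ?_
  have hm : Ioo (t / 2) (t + 1) ∈ 𝓝 t := Ioo_mem_nhds (by linarith) (by linarith)
  refine continuousAt_of_dominated (bound := fun k => ‖w k‖ * (C / (t / 2))) ?_ ?_
    (hw.norm.mul_const _) ?_
  · filter_upwards [hm] with s hs
    exact (integrable_superpose hw hΦ hc (by linarith [hs.1])).aestronglyMeasurable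
  · filter_upwards [hm] with s hs
    refine Eventually.of_forall fun k => ?_
    rw [norm_mul]
    refine mul_le_mul_of_nonneg_left ?_ (norm_nonneg _)
    have hs0 : 0 < s := by linarith [hs.1]
    rw [le_div_iff₀ (by linarith), mul_comm]
    refine le_trans ?_ ((hC k).2 s ⟨hs0, hs.2.le⟩)
    exact mul_le_mul_of_nonneg_right hs.1.le (abs_nonneg _)
  · refine Eventually.of_forall fun k => ContinuousAt.mul continuousAt_const ?_
    have h1 : ContinuousAt (fun q : ℝ × ℝ => Φ q.1 q.2) (k, t) :=
      hc.continuousAt ((isOpen_univ.prod isOpen_Ioi).mem_nhds ⟨mem_univ _, ht⟩)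
    exact ContinuousAt.comp (f := fun s : ℝ => (k, s)) h1 (by fun_prop)

/-- Integrating absolute values in time first gives `|w k|` times `|κ| * |Φ k|` at `t`, which is at
most `C / t` uniformly in `k`. This is what justifies Fubini for superpositions. -/
theorem integrable_prod_superpose {κ : ℝ → ℝ} (hκ : Good κ) (hw : Integrable w) (hΦ : UnifGood Φ)
    (hc : ContinuousOn (fun q : ℝ × ℝ => Φ q.1 q.2) (univ ×ˢ Ioi 0)) {t : ℝ} (ht : 0 < t) :
    Integrable (fun q : ℝ × ℝ => κ (t - q.2) * (w q.1 * Φ q.1 q.2))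
      (volume.prod (volume.restrict (Ioo 0 t))) := by
  have hm : AEStronglyMeasurable (fun q : ℝ × ℝ => κ (t - q.2) * (w q.1 * Φ q.1 q.2))
      (volume.prod (volume.restrict (Ioo 0 t))) := by
    refine AEStronglyMeasurable.mul ?_ (AEStronglyMeasurable.mul ?_ ?_)
    · refine AEStronglyMeasurable.comp_snd (f := fun y => κ (t - y)) ?_
      exact ((intervalIntegrable_iff_integrableOn_Ioo_of_le ht.le).1
        (hκ.locInt.comp_sub ht.le)).aestronglyMeasurable
    · exact hw.aestronglyMeasurable.comp_fst
    · rw [← Measure.restrict_univ (μ := (volume : Measure ℝ)), Measure.restrict_restrict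
        measurableSet_Ioo, inter_univ, Measure.prod_restrict]
      exact (hc.mono (prod_mono_right Ioo_subset_Ioi_self)).aestronglyMeasurable
        (MeasurableSet.univ.prod measurableSet_Ioo)
  rw [integrable_prod_iff hm]
  obtain ⟨C, _, hC⟩ := (hΦ.abs.conv hκ.abs).bound t ht
  have hi : ∀ k, IntegrableOn (fun y => κ (t - y) * Φ k y) (Ioo 0 t) := fun k =>
    (HalfConvAt.iff_integrableOn ht.le).1 (hκ.halfConvAt (hΦ.good k) ht)
  refine ⟨Eventually.of_forall fun k => ?_, ?_⟩
  · refine ((hi k).const_mul (w k)).congr (Eventually.of_forall fun y => ?_)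
    simp only
    ring
  · refine (hw.norm.mul_const (C / t)).mono' hm.norm.integral_prod_right'
      (Eventually.of_forall fun k => ?_)
    have e : ∫ y in Ioo 0 t, ‖κ (t - y) * (w k * Φ k y)‖
        = ‖w k‖ * halfConv (fun s => |κ s|) (fun s => |Φ k s|) t := by
      rw [halfConv, intervalIntegral.integral_of_le ht.le, integral_Ioc_eq_integral_Ioo,
        ← integral_const_mul]
      congr 1
      ext y
      simp only [Real.norm_eq_abs, abs_mul]
      ring
    have hn : 0 ≤ halfConv (fun s => |κ s|) (fun s => |Φ k s|) t :=
      halfConv_nonneg ht.le (fun _ _ => abs_nonneg _) fun _ _ => abs_nonneg _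
    rw [e, Real.norm_of_nonneg (mul_nonneg (norm_nonneg _) hn)]
    refine mul_le_mul_of_nonneg_left ?_ (norm_nonneg _)
    have := (hC k).2 t ⟨ht, le_rfl⟩
    rw [abs_of_nonneg hn] at this
    rw [le_div_iff₀ ht]
    linarith

theorem halfConv_superpose {κ : ℝ → ℝ} (hκ : Good κ) (hw : Integrable w) (hΦ : UnifGood Φ)
    (hc : ContinuousOn (fun q : ℝ × ℝ => Φ q.1 q.2) (univ ×ˢ Ioi 0)) {t : ℝ} (ht : 0 < t) :
    halfConv κ (superpose w Φ) t = superpose w (fun k => halfConv κ (Φ k)) t := by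
  have hsw := integral_integral_swap (f := fun k y => κ (t - y) * (w k * Φ k y))
    (integrable_prod_superpose hκ hw hΦ hc ht)
  rw [halfConv, intervalIntegral.integral_of_le ht.le, integral_Ioc_eq_integral_Ioo]
  simp only [superpose]
  simp_rw [← integral_const_mul]
  rw [← hsw]
  congr 1
  ext k
  rw [halfConv, intervalIntegral.integral_of_le ht.le, integral_Ioc_eq_integral_Ioo,
    ← integral_const_mul]
  congr 1
  ext y
  ring

theorem good_superpose (hw : Integrable w) (hΦ : UnifGood Φ)
    (hc : ContinuousOn (fun q : ℝ × ℝ => Φ q.1 q.2) (univ ×ˢ Ioi 0)) : Good (superpose w Φ) := by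
  refine ⟨fun T => ?_, fun T => ?_⟩
  · rcases le_or_gt T 0 with hT | hT
    · simp [Ioc_eq_empty (not_lt.2 hT)]
    -- With the constant kernel `1`, integrability on the product yields integrability in time.
    have h := (integrable_prod_superpose good_one hw hΦ hc hT).integral_prod_right
    simp only [one_mul] at h
    rw [integrableOn_Ioc_iff_integrableOn_Ioo]
    exact h
  · rcases le_or_gt T 0 with hT | hT
    · exact ⟨0, fun t ht => absurd (ht.1.trans_le ht.2) (not_lt.2 hT)⟩
    obtain ⟨C, hC0, hC⟩ := hΦ.bound T hT
    refine ⟨C * ∫ k, ‖w k‖, fun t ht => ?_⟩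
    have h1 : |superpose w Φ t| ≤ ∫ k, C / t * ‖w k‖ := by
      rw [← Real.norm_eq_abs]
      refine norm_integral_le_of_norm_le (hw.norm.const_mul _) (Eventually.of_forall fun k => ?_)
      rw [norm_mul, mul_comm]
      refine mul_le_mul_of_nonneg_right ?_ (norm_nonneg _)
      rw [le_div_iff₀ ht.1, mul_comm]
      exact (hC k).2 t ht
    rw [integral_const_mul] at h1
    calc t * |superpose w Φ t| ≤ t * (C / t * ∫ k, ‖w k‖) :=
          mul_le_mul_of_nonneg_left h1 ht.1.le
      _ = _ := by
          have := ht.1.ne'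
          field_simp

end Superposition

/-! ### Trigonometric integrals -/

/-- The integral `∫ (A k cos (k x) + B k sin (k x)) Φ k dk` differentiates under the integral. -/
theorem hasDerivAt_trig_integral {A B : ℝ → ℝ} (hA : Integrable A) (hB : Integrable B)
    (hA' : Integrable fun k => k * A k) (hB' : Integrable fun k => k * B k) (x : ℝ) :
    HasDerivAt (fun x => ∫ k, (A k * Real.cos (k * x) + B k * Real.sin (k * x)))
      (∫ k, (k * B k * Real.cos (k * x) + -(k * A k) * Real.sin (k * x))) x := by
  have hmeas : ∀ {A B : ℝ → ℝ}, Integrable A → Integrable B → ∀ x : ℝ,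
      AEStronglyMeasurable fun k => A k * Real.cos (k * x) + B k * Real.sin (k * x) :=
    fun hA hB x => (hA.aestronglyMeasurable.mul (by fun_prop)).add
      (hB.aestronglyMeasurable.mul (by fun_prop))
  refine (hasDerivAt_integral_of_dominated_loc_of_deriv_le (s := univ)
    (F := fun x k => A k * Real.cos (k * x) + B k * Real.sin (k * x))
    (F' := fun x k => k * B k * Real.cos (k * x) + -(k * A k) * Real.sin (k * x))
    (bound := fun k => ‖k * B k‖ + ‖k * A k‖) univ_mem
    (Eventually.of_forall (hmeas hA hB)) ?_ (hmeas hB' hA'.neg x) ?_ (hB'.norm.add hA'.norm) ?_).2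
  · exact (hA.mul_bdd (c := 1) (by fun_prop)
      (Eventually.of_forall fun k => Real.abs_cos_le_one _)).add
      (hB.mul_bdd (c := 1) (by fun_prop) (Eventually.of_forall fun k => Real.abs_sin_le_one _))
  · refine Eventually.of_forall fun k y _ => (norm_add_le _ _).trans (add_le_add ?_ ?_)
    · rw [norm_mul]
      exact mul_le_of_le_one_right (norm_nonneg _) (Real.abs_cos_le_one _)
    · rw [norm_mul]
      refine (mul_le_of_le_one_right (norm_nonneg _) (Real.abs_sin_le_one _)).trans_eq ?_
      exact norm_neg _
  · refine Eventually.of_forall fun k y _ => ?_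
    have h1 : HasDerivAt (fun y => k * y) k y := by simpa using (hasDerivAt_id y).const_mul k
    have h2 := (h1.cos.const_mul (A k)).add (h1.sin.const_mul (B k))
    convert! h2 using 1
    ring

theorem continuous_trig_integral {A B : ℝ → ℝ} (hA : Integrable A) (hB : Integrable B) :
    Continuous fun x => ∫ k, (A k * Real.cos (k * x) + B k * Real.sin (k * x)) := by
  refine continuous_of_dominated (bound := fun k => ‖A k‖ + ‖B k‖) (fun x =>
    (hA.aestronglyMeasurable.mul (by fun_prop)).add (hB.aestronglyMeasurable.mul (by fun_prop)))
    (fun x => Eventually.of_forall fun k => ?_) (hA.norm.add hB.norm)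
    (Eventually.of_forall fun k => by fun_prop)
  refine (norm_add_le _ _).trans (add_le_add ?_ ?_)
  · rw [norm_mul]
    exact mul_le_of_le_one_right (norm_nonneg _) (Real.abs_cos_le_one _)
  · rw [norm_mul]
    exact mul_le_of_le_one_right (norm_nonneg _) (Real.abs_sin_le_one _)



/-! ### Prabhakar integrals on the algebra of kernels -/

/-- The parameters for which the Prabhakar integral is a convolution or the identity. -/
def Admissible (ε α : ℝ) : Prop := 0 < α ∨ α = 0 ∧ ε = 0

section PrabhakarIntegral

variable {ε ρ α ω : ℝ}

theorem prabhakarIntegral_of_pos (hα : 0 < α) (f : ℝ → ℝ) :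
    prabhakarIntegral ε ρ α ω f = halfConv (prabhakarKernel ε ρ α ω) f := by
  ext t
  rw [prabhakarIntegral, if_neg fun h => hα.ne' h.1, halfConv]

theorem prabhakarIntegral_of_zero (h : α = 0 ∧ ε = 0) (f : ℝ → ℝ) :
    prabhakarIntegral ε ρ α ω f = f := by
  ext t
  rw [prabhakarIntegral, if_pos h]

theorem prabhakarIntegrableAt_of_good (hρ : 0 < ρ) (h : Admissible ε α) {f : ℝ → ℝ} (hf : Good f)
    {t : ℝ} (ht : 0 < t) : PrabhakarIntegrableAt ε ρ α ω f t := by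
  rcases h with hα | h
  · exact Or.inr ((good_prabhakarKernel hρ ε ω hα).halfConvAt hf ht)
  · exact Or.inl h

theorem UnifGood.prabhakarIntegral {ι : Type*} (hρ : 0 < ρ) (h : Admissible ε α) {Φ : ι → ℝ → ℝ}
    (hΦ : UnifGood Φ) : UnifGood fun i => prabhakarIntegral ε ρ α ω (Φ i) := by
  rcases h with hα | h
  · simp only [prabhakarIntegral_of_pos hα]
    exact hΦ.conv (good_prabhakarKernel hρ ε ω hα)
  · simpa only [prabhakarIntegral_of_zero h] using hΦ

theorem prabhakarIntegral_congr (h : Admissible ε α) {f f' : ℝ → ℝ} {t : ℝ} (ht : 0 < t)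
    (hf : EqOn f f' (Ioi 0)) :
    prabhakarIntegral ε ρ α ω f t = prabhakarIntegral ε ρ α ω f' t := by
  rcases h with hα | h
  · rw [prabhakarIntegral_of_pos hα, prabhakarIntegral_of_pos hα]
    exact halfConv_congr ht.le (fun _ _ => rfl) fun s hs => hf hs.1
  · rw [prabhakarIntegral_of_zero h, prabhakarIntegral_of_zero h]
    exact hf ht

theorem prabhakarIntegral_const_mul (c : ℝ) (f : ℝ → ℝ) (t : ℝ) :
    prabhakarIntegral ε ρ α ω (fun s => c * f s) t = c * prabhakarIntegral ε ρ α ω f t := by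
  by_cases h : α = 0 ∧ ε = 0
  · rw [prabhakarIntegral_of_zero h, prabhakarIntegral_of_zero h]
  · rw [prabhakarIntegral, if_neg h, prabhakarIntegral, if_neg h]
    exact halfConv_const_mul_right c (prabhakarKernel ε ρ α ω) f t

theorem prabhakarIntegral_superpose (hρ : 0 < ρ) (h : Admissible ε α) {w : ℝ → ℝ}
    {Φ : ℝ → ℝ → ℝ} (hw : Integrable w) (hΦ : UnifGood Φ)
    (hc : ContinuousOn (fun q : ℝ × ℝ => Φ q.1 q.2) (univ ×ˢ Ioi 0)) {t : ℝ} (ht : 0 < t) :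
    prabhakarIntegral ε ρ α ω (superpose w Φ) t
      = superpose w (fun k => prabhakarIntegral ε ρ α ω (Φ k)) t := by
  rcases h with hα | h
  · simp only [prabhakarIntegral_of_pos hα]
    exact halfConv_superpose (good_prabhakarKernel hρ ε ω hα) hw hΦ hc ht
  · simp only [prabhakarIntegral_of_zero h]

theorem prabhakarIntegral_resolventSeries (hρ : 0 < ρ) (h : Admissible ε α) {γ δ μ β l : ℝ}
    (hγ : 0 ≤ γ) (hμ : 0 < μ) (hβ : 0 < β) {t : ℝ} (ht : 0 < t) :
    prabhakarIntegral ε ρ α ω (resolventSeries γ δ μ β ρ ω l) t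
      = resolventSeries γ (δ + ε) μ (β + α) ρ ω l t := by
  rcases h with hα | h
  · rw [prabhakarIntegral_of_pos hα]
    exact halfConv_prabhakarKernel_resolventSeries hγ hμ hρ δ ε ω l hβ hα ht
  · rw [prabhakarIntegral_of_zero h, h.1, h.2, add_zero, add_zero]

end PrabhakarIntegral

/-! ### The series of the solution formula -/

section Series

variable {γ μ ν ρ ω K : ℝ}

/-- The symbol of the solution operator, as a function of the frequency `k` and time. -/
def solutionSymbol (γ μ ν ρ ω K k : ℝ) : ℝ → ℝ :=
  resolventSeries γ (γ * (1 - ν)) μ (μ + ν * (1 - μ)) ρ ω (K * k ^ 2)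

/-- The resolvent of the kernel `e^γ_{ρ,μ,ω}` at the spectral parameter `K k²`. -/
def resolventSymbol (γ μ ρ ω K k : ℝ) : ℝ → ℝ :=
  resolventSeries γ γ μ μ ρ ω (K * k ^ 2)

theorem doubleSeriesTerm_eq (γ μ ν ρ ω K k : ℝ) {t : ℝ} (ht : 0 < t) (p : ℕ × ℕ) :
    doubleSeriesTerm γ μ ν ρ ω K k t p = dblCoeff γ (γ * (1 - ν)) ω (K * k ^ 2) p
      * powKernel (dblExp μ (μ + ν * (1 - μ)) ρ p) t := by
  have h := prabhakar_term_eq (γ * (p.1 + 1 - ν)) ρ (μ * (p.1 + 1) - ν * (μ - 1)) ω ht p.2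
  rw [doubleSeriesTerm, mul_assoc ((-K) ^ p.1), h, dblCoeff, dblExp,
    show γ * (p.1 + 1 - ν) = γ * p.1 + γ * (1 - ν) by ring,
    show ρ * p.2 + (μ * (p.1 + 1) - ν * (μ - 1)) = ρ * p.2 + (μ * p.1 + (μ + ν * (1 - μ))) by ring,
    show (-(K * k ^ 2)) ^ p.1 = (-K) ^ p.1 * k ^ (2 * p.1) by rw [pow_mul, ← mul_pow]; ring]
  ring

theorem seriesTerm_eq_tsum (γ μ ν ρ ω K k t : ℝ) (n : ℕ) :
    seriesTerm γ μ ν ρ ω K k t n = ∑' r : ℕ, doubleSeriesTerm γ μ ν ρ ω K k t (n, r) := by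
  simp only [doubleSeriesTerm]
  rw [tsum_mul_right, tsum_mul_left]
  rfl

theorem order_pos (hμ : μ ∈ Ioo (0 : ℝ) 1) (hν : ν ∈ Icc (0 : ℝ) 1) : 0 < μ + ν * (1 - μ) := by
  nlinarith [hμ.1, hμ.2, hν.1]

theorem hasSum_doubleSeriesTerm (hμ : μ ∈ Ioo (0 : ℝ) 1) (hν : ν ∈ Icc (0 : ℝ) 1)
    (hρ : 0 < ρ) (hγ : 0 ≤ γ) (k : ℝ) {t : ℝ} (ht : 0 < t) :
    HasSum (doubleSeriesTerm γ μ ν ρ ω K k t) (solutionSymbol γ μ ν ρ ω K k t) := by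
  have h := resolventSeries_hasSum hγ hμ.1 hρ (γ * (1 - ν)) ω (K * k ^ 2) (order_pos hμ hν) ht
  exact h.congr_fun fun p => doubleSeriesTerm_eq γ μ ν ρ ω K k ht p

theorem summable_abs_doubleSeriesTerm (hμ : μ ∈ Ioo (0 : ℝ) 1) (hν : ν ∈ Icc (0 : ℝ) 1)
    (hρ : 0 < ρ) (hγ : 0 ≤ γ) (k : ℝ) {t : ℝ} (ht : 0 < t) :
    Summable fun p => |doubleSeriesTerm γ μ ν ρ ω K k t p| :=
  (hasSum_doubleSeriesTerm hμ hν hρ hγ k ht).summable.abs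

theorem summable_abs_seriesTerm (hμ : μ ∈ Ioo (0 : ℝ) 1) (hν : ν ∈ Icc (0 : ℝ) 1)
    (hρ : 0 < ρ) (hγ : 0 ≤ γ) (k : ℝ) {t : ℝ} (ht : 0 < t) :
    Summable fun n => |seriesTerm γ μ ν ρ ω K k t n| := by
  simp only [seriesTerm_eq_tsum]
  exact (hasSum_doubleSeriesTerm hμ hν hρ hγ k ht).summable.prod.abs

theorem tsum_seriesTerm (hμ : μ ∈ Ioo (0 : ℝ) 1) (hν : ν ∈ Icc (0 : ℝ) 1)
    (hρ : 0 < ρ) (hγ : 0 ≤ γ) (k : ℝ) {t : ℝ} (ht : 0 < t) :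
    ∑' n, seriesTerm γ μ ν ρ ω K k t n = solutionSymbol γ μ ν ρ ω K k t := by
  have h := hasSum_doubleSeriesTerm (ω := ω) (K := K) hμ hν hρ hγ k ht
  rw [← h.tsum_eq, h.summable.tsum_prod]
  simp only [seriesTerm_eq_tsum]

/-- At the endpoint `ν = 1` both parameters vanish together, and the inner integral is the identity.
The endpoint `ν = 0` plays the same role for the outer one. -/
theorem admissible_inner (hμ : μ ∈ Ioo (0 : ℝ) 1) (hν : ν ∈ Icc (0 : ℝ) 1) (γ : ℝ) :
    Admissible (-γ * (1 - ν)) ((1 - ν) * (1 - μ)) := by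
  rcases hν.2.eq_or_lt with h | h
  · exact Or.inr (by simp [h])
  · exact Or.inl (mul_pos (by linarith) (by linarith [hμ.2]))

theorem admissible_outer (hμ : μ ∈ Ioo (0 : ℝ) 1) (hν : ν ∈ Icc (0 : ℝ) 1) (γ : ℝ) :
    Admissible (-γ * ν) (ν * (1 - μ)) := by
  rcases hν.1.eq_or_lt with h | h
  · exact Or.inr (by simp [← h])
  · exact Or.inl (mul_pos h (by linarith [hμ.2]))

theorem outer_resolventSymbol (hμ : μ ∈ Ioo (0 : ℝ) 1) (hν : ν ∈ Icc (0 : ℝ) 1)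
    (hρ : 0 < ρ) (hγ : 0 ≤ γ) (k : ℝ) {t : ℝ} (ht : 0 < t) :
    prabhakarIntegral (-γ * ν) ρ (ν * (1 - μ)) ω (resolventSymbol γ μ ρ ω K k) t
      = solutionSymbol γ μ ν ρ ω K k t := by
  rw [resolventSymbol, prabhakarIntegral_resolventSeries hρ (admissible_outer hμ hν γ) hγ hμ.1 hμ.1
    ht, solutionSymbol]
  congr 1
  ring

/-- The parameters of `S` and of the inner kernel add up to `(0, 1)`, and `e^0_{ρ,1,ω} = 1`. Hence
every frequency has initial value `1`, and the time derivative of the inner integral is `-K k²`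
times the resolvent. -/
theorem inner_solutionSymbol (hμ : μ ∈ Ioo (0 : ℝ) 1) (hν : ν ∈ Icc (0 : ℝ) 1)
    (hρ : 0 < ρ) (hγ : 0 ≤ γ) (k : ℝ) {t : ℝ} (ht : 0 < t) :
    innerIntegral γ μ ν ρ ω (solutionSymbol γ μ ν ρ ω K k) t
      = 1 - halfConv (fun _ => 1) (fun s => K * k ^ 2 * resolventSymbol γ μ ρ ω K k s) t := by
  have h1 : ∀ s > 0, prabhakarKernel 0 ρ 1 ω s = 1 := fun s hs => by
    rw [prabhakarKernel_zero _ _ _ hs, powKernel_one]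
  rw [innerIntegral, solutionSymbol, prabhakarIntegral_resolventSeries hρ
    (admissible_inner hμ hν γ) hγ hμ.1 (order_pos hμ hν) ht,
    show γ * (1 - ν) + -γ * (1 - ν) = 0 by ring,
    show μ + ν * (1 - μ) + (1 - ν) * (1 - μ) = 1 by ring,
    resolventSeries_shift hγ hμ.1 hρ 0 ω _ one_pos ht, h1 t ht, halfConv_const_mul_right]
  congr 2
  have h2 := halfConv_prabhakarKernel_resolventSeries hγ hμ.1 hρ γ 0 ω (K * k ^ 2) hμ.1 one_pos ht
  rw [add_zero] at h2
  rw [zero_add, add_comm 1 μ, ← h2]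
  exact halfConv_congr ht.le (fun s hs => h1 s hs.1) fun _ _ => rfl

theorem unifGood_mul_resolventSymbol (hμ : μ ∈ Ioo (0 : ℝ) 1) (hρ : 0 < ρ) (hγ : 0 ≤ γ)
    (hK : 0 < K) : UnifGood fun k s => K * k ^ 2 * resolventSymbol γ μ ρ ω K k s :=
  unifGood_mul_resolvent hγ hμ.1 hμ.2 hρ ω (fun k : ℝ => K * k ^ 2) fun k => by positivity

theorem unifGood_solutionSymbol (hμ : μ ∈ Ioo (0 : ℝ) 1) (hν : ν ∈ Icc (0 : ℝ) 1) (hρ : 0 < ρ)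
    (hγ : 0 ≤ γ) (hK : 0 < K) : UnifGood (solutionSymbol γ μ ν ρ ω K) :=
  ((unifGood_resolvent hγ hμ.1 hμ.2 hρ ω (fun k : ℝ => K * k ^ 2)
    fun k => by positivity).prabhakarIntegral (ω := ω) hρ (admissible_outer hμ hν γ)).congr
      fun k _ ht => outer_resolventSymbol hμ hν hρ hγ k ht

/-- `K k² S` is the outer integral of `K k² p` and inherits its bounds. This gain of two powers of
`k` at each `t > 0` makes the solution twice differentiable although only `ĝ ∈ L¹`. -/
theorem unifGood_mul_solutionSymbol (hμ : μ ∈ Ioo (0 : ℝ) 1) (hν : ν ∈ Icc (0 : ℝ) 1)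
    (hρ : 0 < ρ) (hγ : 0 ≤ γ) (hK : 0 < K) :
    UnifGood fun k s => K * k ^ 2 * solutionSymbol γ μ ν ρ ω K k s :=
  ((unifGood_mul_resolventSymbol (ω := ω) hμ hρ hγ hK).prabhakarIntegral (ω := ω) hρ
    (admissible_outer hμ hν γ)).congr fun k t ht => by
      rw [prabhakarIntegral_const_mul, outer_resolventSymbol hμ hν hρ hγ k ht]

theorem continuousOn_resolventSymbol (hμ : μ ∈ Ioo (0 : ℝ) 1) (hρ : 0 < ρ) (hγ : 0 ≤ γ) :
    ContinuousOn (fun q : ℝ × ℝ => resolventSymbol γ μ ρ ω K q.1 q.2) (univ ×ˢ Ioi 0) :=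
  (continuousOn_uncurry_resolventSeries hγ hμ.1 hρ γ ω hμ.1).comp
    (f := fun q : ℝ × ℝ => (K * q.1 ^ 2, q.2)) (by fun_prop) fun _ hq => ⟨mem_univ _, hq.2⟩

theorem continuousOn_solutionSymbol (hμ : μ ∈ Ioo (0 : ℝ) 1) (hν : ν ∈ Icc (0 : ℝ) 1)
    (hρ : 0 < ρ) (hγ : 0 ≤ γ) :
    ContinuousOn (fun q : ℝ × ℝ => solutionSymbol γ μ ν ρ ω K q.1 q.2) (univ ×ˢ Ioi 0) :=
  (continuousOn_uncurry_resolventSeries hγ hμ.1 hρ (γ * (1 - ν)) ω (order_pos hμ hν)).comp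
    (f := fun q : ℝ × ℝ => (K * q.1 ^ 2, q.2)) (by fun_prop) fun _ hq => ⟨mem_univ _, hq.2⟩

end Series



/-! ### The Fourier transform of the datum -/

section FourierHat

open scoped FourierTransform

variable {g : ℝ → ℝ}

theorem fourierHat_eq_fourier (g : ℝ → ℝ) (k : ℝ) :
    fourierHat g k = 𝓕 (fun x => (g x : ℂ)) (-(k / (2 * Real.pi))) := by
  rw [Real.fourier_eq', fourierHat]
  congr 1
  ext x
  rw [smul_eq_mul]
  congr 2
  have : (Real.pi : ℂ) ≠ 0 := Complex.ofReal_ne_zero.2 Real.pi_ne_zero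
  simp only [RCLike.inner_apply, conj_trivial]
  push_cast
  field_simp

theorem fourierHat_neg (g : ℝ → ℝ) (k : ℝ) :
    fourierHat g (-k) = (starRingEnd ℂ) (fourierHat g k) := by
  rw [fourierHat, fourierHat, ← integral_conj]
  congr 1
  ext x
  rw [map_mul, ← Complex.exp_conj, Complex.conj_ofReal]
  congr 2
  simp

/-- Fourier inversion in the normalization of `fourierHat`. -/
theorem integral_exp_mul_fourierHat (hc : Continuous g) (hg : Integrable g)
    (hĝ : Integrable (fourierHat g)) (x : ℝ) :
    (1 / (2 * Real.pi) : ℝ) * ∫ k : ℝ, Complex.exp (-(Complex.I * k * x)) * fourierHat g k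
      = (g x : ℂ) := by
  have hpi : (0 : ℝ) < 2 * Real.pi := by positivity
  have hF : (fun ξ : ℝ => 𝓕 (fun x => (g x : ℂ)) ξ) = fun ξ => fourierHat g (-(2 * Real.pi) * ξ) := by
    ext ξ
    rw [fourierHat_eq_fourier]
    field_simp
  have hint : Integrable (𝓕 (fun x => (g x : ℂ))) := by
    have : Integrable fun ξ => fourierHat g (-(2 * Real.pi) * ξ) :=
      hĝ.comp_mul_left' (by linarith)
    rwa [← hF] at this
  have hinv := congrFun (Continuous.fourierInv_fourier_eq
    (f := fun x => (g x : ℂ)) (by fun_prop) hg.ofReal hint) x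
  rw [Real.fourierInv_eq'] at hinv
  have hsub := Measure.integral_comp_mul_left
    (fun k : ℝ => Complex.exp (-(Complex.I * k * x)) * fourierHat g k) (-(2 * Real.pi))
  rw [← hinv]
  have habs : |(-(2 * Real.pi))⁻¹| = 1 / (2 * Real.pi) := by
    rw [abs_inv, abs_neg, abs_of_pos hpi, one_div]
  rw [habs, Complex.real_smul] at hsub
  rw [← hsub]
  congr 1
  ext ξ
  rw [smul_eq_mul, ← congrFun hF ξ]
  congr 2
  simp only [RCLike.inner_apply, conj_trivial]
  push_cast
  ring

/-- The real amplitude `Re (e^{-ikx} ĝ(k)) / (2π)`. -/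
def amplitude (g : ℝ → ℝ) (x k : ℝ) : ℝ :=
  (fourierHat g k).re / (2 * Real.pi) * Real.cos (k * x)
    + (fourierHat g k).im / (2 * Real.pi) * Real.sin (k * x)

theorem re_exp_mul_fourierHat (g : ℝ → ℝ) (x k s : ℝ) :
    (Complex.exp (-(Complex.I * k * x)) * fourierHat g k * ((1 / (2 * Real.pi) * s : ℝ) : ℂ)).re
      = amplitude g x k * s := by
  rw [Complex.re_mul_ofReal, Complex.mul_re, amplitude,
    show -(Complex.I * k * x) = ((-(k * x) : ℝ) : ℂ) * Complex.I by push_cast; ring,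
    Complex.exp_ofReal_mul_I_re, Complex.exp_ofReal_mul_I_im, Real.cos_neg, Real.sin_neg]
  ring

theorem integrable_re_fourierHat (hĝ : Integrable (fourierHat g)) :
    Integrable fun k => (fourierHat g k).re / (2 * Real.pi) := hĝ.re.div_const _

theorem integrable_im_fourierHat (hĝ : Integrable (fourierHat g)) :
    Integrable fun k => (fourierHat g k).im / (2 * Real.pi) := hĝ.im.div_const _

theorem integrable_amplitude (hĝ : Integrable (fourierHat g)) (x : ℝ) :
    Integrable (amplitude g x) :=
  ((integrable_re_fourierHat hĝ).mul_bdd (c := 1) (by fun_prop)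
    (Eventually.of_forall fun k => Real.abs_cos_le_one _)).add
  ((integrable_im_fourierHat hĝ).mul_bdd (c := 1) (by fun_prop)
    (Eventually.of_forall fun k => Real.abs_sin_le_one _))

theorem integrable_exp_mul_fourierHat (hĝ : Integrable (fourierHat g)) (x : ℝ) :
    Integrable fun k : ℝ => Complex.exp (-(Complex.I * k * x)) * fourierHat g k := by
  refine hĝ.bdd_mul (c := 1) (by fun_prop) (Eventually.of_forall fun k => ?_)
  rw [show -(Complex.I * k * x) = ((-(k * x) : ℝ) : ℂ) * Complex.I by push_cast; ring,
    Complex.norm_exp_ofReal_mul_I]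

theorem integral_amplitude (hc : Continuous g) (hg : Integrable g)
    (hĝ : Integrable (fourierHat g)) (x : ℝ) : ∫ k, amplitude g x k = g x := by
  have h := congrArg Complex.re (integral_exp_mul_fourierHat hc hg hĝ x)
  rw [Complex.ofReal_re, Complex.re_ofReal_mul] at h
  rw [← h, ← Complex.reCLM_apply, ← ContinuousLinearMap.integral_comp_comm _
    (integrable_exp_mul_fourierHat hĝ x), ← integral_const_mul]
  congr 1
  ext k
  have := re_exp_mul_fourierHat g x k 1
  rw [mul_one, mul_one, Complex.re_mul_ofReal] at this
  rw [← this, Complex.reCLM_apply, mul_comm]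

theorem abs_amplitude_le (g : ℝ → ℝ) (x k : ℝ) :
    |amplitude g x k| ≤ |(fourierHat g k).re / (2 * Real.pi)|
      + |(fourierHat g k).im / (2 * Real.pi)| := by
  refine (abs_add_le _ _).trans (add_le_add ?_ ?_)
  · rw [abs_mul]
    exact mul_le_of_le_one_right (abs_nonneg _) (Real.abs_cos_le_one _)
  · rw [abs_mul]
    exact mul_le_of_le_one_right (abs_nonneg _) (Real.abs_sin_le_one _)

/-- The Riemann-Lebesgue lemma for superpositions. -/
theorem tendsto_integral_amplitude (hĝ : Integrable (fourierHat g)) {s : ℝ → ℝ}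
    (hs : Continuous s) {C : ℝ} (hC : ∀ k, |s k| ≤ C) :
    Tendsto (fun x => ∫ k, amplitude g x k * s k) (cocompact ℝ) (𝓝 0) := by
  have hI : ∀ x : ℝ, Integrable fun k : ℝ => Complex.exp (-(Complex.I * k * x)) * fourierHat g k
      * ((1 / (2 * Real.pi) * s k : ℝ) : ℂ) := fun x => by
    refine (integrable_exp_mul_fourierHat hĝ x).mul_bdd (c := 1 / (2 * Real.pi) * C) (by fun_prop)
      (Eventually.of_forall fun k => ?_)
    rw [Complex.norm_real, norm_mul, Real.norm_of_nonneg (by positivity)]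
    exact mul_le_mul_of_nonneg_left (hC k) (by positivity)
  have h := Real.zero_at_infty_fourier
    (fun k : ℝ => fourierHat g k * ((1 / (2 * Real.pi) * s k : ℝ) : ℂ))
  have hsc : Tendsto (fun x : ℝ => (2 * Real.pi)⁻¹ * x) (cocompact ℝ) (cocompact ℝ) :=
    (Homeomorph.mulLeft₀ (2 * Real.pi)⁻¹ (by positivity)).isClosedEmbedding.tendsto_cocompact
  have h2 := (Complex.continuous_re.tendsto 0).comp (h.comp hsc)
  rw [Complex.zero_re] at h2
  refine h2.congr fun x => ?_
  simp only [Function.comp_apply]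
  rw [Real.fourier_eq']
  have e : ∀ k : ℝ, Complex.exp (↑(-2 * Real.pi * inner ℝ k ((2 * Real.pi)⁻¹ * x)) * Complex.I) •
      (fourierHat g k * ((1 / (2 * Real.pi) * s k : ℝ) : ℂ))
      = Complex.exp (-(Complex.I * k * x)) * fourierHat g k
        * ((1 / (2 * Real.pi) * s k : ℝ) : ℂ) := fun k => by
    rw [smul_eq_mul, ← mul_assoc]
    congr 3
    have : (Real.pi : ℂ) ≠ 0 := Complex.ofReal_ne_zero.2 Real.pi_ne_zero
    simp only [RCLike.inner_apply, conj_trivial]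
    push_cast
    field_simp
  simp_rw [e]
  rw [← Complex.reCLM_apply, ← ContinuousLinearMap.integral_comp_comm _ (hI x)]
  congr 1
  ext k
  rw [Complex.reCLM_apply, re_exp_mul_fourierHat]

/-- The complex superposition is real, because the integrand is Hermitian. -/
theorem integral_exp_mul_eq_amplitude (hĝ : Integrable (fourierHat g)) {s : ℝ → ℝ}
    (hs : Continuous s) {C : ℝ} (hC : ∀ k, |s k| ≤ C) (heven : ∀ k, s (-k) = s k) (x : ℝ) :
    Integrable (fun k : ℝ => Complex.exp (-(Complex.I * k * x)) * fourierHat g k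
      * ((1 / (2 * Real.pi) * s k : ℝ) : ℂ)) ∧
    ((∫ k, amplitude g x k * s k : ℝ) : ℂ) = ∫ k : ℝ,
      Complex.exp (-(Complex.I * k * x)) * fourierHat g k * ((1 / (2 * Real.pi) * s k : ℝ) : ℂ) := by
  have hI : Integrable fun k : ℝ => Complex.exp (-(Complex.I * k * x)) * fourierHat g k
      * ((1 / (2 * Real.pi) * s k : ℝ) : ℂ) := by
    refine (integrable_exp_mul_fourierHat hĝ x).mul_bdd (c := 1 / (2 * Real.pi) * C) (by fun_prop)
      (Eventually.of_forall fun k => ?_)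
    rw [Complex.norm_real, norm_mul, Real.norm_of_nonneg (by positivity)]
    exact mul_le_mul_of_nonneg_left (hC k) (by positivity)
  refine ⟨hI, ?_⟩
  set Ψ : ℝ → ℂ := fun k => Complex.exp (-(Complex.I * k * x)) * fourierHat g k
      * ((1 / (2 * Real.pi) * s k : ℝ) : ℂ) with hΨ
  have hconj : ∀ k, Ψ (-k) = (starRingEnd ℂ) (Ψ k) := fun k => by
    simp only [hΨ]
    rw [heven, fourierHat_neg, map_mul, map_mul, Complex.conj_ofReal, ← Complex.exp_conj]
    congr 3
    simp
  have hreal : (starRingEnd ℂ) (∫ k, Ψ k) = ∫ k, Ψ k := by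
    -- The substitution `k ↦ -k` conjugates the integrand, so the integral is real.
    rw [← integral_conj, ← integral_neg_eq_self Ψ]
    simp_rw [hconj]
  obtain ⟨r, hr⟩ := Complex.conj_eq_iff_real.1 hreal
  have hre : ∫ k, amplitude g x k * s k = (∫ k, Ψ k).re := by
    rw [← Complex.reCLM_apply, ← ContinuousLinearMap.integral_comp_comm _ hI]
    congr 1
    ext k
    rw [Complex.reCLM_apply, re_exp_mul_fourierHat]
  rw [hre, hr, Complex.ofReal_re]

end FourierHat



/-! ### Existence -/

theorem contDiff_two_of_hasDerivAt {f f' f'' : ℝ → ℝ} (h : ∀ x, HasDerivAt f (f' x) x)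
    (h' : ∀ x, HasDerivAt f' (f'' x) x) (hc : Continuous f'') :
    ContDiff ℝ 2 f ∧ iteratedDeriv 2 f = f'' := by
  have e1 : deriv f = f' := funext fun x => (h x).deriv
  have e2 : deriv f' = f'' := funext fun x => (h' x).deriv
  constructor
  · rw [show (2 : WithTop ℕ∞) = 1 + 1 by norm_num, contDiff_succ_iff_deriv]
    refine ⟨fun x => (h x).differentiableAt, by simp, ?_⟩
    rw [e1, contDiff_one_iff_deriv, e2]
    exact ⟨fun x => (h' x).differentiableAt, hc⟩
  · rw [iteratedDeriv_succ, iteratedDeriv_one, e1, e2]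

section Existence

variable {γ μ ν ρ ω K : ℝ} {g : ℝ → ℝ}

/-- The solution of the Cauchy problem, as a superposition of symbols. -/
def solution (γ μ ν ρ ω K : ℝ) (g : ℝ → ℝ) (x : ℝ) : ℝ → ℝ :=
  superpose (amplitude g x) (solutionSymbol γ μ ν ρ ω K)

/-- The negative time derivative of the inner Prabhakar integral of the solution. -/
def solutionFlux (γ μ ρ ω K : ℝ) (g : ℝ → ℝ) (x : ℝ) : ℝ → ℝ :=
  superpose (amplitude g x) fun k s => K * k ^ 2 * resolventSymbol γ μ ρ ω K k s

theorem exists_symbol_bound (hμ : μ ∈ Ioo (0 : ℝ) 1) (hν : ν ∈ Icc (0 : ℝ) 1) (hρ : 0 < ρ)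
    (hγ : 0 ≤ γ) (hK : 0 < K) {t : ℝ} (ht : 0 < t) :
    ∃ C, (∀ k, |solutionSymbol γ μ ν ρ ω K k t| ≤ C) ∧
      ∀ k, |k ^ 2 * solutionSymbol γ μ ν ρ ω K k t| ≤ C := by
  obtain ⟨C, hC0, hC⟩ := (unifGood_solutionSymbol (ω := ω) hμ hν hρ hγ hK).bound t ht
  obtain ⟨D, hD0, hD⟩ := (unifGood_mul_solutionSymbol (ω := ω) hμ hν hρ hγ hK).bound t ht
  refine ⟨C / t + D / (K * t), fun k => ?_, fun k => ?_⟩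
  · have h := (hC k).2 t ⟨ht, le_rfl⟩
    have h2 : |solutionSymbol γ μ ν ρ ω K k t| ≤ C / t := by rwa [le_div_iff₀ ht, mul_comm]
    exact h2.trans (le_add_of_nonneg_right (by positivity))
  · have h := (hD k).2 t ⟨ht, le_rfl⟩
    have h2 : |k ^ 2 * solutionSymbol γ μ ν ρ ω K k t| ≤ D / (K * t) := by
      rw [le_div_iff₀ (by positivity)]
      rw [mul_assoc, abs_mul, abs_of_pos hK] at h
      linarith
    exact h2.trans (le_add_of_nonneg_left (by positivity))

theorem continuous_solutionSymbol (hμ : μ ∈ Ioo (0 : ℝ) 1) (hν : ν ∈ Icc (0 : ℝ) 1) (hρ : 0 < ρ)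
    (hγ : 0 ≤ γ) {t : ℝ} (ht : 0 < t) : Continuous fun k => solutionSymbol γ μ ν ρ ω K k t :=
  continuous_slice (continuousOn_solutionSymbol hμ hν hρ hγ) ht

theorem solution_space_regular (hμ : μ ∈ Ioo (0 : ℝ) 1) (hν : ν ∈ Icc (0 : ℝ) 1)
    (hρ : 0 < ρ) (hγ : 0 ≤ γ) (hK : 0 < K) (hĝ : Integrable (fourierHat g)) {t : ℝ} (ht : 0 < t) :
    ContDiff ℝ 2 (fun x => solution γ μ ν ρ ω K g x t) ∧
      iteratedDeriv 2 (fun x => solution γ μ ν ρ ω K g x t) = fun x =>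
        -superpose (amplitude g x) (fun k s => k ^ 2 * solutionSymbol γ μ ν ρ ω K k s) t := by
  obtain ⟨C, hC, hC2⟩ := exists_symbol_bound (ω := ω) hμ hν hρ hγ hK ht
  have hc := continuous_solutionSymbol (ω := ω) (K := K) hμ hν hρ hγ ht
  set S : ℝ → ℝ := fun k => solutionSymbol γ μ ν ρ ω K k t with hS
  set a : ℝ → ℝ := fun k => (fourierHat g k).re / (2 * Real.pi)
  set b : ℝ → ℝ := fun k => (fourierHat g k).im / (2 * Real.pi)
  have hmul : ∀ {f : ℝ → ℝ}, Integrable f → Integrable (fun k => f k * S k) ∧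
      Integrable (fun k => k * (f k * S k)) ∧ Integrable (fun k => k * (k * (f k * S k))) := by
    intro f hf
    refine ⟨hf.mul_bdd (c := C) hc.aestronglyMeasurable (Eventually.of_forall hC), ?_, ?_⟩
    · refine (hf.mul_bdd (g := fun k => k * S k) (c := C + C) (by fun_prop)
        (Eventually.of_forall fun k => ?_)).congr (Eventually.of_forall fun k => ?_)
      -- The first-order weight is interpolated between the bounds for `S` and for `k² S`.
      · have h1 : |k| ≤ 1 + k ^ 2 := by
          rw [← sq_abs]
          nlinarith [sq_nonneg (|k| - 1), abs_nonneg k]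
        have h3 := hC2 k
        rw [abs_mul, abs_of_nonneg (sq_nonneg k)] at h3
        rw [Real.norm_eq_abs, abs_mul]
        have h4 := mul_le_mul_of_nonneg_right h1 (abs_nonneg (S k))
        linarith [hC k]
      · simp only
        ring
    · refine (hf.mul_bdd (g := fun k => k ^ 2 * S k) (c := C) (by fun_prop)
        (Eventually.of_forall hC2)).congr (Eventually.of_forall fun k => ?_)
      simp only
      ring
  obtain ⟨ha0, ha1, ha2⟩ := hmul (integrable_re_fourierHat hĝ)
  obtain ⟨hb0, hb1, hb2⟩ := hmul (integrable_im_fourierHat hĝ)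
  have hf : (fun x => solution γ μ ν ρ ω K g x t) = fun x =>
      ∫ k, (a k * S k * Real.cos (k * x) + b k * S k * Real.sin (k * x)) := by
    ext x
    refine integral_congr_ae (Eventually.of_forall fun k => ?_)
    simp only [amplitude, a, b, hS]
    ring
  have hf2 : (fun x => -superpose (amplitude g x)
      (fun k s => k ^ 2 * solutionSymbol γ μ ν ρ ω K k s) t) = fun x =>
      ∫ k, (k * -(k * (a k * S k)) * Real.cos (k * x)
        + -(k * (k * (b k * S k))) * Real.sin (k * x)) := by
    ext x
    rw [superpose, ← integral_neg]
    refine integral_congr_ae (Eventually.of_forall fun k => ?_)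
    simp only [amplitude, a, b, hS]
    ring
  rw [hf, hf2]
  have ha2' : Integrable fun k => k * -(k * (a k * S k)) := by
    exact ha2.neg.congr (Eventually.of_forall fun k => by simp only [Pi.neg_apply]; ring)
  exact contDiff_two_of_hasDerivAt (fun x => hasDerivAt_trig_integral ha0 hb0 ha1 hb1 x)
    (fun x => hasDerivAt_trig_integral hb1 ha1.neg hb2 ha2' x)
    (continuous_trig_integral ha2' hb2.neg)

theorem good_solution (hμ : μ ∈ Ioo (0 : ℝ) 1) (hν : ν ∈ Icc (0 : ℝ) 1)
    (hρ : 0 < ρ) (hγ : 0 ≤ γ) (hK : 0 < K) (hĝ : Integrable (fourierHat g)) (x : ℝ) :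
    Good (solution γ μ ν ρ ω K g x) :=
  good_superpose (integrable_amplitude hĝ x) (unifGood_solutionSymbol hμ hν hρ hγ hK)
    (continuousOn_solutionSymbol hμ hν hρ hγ)

theorem continuousOn_mul_resolventSymbol (hμ : μ ∈ Ioo (0 : ℝ) 1) (hρ : 0 < ρ) (hγ : 0 ≤ γ) :
    ContinuousOn (fun q : ℝ × ℝ => K * q.1 ^ 2 * resolventSymbol γ μ ρ ω K q.1 q.2)
      (univ ×ˢ Ioi 0) :=
  (Continuous.continuousOn (by fun_prop)).mul (continuousOn_resolventSymbol hμ hρ hγ)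

theorem good_solutionFlux (hμ : μ ∈ Ioo (0 : ℝ) 1) (hρ : 0 < ρ) (hγ : 0 ≤ γ) (hK : 0 < K)
    (hĝ : Integrable (fourierHat g)) (x : ℝ) : Good (solutionFlux γ μ ρ ω K g x) :=
  good_superpose (integrable_amplitude hĝ x) (unifGood_mul_resolventSymbol hμ hρ hγ hK)
    (continuousOn_mul_resolventSymbol hμ hρ hγ)

/-- The identity for a single symbol is superposed over `k`; the constant `1` there becomes `g x` by
Fourier inversion. -/
theorem inner_solution (hμ : μ ∈ Ioo (0 : ℝ) 1) (hν : ν ∈ Icc (0 : ℝ) 1) (hρ : 0 < ρ)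
    (hγ : 0 ≤ γ) (hK : 0 < K) (hc : Continuous g) (hg : Integrable g)
    (hĝ : Integrable (fourierHat g)) (x : ℝ) {t : ℝ} (ht : 0 < t) :
    innerIntegral γ μ ν ρ ω (solution γ μ ν ρ ω K g x) t
      = g x - ∫ s in (0 : ℝ)..t, solutionFlux γ μ ρ ω K g x s := by
  have hw := integrable_amplitude hĝ x
  have hU := unifGood_mul_resolventSymbol (ω := ω) hμ hρ hγ hK
  rw [innerIntegral, solution, prabhakarIntegral_superpose hρ (admissible_inner hμ hν γ) hw
    (unifGood_solutionSymbol hμ hν hρ hγ hK) (continuousOn_solutionSymbol hμ hν hρ hγ) ht,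
    ← halfConv_one, solutionFlux, halfConv_superpose good_one hw hU
    (continuousOn_mul_resolventSymbol hμ hρ hγ) ht, ← integral_amplitude hc hg hĝ x]
  unfold superpose
  have hI : Integrable fun k => amplitude g x k * halfConv (fun _ => 1)
      (fun s => K * k ^ 2 * resolventSymbol γ μ ρ ω K k s) t := by
    have h := (integrable_prod_superpose good_one hw hU
      (continuousOn_mul_resolventSymbol hμ hρ hγ) ht).integral_prod_left
    refine h.congr (Eventually.of_forall fun k => ?_)
    simp only [one_mul]
    rw [integral_const_mul, halfConv_one, intervalIntegral.integral_of_le ht.le,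
      integral_Ioc_eq_integral_Ioo]
  rw [← integral_sub hw hI]
  refine integral_congr_ae (Eventually.of_forall fun k => ?_)
  have h := inner_solutionSymbol (ω := ω) (K := K) hμ hν hρ hγ k ht
  rw [innerIntegral] at h
  simp only
  rw [h]
  ring

theorem deriv_inner_solution (hμ : μ ∈ Ioo (0 : ℝ) 1) (hν : ν ∈ Icc (0 : ℝ) 1) (hρ : 0 < ρ)
    (hγ : 0 ≤ γ) (hK : 0 < K) (hc : Continuous g) (hg : Integrable g)
    (hĝ : Integrable (fourierHat g)) (x : ℝ) {t : ℝ} (ht : 0 < t) :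
    HasDerivAt (innerIntegral γ μ ν ρ ω (solution γ μ ν ρ ω K g x))
      (-solutionFlux γ μ ρ ω K g x t) t := by
  have hq := good_solutionFlux (ω := ω) hμ hρ hγ hK hĝ x
  have hqc : ContinuousOn (solutionFlux γ μ ρ ω K g x) (Ioi 0) :=
    continuousOn_superpose (integrable_amplitude hĝ x) (unifGood_mul_resolventSymbol hμ hρ hγ hK)
      (continuousOn_mul_resolventSymbol hμ hρ hγ)
  have h1 : HasDerivAt (fun t => ∫ s in (0 : ℝ)..t, solutionFlux γ μ ρ ω K g x s)
      (solutionFlux γ μ ρ ω K g x t) t := by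
    refine intervalIntegral.integral_hasDerivAt_right (hq.locInt.intervalIntegrable le_rfl ht.le)
      ?_ (hqc.continuousAt (Ioi_mem_nhds ht))
    exact ⟨Ioi 0, Ioi_mem_nhds ht, hqc.aestronglyMeasurable measurableSet_Ioi⟩
  refine (h1.const_sub (g x)).congr_of_eventuallyEq ?_
  filter_upwards [Ioi_mem_nhds ht] with s hs
  exact inner_solution hμ hν hρ hγ hK hc hg hĝ x hs

theorem outer_solution (hμ : μ ∈ Ioo (0 : ℝ) 1) (hν : ν ∈ Icc (0 : ℝ) 1) (hρ : 0 < ρ)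
    (hγ : 0 ≤ γ) (hK : 0 < K) (hĝ : Integrable (fourierHat g)) (x : ℝ) {t : ℝ} (ht : 0 < t) :
    prabhakarIntegral (-γ * ν) ρ (ν * (1 - μ)) ω (fun s => -1 * solutionFlux γ μ ρ ω K g x s) t
      = -(K * superpose (amplitude g x)
          (fun k s => k ^ 2 * solutionSymbol γ μ ν ρ ω K k s) t) := by
  rw [prabhakarIntegral_const_mul, solutionFlux, prabhakarIntegral_superpose hρ
    (admissible_outer hμ hν γ) (integrable_amplitude hĝ x)
    (unifGood_mul_resolventSymbol hμ hρ hγ hK) (continuousOn_mul_resolventSymbol hμ hρ hγ) ht,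
    neg_one_mul, superpose, superpose, ← integral_const_mul]
  congr 2
  ext k
  rw [prabhakarIntegral_const_mul, outer_resolventSymbol hμ hν hρ hγ k ht]
  ring

theorem isSolution_solution (hμ : μ ∈ Ioo (0 : ℝ) 1) (hν : ν ∈ Icc (0 : ℝ) 1) (hρ : 0 < ρ)
    (hγ : 0 ≤ γ) (hK : 0 < K) (hc : Continuous g) (hg : Integrable g)
    (hĝ : Integrable (fourierHat g)) :
    IsSolution γ μ ν ρ ω K g (solution γ μ ν ρ ω K g) := by
  have hgood := fun x => good_solution (ω := ω) hμ hν hρ hγ hK hĝ x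
  have hq := fun x => good_solutionFlux (ω := ω) hμ hρ hγ hK hĝ x
  have hinner := fun (x t : ℝ) (ht : 0 < t) =>
    inner_solution (ω := ω) hμ hν hρ hγ hK hc hg hĝ x (t := t) ht
  have hderiv := fun (x t : ℝ) (ht : 0 < t) =>
    deriv_inner_solution (ω := ω) hμ hν hρ hγ hK hc hg hĝ x (t := t) ht
  have hdeq : ∀ x, EqOn (fun s => -1 * solutionFlux γ μ ρ ω K g x s)
      (deriv (innerIntegral γ μ ν ρ ω (solution γ μ ν ρ ω K g x))) (Ioi 0) := fun x t ht => by
    simp only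
    rw [(hderiv x t ht).deriv, neg_one_mul]
  have hdecay : ∀ t > 0, Tendsto (fun x => solution γ μ ν ρ ω K g x t) (cocompact ℝ) (𝓝 0) := by
    intro t ht
    obtain ⟨C, hC, -⟩ := exists_symbol_bound (ω := ω) hμ hν hρ hγ hK ht
    exact tendsto_integral_amplitude hĝ (continuous_solutionSymbol hμ hν hρ hγ ht) hC
  refine ⟨fun x => ⟨fun b _ => (hgood x).locInt b, fun t ht => ?_, fun b hb => ?_,
    fun t ht => (hderiv x t ht).differentiableAt, fun t ht => ?_⟩, fun t ht =>
    (solution_space_regular hμ hν hρ hγ hK hĝ ht).1, fun T hT => ?_, fun t ht x => ?_, fun x => ?_,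
    fun t ht => (hdecay t ht).mono_left atTop_le_cocompact,
    fun t ht => (hdecay t ht).mono_left atBot_le_cocompact⟩
  · exact prabhakarIntegrableAt_of_good hρ (admissible_inner hμ hν γ) (hgood x) ht
  -- The formula with the primitive supplies the absolutely continuous representative, including the
  -- correct value at `0`.
  · refine ⟨fun t => g x - ∫ s in (0 : ℝ)..t, solutionFlux γ μ ρ ω K g x s, ?_,
      fun t ht => (hinner x t ht.1).symm⟩
    have h1 := ((hq x).locInt.intervalIntegrable le_rfl
      hb.le).absolutelyContinuousOnInterval_intervalIntegral (c := 0) (by simp)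
    have h2 : AbsolutelyContinuousOnInterval (fun _ : ℝ => g x) 0 b :=
      (contDiff_const (n := 1)).contDiffOn.absolutelyContinuousOnInterval
    exact h2.sub h1
  · exact prabhakarIntegrableAt_of_good hρ (admissible_outer hμ hν γ)
      (((hq x).const_mul (-1)).congr (hdeq x)) ht
  · have hU := (unifGood_solutionSymbol (ω := ω) hμ hν hρ hγ hK).abs
    have hU2 := (unifGood_mul_solutionSymbol (ω := ω) hμ hν hρ hγ hK).abs
    have hcS := continuousOn_solutionSymbol (ω := ω) (K := K) hμ hν hρ hγ
    have hcU2 : ContinuousOn (fun q : ℝ × ℝ =>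
        |K * q.1 ^ 2 * solutionSymbol γ μ ν ρ ω K q.1 q.2|) (univ ×ˢ Ioi 0) :=
      ((Continuous.continuousOn (by fun_prop)).mul hcS).abs
    have hW := (integrable_re_fourierHat hĝ).abs.add (integrable_im_fourierHat hĝ).abs
    -- The majorant may not depend on `x`, so the amplitude is replaced by this bound.
    -- Superpositions with weight `W` are again `Good`, in particular integrable down to `t = 0`.
    set W : ℝ → ℝ := fun k => |(fourierHat g k).re / (2 * Real.pi)|
      + |(fourierHat g k).im / (2 * Real.pi)| with hWdef
    have hle : ∀ x (F : ℝ → ℝ), (Integrable fun k => W k * |F k|) →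
        |∫ k, amplitude g x k * F k| ≤ ∫ k, W k * |F k| := fun x F hF => by
      rw [← Real.norm_eq_abs]
      refine norm_integral_le_of_norm_le hF (Eventually.of_forall fun k => ?_)
      rw [norm_mul]
      exact mul_le_mul_of_nonneg_right (abs_amplitude_le g x k) (abs_nonneg _)
    have g1 := good_superpose hW hU hcS.abs
    have g2 := (good_superpose hW hU2 hcU2).const_mul K⁻¹
    refine ⟨_, ((g1.add g2).locInt T).mono_set Ioo_subset_Ioc_self, fun t ht x => ?_⟩
    have i1 := integrable_superpose hW hU hcS.abs ht.1
    have i2 := integrable_superpose hW hU2 hcU2 ht.1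
    have n1 : 0 ≤ superpose W (fun k s => |solutionSymbol γ μ ν ρ ω K k s|) t :=
      integral_nonneg fun k => mul_nonneg (by positivity) (abs_nonneg _)
    have n2 : 0 ≤ K⁻¹ *
        superpose W (fun k s => |K * k ^ 2 * solutionSymbol γ μ ν ρ ω K k s|) t :=
      mul_nonneg (by positivity)
        (integral_nonneg fun k => mul_nonneg (by positivity) (abs_nonneg _))
    constructor
    · exact (hle x _ i1).trans (le_add_of_nonneg_right n2)
    · rw [(solution_space_regular (ω := ω) hμ hν hρ hγ hK hĝ ht.1).2]
      simp only
      rw [abs_neg]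
      refine le_trans ?_ (le_add_of_nonneg_left n1)
      have e : superpose (amplitude g x) (fun k s => k ^ 2 * solutionSymbol γ μ ν ρ ω K k s) t
          = K⁻¹ * ∫ k, amplitude g x k * (K * k ^ 2 * solutionSymbol γ μ ν ρ ω K k t) := by
        rw [superpose, ← integral_const_mul]
        congr 1
        ext k
        field_simp
      rw [e, abs_mul, abs_of_pos (inv_pos.2 hK)]
      exact mul_le_mul_of_nonneg_left (hle x _ i2) (inv_pos.2 hK).le
  · rw [hilferPrabhakarDeriv, ← prabhakarIntegral_congr (admissible_outer hμ hν γ) ht (hdeq x),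
      outer_solution hμ hν hρ hγ hK hĝ x ht,
      (solution_space_regular (ω := ω) hμ hν hρ hγ hK hĝ ht).2]
    ring
  · have h1 := ((hq x).locInt.continuous_primitive 1).continuousWithinAt
      (show (0 : ℝ) ∈ Icc 0 1 from ⟨le_rfl, zero_le_one⟩)
    have h2 : Tendsto (fun t => ∫ s in (0 : ℝ)..t, solutionFlux γ μ ρ ω K g x s) (𝓝[>] 0)
        (𝓝 0) := by
      have h3 := h1.tendsto.mono_left (nhdsWithin_mono (0 : ℝ) (Ioc_subset_Icc_self (b := 1)))
      rw [intervalIntegral.integral_same] at h3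
      rwa [nhdsWithin_Ioc_eq_nhdsGT one_pos] at h3
    have h4 := h2.const_sub (g x)
    rw [sub_zero] at h4
    refine h4.congr' ?_
    filter_upwards [self_mem_nhdsWithin] with t ht
    exact (hinner x t ht).symm

/-- The superposition agrees with the complex solution formula. -/
theorem solution_eq_integral (hμ : μ ∈ Ioo (0 : ℝ) 1) (hν : ν ∈ Icc (0 : ℝ) 1) (hρ : 0 < ρ)
    (hγ : 0 ≤ γ) (hK : 0 < K) (hĝ : Integrable (fourierHat g)) (x : ℝ) {t : ℝ} (ht : 0 < t) :
    Integrable (solutionIntegrand γ μ ν ρ ω K g x t) ∧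
      (solution γ μ ν ρ ω K g x t : ℂ) = ∫ k : ℝ, solutionIntegrand γ μ ν ρ ω K g x t k := by
  obtain ⟨C, hC, -⟩ := exists_symbol_bound (ω := ω) hμ hν hρ hγ hK ht
  have h := integral_exp_mul_eq_amplitude hĝ (continuous_solutionSymbol (ω := ω) (K := K)
    hμ hν hρ hγ ht) hC (fun k => by simp only [solutionSymbol, neg_sq]) x
  have e : solutionIntegrand γ μ ν ρ ω K g x t = fun k : ℝ => Complex.exp (-(Complex.I * k * x))
      * fourierHat g k * ((1 / (2 * Real.pi) * solutionSymbol γ μ ν ρ ω K k t : ℝ) : ℂ) := by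
    ext k
    rw [solutionIntegrand, tsum_seriesTerm hμ hν hρ hγ k ht]
  rw [e]
  exact h

end Existence



/-! ### The integrated form of the equation in time -/

theorem LocInt.continuousOn_primitive {f : ℝ → ℝ} (hf : LocInt f) :
    ContinuousOn (fun t => ∫ s in (0 : ℝ)..t, f s) (Ioi 0) := fun t ht =>
  ((hf.continuous_primitive (t + 1)).continuousAt
    (Icc_mem_nhds ht (lt_add_one t))).continuousWithinAt

/-- The absolutely continuous representative agrees with `v` only for `t > 0`; its value at `0` is
recovered from the one-sided limit. -/
theorem eq_add_integral_deriv {v : ℝ → ℝ} {c : ℝ}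
    (hac : ∀ b > 0, ∃ w : ℝ → ℝ, AbsolutelyContinuousOnInterval w 0 b ∧ EqOn w v (Ioc 0 b))
    (hv : Tendsto v (𝓝[>] 0) (𝓝 c)) :
    LocInt (deriv v) ∧ ∀ t > 0, v t = c + ∫ s in (0 : ℝ)..t, deriv v s := by
  have key : ∀ t > 0, IntegrableOn (deriv v) (Ioc 0 t) ∧
      v t = c + ∫ s in (0 : ℝ)..t, deriv v s := by
    intro t ht
    obtain ⟨w, hw, hwv⟩ := hac t ht
    have hd : EqOn (deriv w) (deriv v) (Ioo 0 t) := fun s hs =>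
      EventuallyEq.deriv_eq (by
        filter_upwards [Ioo_mem_nhds hs.1 hs.2] with r hr using hwv ⟨hr.1, hr.2.le⟩)
    have hi := hw.intervalIntegrable_deriv
    rw [intervalIntegrable_iff_integrableOn_Ioo_of_le ht.le] at hi
    have hint : ∫ s in (0 : ℝ)..t, deriv w s = ∫ s in (0 : ℝ)..t, deriv v s :=
      intervalIntegral.integral_congr_uIoo (by rwa [uIoo_of_le ht.le])
    have hw0 : w 0 = c := by
      have hcont := hw.continuousOn.continuousWithinAt (left_mem_uIcc (a := 0) (b := t))
      rw [uIcc_of_le ht.le] at hcont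
      have h1 : Tendsto w (𝓝[>] 0) (𝓝 (w 0)) := by
        rw [← nhdsWithin_Ioc_eq_nhdsGT ht]
        exact hcont.tendsto.mono_left (nhdsWithin_mono _ Ioc_subset_Icc_self)
      refine tendsto_nhds_unique h1 (hv.congr' ?_)
      filter_upwards [Ioc_mem_nhdsGT ht] with s hs using (hwv hs).symm
    refine ⟨(integrableOn_Ioc_iff_integrableOn_Ioo).2 (hi.congr_fun hd measurableSet_Ioo), ?_⟩
    rw [← hint, hw.integral_deriv_eq_sub, hw0, hwv ⟨ht, le_rfl⟩]
    ring
  refine ⟨fun T => ?_, fun t ht => (key t ht).2⟩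
  rcases le_or_gt T 0 with hT | hT
  · simp [Ioc_eq_empty (not_lt.2 hT)]
  · exact (key T hT).1

/-- Commutation with convolution by `1`. For `g` merely locally integrable, `f * g` need not exist
at every point, but the primitive of `|g|` is `Good`, so the integrated identity holds at every `t >
0`. -/
theorem Good.integral_halfConv {f g : ℝ → ℝ} (hf : Good f) (hg : LocInt g) {t : ℝ} (ht : 0 < t) :
    ∫ s in (0 : ℝ)..t, halfConv f g s = halfConv f (fun s => ∫ r in (0 : ℝ)..s, g r) t := by
  have h1 : (fun s => ∫ r in (0 : ℝ)..s, g r) = halfConv (fun _ => 1) g :=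
    funext fun s => (halfConv_one g s).symm
  have habs : (fun _ : ℝ => |(1 : ℝ)|) = fun _ => 1 := by simp
  rw [← halfConv_one, h1, ← halfConv_assoc good_one.locInt hf.locInt hg ht,
    show halfConv (fun _ => 1) f = halfConv f fun _ => 1 from funext fun s => halfConv_comm _ _ _,
    halfConv_assoc hf.locInt good_one.locInt hg ht]
  · rw [habs, show halfConv (fun _ => 1) (fun y => |g y|) = fun s => ∫ r in (0 : ℝ)..s, |g r| from
      funext fun s => halfConv_one _ s]
    exact hf.abs.halfConvAt hg.abs.good_primitive ht
  · rw [habs]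
    simpa [HalfConvAt] using (hf.locInt.abs.conv hg.abs).intervalIntegrable le_rfl ht.le

theorem LocInt.prabhakarIntegral {ε ρ α : ℝ} {f : ℝ → ℝ} (hf : LocInt f) (hρ : 0 < ρ)
    (h : Admissible ε α) (ω : ℝ) : LocInt (prabhakarIntegral ε ρ α ω f) := by
  rcases h with hα | h
  · rw [prabhakarIntegral_of_pos hα]
    exact (good_prabhakarKernel hρ ε ω hα).locInt.conv hf
  · rwa [prabhakarIntegral_of_zero h]

theorem LocInt.ae_halfConv_prabhakarIntegral {ε ρ α β : ℝ} {f : ℝ → ℝ} (hf : LocInt f)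
    (hρ : 0 < ρ) (h : Admissible ε α) (hβ : 0 < β) (δ ω : ℝ) :
    ∀ᵐ t, 0 < t → halfConv (prabhakarKernel δ ρ β ω) (HilferPrabhakar.prabhakarIntegral ε ρ α ω f) t
      = halfConv (prabhakarKernel (δ + ε) ρ (β + α) ω) f t := by
  rcases h with hα | h
  · rw [prabhakarIntegral_of_pos hα]
    filter_upwards [(good_prabhakarKernel hρ δ ω hβ).locInt.ae_halfConv_assoc
      (good_prabhakarKernel hρ ε ω hα).locInt hf] with t ht h0
    rw [← ht h0]
    refine halfConv_congr h0.le (fun s hs => ?_) fun _ _ => rfl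
    rw [halfConv_comm, halfConv_prabhakarKernel hρ δ ε ω hβ hα hs.1]
  · rw [prabhakarIntegral_of_zero h, h.1, h.2, add_zero, add_zero]
    exact Eventually.of_forall fun _ _ => rfl

variable {γ μ ν ρ ω : ℝ}

theorem HasHilferPrabhakarDeriv.locInt {f : ℝ → ℝ} (hf : HasHilferPrabhakarDeriv γ μ ν ρ ω f) :
    LocInt f := fun T => by
  rcases le_or_gt T 0 with hT | hT
  · simp [Ioc_eq_empty (not_lt.2 hT)]
  · exact hf.integrableOn T hT

/-- The integrated Volterra form of the equation `𝓓 f = F` with initial value `c`. -/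
theorem integral_eq_of_hilferPrabhakarDeriv (hμ : μ ∈ Ioo (0 : ℝ) 1) (hν : ν ∈ Icc (0 : ℝ) 1)
    (hρ : 0 < ρ) {f F : ℝ → ℝ} {c : ℝ} (hf : HasHilferPrabhakarDeriv γ μ ν ρ ω f)
    (hc : Tendsto (innerIntegral γ μ ν ρ ω f) (𝓝[>] 0) (𝓝 c))
    (hF : ∀ t > 0, hilferPrabhakarDeriv γ μ ν ρ ω f t = F t) :
    LocInt F ∧ ∀ t > 0, ∫ s in (0 : ℝ)..t, f s
      = c * (∫ s in (0 : ℝ)..t, prabhakarKernel (γ * (1 - ν)) ρ (μ + ν * (1 - μ)) ω s)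
        + halfConv (prabhakarKernel γ ρ μ ω) (fun t => ∫ s in (0 : ℝ)..t, F s) t := by
  obtain ⟨hv', hv⟩ := eq_add_integral_deriv hf.inner_ac hc
  have hfl := hf.locInt
  have hβ := order_pos hμ hν
  set a := prabhakarKernel γ ρ μ ω with ha
  set b := prabhakarKernel (γ * (1 - ν)) ρ (μ + ν * (1 - μ)) ω with hb
  have hag : Good a := good_prabhakarKernel hρ γ ω hμ.1
  have hbg : Good b := good_prabhakarKernel hρ _ ω hβ
  have hFl : LocInt F := (hv'.prabhakarIntegral hρ (admissible_outer hμ hν γ) ω).congr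
    fun t ht => hF t ht
  -- The kernel `b` complements the inner one: their convolution is `e^0_{ρ,1,ω} = 1`.
  have h1 : ∀ᵐ t, 0 < t → halfConv b (innerIntegral γ μ ν ρ ω f) t = ∫ s in (0 : ℝ)..t, f s := by
    filter_upwards [hfl.ae_halfConv_prabhakarIntegral hρ (admissible_inner hμ hν γ) hβ
      (γ * (1 - ν)) ω] with t ht h0
    rw [innerIntegral, hb, ht h0, ← halfConv_one]
    refine halfConv_congr h0.le (fun s hs => ?_) fun _ _ => rfl
    rw [show γ * (1 - ν) + -γ * (1 - ν) = 0 by ring,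
      show μ + ν * (1 - μ) + (1 - ν) * (1 - μ) = 1 by ring, prabhakarKernel_zero _ _ _ hs.1,
      powKernel_one]
  -- Convolving `a` with the outer kernel gives `b`, so `a * F` is `b` convolved with the derivative
  -- of the inner integral.
  have h2 : ∀ᵐ t, 0 < t → halfConv a F t = halfConv b (deriv (innerIntegral γ μ ν ρ ω f)) t := by
    filter_upwards [hv'.ae_halfConv_prabhakarIntegral hρ (admissible_outer hμ hν γ) hμ.1
      γ ω] with t ht h0
    rw [ha, hb, show γ * (1 - ν) = γ + -γ * ν by ring, ← ht h0]
    exact halfConv_congr h0.le (fun _ _ => rfl) fun s hs => (hF s hs.1).symm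
  have h3 : ∀ t > 0, halfConv b (innerIntegral γ μ ν ρ ω f) t
      = c * (∫ s in (0 : ℝ)..t, b s) + ∫ s in (0 : ℝ)..t, halfConv a F s := by
    intro t ht
    rw [halfConv_congr (g' := fun s => c * 1 + ∫ r in (0 : ℝ)..s,
      deriv (innerIntegral γ μ ν ρ ω f) r) ht.le (fun _ _ => rfl)
      (fun s hs => by simp only [mul_one]; exact hv s hs.1),
      halfConv_add_right (hbg.halfConvAt (good_one.const_mul c) ht)
        (hbg.halfConvAt hv'.good_primitive ht), halfConv_const_mul_right, halfConv_comm,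
      halfConv_one, ← hbg.integral_halfConv hv' ht]
    congr 1
    refine intervalIntegral.integral_congr_ae ?_
    filter_upwards [h2] with s hs h0
    rw [uIoc_of_le ht.le] at h0
    exact (hs h0.1).symm
  refine ⟨hFl, fun t ht => ?_⟩
  rw [← hag.integral_halfConv hFl ht]
  -- The identity is known almost everywhere, and both sides are primitives, hence continuous.
  refine Measure.eqOn_open_of_ae_eq (μ := volume) (U := Ioi 0)
    (f := fun t => ∫ s in (0 : ℝ)..t, f s)
    (g := fun t => c * (∫ s in (0 : ℝ)..t, b s) + ∫ s in (0 : ℝ)..t, halfConv a F s)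
    ?_ isOpen_Ioi hfl.continuousOn_primitive
    ((hbg.locInt.continuousOn_primitive.const_mul c).add
      (hag.locInt.conv hFl).continuousOn_primitive) ht
  rw [EventuallyEq, ae_restrict_iff' measurableSet_Ioi]
  filter_upwards [h1] with s hs h0
  rw [← hs h0, h3 s h0]



/-! ### Second differences -/

/-- The symmetric second difference of `φ` at `x` with step `η`. -/
def secondDiff (φ : ℝ → ℝ) (η x : ℝ) : ℝ := φ (x + η) + φ (x - η) - 2 * φ x

section SecondDiff

variable {φ φ' φ'' : ℝ → ℝ}

/-- Cauchy's mean value theorem in the step size, against `s ^ 2`, followed by the ordinary one for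
`φ'`. Second differences are thus controlled by `φ''` alone, without joint regularity in space and
time. -/
theorem exists_secondDiff_eq (h : ∀ x, HasDerivAt φ (φ' x) x) (h' : ∀ x, HasDerivAt φ' (φ'' x) x)
    {η : ℝ} (hη : 0 < η) (x : ℝ) :
    ∃ z ∈ Ioo (x - η) (x + η), secondDiff φ η x = φ'' z * η ^ 2 := by
  have hg : ∀ s, HasDerivAt (fun s => secondDiff φ s x) (φ' (x + s) - φ' (x - s)) s := fun s => by
    have h1 := (h (x + s)).comp_const_add x s
    have h2 := (h (x - s)).comp_const_sub x s
    exact ((h1.add h2).sub_const (2 * φ x)).congr_deriv (by ring)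
  have hs : ∀ s : ℝ, HasDerivAt (fun s : ℝ => s ^ 2) (2 * s) s := fun s => by
    simpa using hasDerivAt_pow 2 s
  obtain ⟨c, hc, e⟩ := exists_ratio_hasDerivAt_eq_ratio_slope (fun s => secondDiff φ s x) _ hη
    (HasDerivAt.continuousOn fun s _ => hg s) (fun s _ => hg s) (fun s : ℝ => s ^ 2) _
    (by fun_prop) (fun s _ => hs s)
  obtain ⟨z, hz, ez⟩ := exists_hasDerivAt_eq_slope φ' φ'' (a := x - c) (b := x + c)
    (by linarith [hc.1]) (HasDerivAt.continuousOn fun s _ => h' s) (fun s _ => h' s)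
  refine ⟨z, ⟨by linarith [hz.1, hc.2], by linarith [hz.2, hc.2]⟩, ?_⟩
  have h0 : secondDiff φ 0 x = 0 := by simp only [secondDiff, add_zero, sub_zero]; ring
  have hc0 := hc.1
  have ez' : φ' (x + c) - φ' (x - c) = φ'' z * (2 * c) := by
    rw [ez, show x + c - (x - c) = 2 * c by ring, div_mul_cancel₀ _ (by positivity)]
  rw [h0, ez'] at e
  have : 2 * c * (secondDiff φ η x - φ'' z * η ^ 2) = 0 := by linear_combination -e
  rcases mul_eq_zero.1 this with h3 | h3
  · linarith
  · linarith

theorem tendsto_secondDiff (h : ∀ x, HasDerivAt φ (φ' x) x) (h' : ∀ x, HasDerivAt φ' (φ'' x) x)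
    (hc : Continuous φ'') (x : ℝ) :
    Tendsto (fun η => secondDiff φ η x / η ^ 2) (𝓝[>] 0) (𝓝 (φ'' x)) := by
  rw [Metric.tendsto_nhdsWithin_nhds]
  intro ε hε
  obtain ⟨δ, hδ, H⟩ := Metric.continuous_iff.1 hc x ε hε
  refine ⟨δ, hδ, fun η hη hd => ?_⟩
  have hη0 : (0 : ℝ) < η := hη
  obtain ⟨z, hz, e⟩ := exists_secondDiff_eq h h' hη0 x
  rw [e, mul_div_cancel_right₀ _ (by positivity)]
  refine H z ?_
  rw [Real.dist_eq, sub_zero, abs_of_pos hη0] at hd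
  rw [Real.dist_eq, abs_lt]
  exact ⟨by linarith [hz.1], by linarith [hz.2]⟩

theorem secondDiff_comp_affine (φ : ℝ → ℝ) (x₀ l η x : ℝ) :
    secondDiff (fun y => φ (x₀ + l * y)) η x = secondDiff φ (l * η) (x₀ + l * x) := by
  simp only [secondDiff]
  ring_nf

theorem continuous_secondDiff (h : Continuous φ) (η : ℝ) : Continuous (secondDiff φ η) := by
  unfold secondDiff
  fun_prop

end SecondDiff

/-! ### Band-limited test functions -/

/-- The cosine transform of `k ^ p * (1 - k)` on `[0, 1]`. -/
def bandCos (p : ℕ) (x : ℝ) : ℝ := ∫ k in (0 : ℝ)..1, k ^ p * (1 - k) * Real.cos (k * x)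

/-- The sine transform of `k ^ p * (1 - k)` on `[0, 1]`. -/
def bandSin (p : ℕ) (x : ℝ) : ℝ := ∫ k in (0 : ℝ)..1, k ^ p * (1 - k) * Real.sin (k * x)

/-- The weight `k ^ p * (1 - k)` on `(0, 1]`, extended by zero. -/
def bandWeight (p : ℕ) : ℝ → ℝ := indicator (Ioc 0 1) fun k => k ^ p * (1 - k)

theorem integrable_bandWeight (p : ℕ) : Integrable (bandWeight p) := by
  rw [bandWeight, integrable_indicator_iff measurableSet_Ioc]
  exact locInt_of_continuous (f := fun k : ℝ => k ^ p * (1 - k)) (by fun_prop) 1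

theorem mul_bandWeight (p : ℕ) (k : ℝ) : k * bandWeight p k = bandWeight (p + 1) k := by
  unfold bandWeight
  by_cases h : k ∈ Ioc (0 : ℝ) 1
  · rw [indicator_of_mem h, indicator_of_mem h]
    ring
  · rw [indicator_of_notMem h, indicator_of_notMem h, mul_zero]

theorem integral_bandWeight_mul (p : ℕ) (f : ℝ → ℝ) :
    ∫ k, bandWeight p k * f k = ∫ k in (0 : ℝ)..1, k ^ p * (1 - k) * f k := by
  rw [intervalIntegral.integral_of_le zero_le_one, ← integral_indicator measurableSet_Ioc]
  refine integral_congr_ae (Eventually.of_forall fun k => ?_)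
  simp only [bandWeight]
  by_cases h : k ∈ Ioc (0 : ℝ) 1
  · rw [indicator_of_mem h, indicator_of_mem h]
  · rw [indicator_of_notMem h, indicator_of_notMem h, zero_mul]

theorem hasDerivAt_bandCos (p : ℕ) (x : ℝ) : HasDerivAt (bandCos p) (-bandSin (p + 1) x) x := by
  have h := hasDerivAt_trig_integral (B := fun _ => 0) (integrable_bandWeight p)
    (integrable_zero _ _ _) (by simpa only [mul_bandWeight] using integrable_bandWeight (p + 1))
    (by simp) x
  simp only [mul_bandWeight, zero_mul, mul_zero, add_zero, zero_add, neg_mul] at h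
  simp only [integral_neg, integral_bandWeight_mul] at h
  exact h

theorem hasDerivAt_bandSin (p : ℕ) (x : ℝ) : HasDerivAt (bandSin p) (bandCos (p + 1) x) x := by
  have h := hasDerivAt_trig_integral (A := fun _ => 0) (integrable_zero _ _ _)
    (integrable_bandWeight p)
    (by simp) (by simpa only [mul_bandWeight] using integrable_bandWeight (p + 1)) x
  simp only [mul_bandWeight, zero_mul, mul_zero, add_zero, zero_add, neg_zero] at h
  simp only [integral_bandWeight_mul] at h
  exact h

theorem continuous_bandCos (p : ℕ) : Continuous (bandCos p) :=
  continuous_iff_continuousAt.2 fun x => (hasDerivAt_bandCos p x).continuousAt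

/-- Integrating by parts twice. -/
theorem sq_mul_bandCos (p : ℕ) (x : ℝ) :
    x ^ 2 * bandCos p x = (p - (p + 1)) * Real.cos x - (p * 0 ^ (p - 1) - (p + 1) * 0 ^ p)
      - ∫ k in (0 : ℝ)..1, (p * ((p - 1 : ℕ) * k ^ (p - 1 - 1)) - (p + 1) * (p * k ^ (p - 1)))
        * Real.cos (k * x) := by
  -- At `k = 1` the factor `k ^ p - k ^ (p + 1)` vanishes, and at `k = 0` the sine does. The
  -- truncated exponents for `p ≤ 1` are harmless, being multiplied by `p` and by the truncated
  -- difference `p - 1`.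
  have hd : ∀ k : ℝ, HasDerivAt (fun k : ℝ => (k ^ p - k ^ (p + 1)) * (x * Real.sin (k * x))
      + (p * k ^ (p - 1) - (p + 1) * k ^ p) * Real.cos (k * x))
      (x ^ 2 * (k ^ p * (1 - k) * Real.cos (k * x))
        + (p * ((p - 1 : ℕ) * k ^ (p - 1 - 1)) - (p + 1) * (p * k ^ (p - 1)))
          * Real.cos (k * x)) k := fun k => by
    have hkx : HasDerivAt (fun k : ℝ => k * x) x k := by simpa using (hasDerivAt_id k).mul_const x
    have h1 := ((hasDerivAt_pow p k).sub (hasDerivAt_pow (p + 1) k)).mul (hkx.sin.const_mul x)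
    have h2 := (((hasDerivAt_pow (p - 1) k).const_mul (p : ℝ)).sub
      ((hasDerivAt_pow p k).const_mul ((p : ℝ) + 1))).mul hkx.cos
    refine (h1.add h2).congr_deriv ?_
    simp only [Pi.sub_apply, Nat.add_sub_cancel]
    push_cast
    ring
  have hi := intervalIntegral.integral_eq_sub_of_hasDerivAt (a := 0) (b := 1)
    (fun k _ => hd k) (Continuous.intervalIntegrable (by fun_prop) _ _)
  rw [intervalIntegral.integral_add (Continuous.intervalIntegrable (by fun_prop) _ _)
    (Continuous.intervalIntegrable (by fun_prop) _ _), intervalIntegral.integral_const_mul] at hi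
  rw [bandCos, eq_sub_iff_add_eq, hi]
  simp

/-- This is the Fejér kernel: `x ^ 2 * bandCos 0 x = 1 - cos x`. -/
theorem bandCos_zero_nonneg (x : ℝ) : 0 ≤ bandCos 0 x := by
  rcases eq_or_ne x 0 with rfl | hx
  · refine intervalIntegral.integral_nonneg zero_le_one fun k hk => ?_
    simp [hk.2]
  · have h := sq_mul_bandCos 0 x
    simp only [CharP.cast_eq_zero, zero_mul, mul_zero, sub_self,
      intervalIntegral.integral_zero, pow_zero] at h
    have h2 : 0 < x ^ 2 := by positivity
    have h3 := Real.cos_le_one x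
    by_contra hn
    push Not at hn
    nlinarith

/-- A trivial bound by `1` is combined with a bound for `x ^ 2 * bandCos p x`. Because frequencies
stay in `[0, 1]`, repeated differentiation costs only a power of `p`, which geometric decay will
beat. -/
theorem abs_bandCos_le (p : ℕ) (x : ℝ) :
    |bandCos p x| ≤ 7 * (p + 1 : ℝ) ^ 2 * (1 + x ^ 2)⁻¹ := by
  have hp : (0 : ℝ) ≤ p := Nat.cast_nonneg p
  have hpow : ∀ n : ℕ, ∀ k ∈ Ioc (0 : ℝ) 1, 0 ≤ k ^ n ∧ k ^ n ≤ 1 := fun n k hk =>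
    ⟨pow_nonneg hk.1.le n, pow_le_one₀ hk.1.le hk.2⟩
  have h1 : |bandCos p x| ≤ 1 := by
    have := intervalIntegral.norm_integral_le_of_norm_le_const (a := 0) (b := 1) (C := 1)
      (f := fun k => k ^ p * (1 - k) * Real.cos (k * x)) fun k hk => by
        rw [uIoc_of_le zero_le_one] at hk
        obtain ⟨h0, h1⟩ := hpow p k hk
        rw [norm_mul, norm_mul, Real.norm_of_nonneg h0, Real.norm_of_nonneg (by linarith [hk.2])]
        exact mul_le_one₀ (mul_le_one₀ h1 (by linarith [hk.2]) (by linarith [hk.1]))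
          (norm_nonneg _) (Real.abs_cos_le_one _)
    simpa [bandCos] using this
  have h2 : |∫ k in (0 : ℝ)..1, (p * ((p - 1 : ℕ) * k ^ (p - 1 - 1)) - (p + 1) * (p * k ^ (p - 1)))
      * Real.cos (k * x)| ≤ 2 * (p + 1 : ℝ) ^ 2 := by
    have := intervalIntegral.norm_integral_le_of_norm_le_const (a := 0) (b := 1)
      (C := 2 * (p + 1 : ℝ) ^ 2)
      (f := fun k : ℝ => (p * ((p - 1 : ℕ) * k ^ (p - 1 - 1)) - (p + 1) * (p * k ^ (p - 1)))
      * Real.cos (k * x)) fun k hk => by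
        rw [uIoc_of_le zero_le_one] at hk
        obtain ⟨h0, h1⟩ := hpow (p - 1 - 1) k hk
        obtain ⟨h0', h1'⟩ := hpow (p - 1) k hk
        have hp1 : ((p - 1 : ℕ) : ℝ) ≤ p := by exact_mod_cast Nat.sub_le p 1
        have hp0 : (0 : ℝ) ≤ ((p - 1 : ℕ) : ℝ) := Nat.cast_nonneg _
        have e1 : p * ((p - 1 : ℕ) * k ^ (p - 1 - 1)) ≤ (p * p : ℝ) := by
          have := mul_le_mul hp1 h1 h0 hp
          exact mul_le_mul_of_nonneg_left (by linarith) hp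
        have e2 : ((p : ℝ) + 1) * (p * k ^ (p - 1)) ≤ (p + 1) * p :=
          mul_le_mul_of_nonneg_left (by nlinarith) (by linarith)
        have e3 : 0 ≤ p * ((p - 1 : ℕ) * k ^ (p - 1 - 1)) := by positivity
        have e4 : 0 ≤ ((p : ℝ) + 1) * (p * k ^ (p - 1)) := by positivity
        rw [norm_mul]
        refine (mul_le_of_le_one_right (norm_nonneg _) (Real.abs_cos_le_one _)).trans ?_
        rw [Real.norm_eq_abs, abs_le]
        constructor <;> nlinarith
    simpa using this
  have h3 : |(p - (p + 1)) * Real.cos x| ≤ 1 := by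
    rw [show ((p : ℝ) - (p + 1)) = -1 by ring, neg_one_mul, abs_neg]
    exact Real.abs_cos_le_one x
  have h4 : |(p : ℝ) * 0 ^ (p - 1) - (p + 1) * 0 ^ p| ≤ 2 * p + 1 := by
    have hz : ∀ n : ℕ, (0 : ℝ) ≤ 0 ^ n ∧ (0 : ℝ) ^ n ≤ 1 := fun n =>
      ⟨pow_nonneg le_rfl n, pow_le_one₀ le_rfl zero_le_one⟩
    have a1 := mul_le_mul_of_nonneg_left (hz (p - 1)).2 hp
    have a2 := mul_le_mul_of_nonneg_left (hz p).2 (by linarith : (0 : ℝ) ≤ p + 1)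
    have a3 := mul_nonneg hp (hz (p - 1)).1
    have a4 := mul_nonneg (by linarith : (0 : ℝ) ≤ p + 1) (hz p).1
    rw [abs_le]
    constructor <;> linarith
  have h5 : x ^ 2 * |bandCos p x| ≤ 1 + (2 * p + 1) + 2 * (p + 1 : ℝ) ^ 2 := by
    rw [← abs_of_nonneg (sq_nonneg x), ← abs_mul, sq_mul_bandCos]
    exact (abs_sub _ _).trans (add_le_add ((abs_sub _ _).trans (add_le_add h3 h4)) h2)
  rw [← div_eq_mul_inv, le_div_iff₀ (by positivity)]
  nlinarith

theorem integrable_bandCos (p : ℕ) : Integrable (bandCos p) :=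
  (integrable_inv_one_add_sq.const_mul (7 * (p + 1 : ℝ) ^ 2)).mono'
    (continuous_bandCos p).aestronglyMeasurable
    (Eventually.of_forall fun x => abs_bandCos_le p x)

theorem integral_abs_bandCos_le (p : ℕ) :
    ∫ x, |bandCos p x| ≤ 7 * Real.pi * (p + 1 : ℝ) ^ 2 := by
  refine (integral_mono (integrable_bandCos p).abs
    (integrable_inv_one_add_sq.const_mul (7 * (p + 1 : ℝ) ^ 2)) (abs_bandCos_le p)).trans ?_
  rw [integral_const_mul, integral_univ_inv_one_add_sq]
  exact (by ring : _ = _).le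

theorem integral_bandCos_zero_pos : 0 < ∫ x, bandCos 0 x := by
  refine integral_pos_of_integrable_nonneg_nonzero (x := 0) (continuous_bandCos 0)
    (integrable_bandCos 0) bandCos_zero_nonneg ?_
  have h : bandCos 0 0 = ∫ k in (0 : ℝ)..1, (1 - k) := by simp [bandCos]
  rw [h, intervalIntegral.integral_sub (by simp) (by simp)]
  norm_num



/-! ### Bounded solutions of `Q = κ * Q_xx` vanish -/

theorem inv_one_add_sq_le {z y : ℝ} (h : |z - y| ≤ 1) : (1 + z ^ 2)⁻¹ ≤ 3 * (1 + y ^ 2)⁻¹ := by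
  rw [← div_eq_mul_inv, inv_eq_one_div, div_le_div_iff₀ (by positivity) (by positivity)]
  have h2 : (z - y) ^ 2 ≤ 1 := (sq_le_one_iff_abs_le_one _).2 h
  nlinarith [sq_nonneg (2 * z - y)]

theorem abs_secondDiff_bandCos_le (p : ℕ) {η : ℝ} (hη : 0 < η) (h1 : η ≤ 1) (x : ℝ) :
    |secondDiff (bandCos p) η x / η ^ 2| ≤ 21 * (p + 3 : ℝ) ^ 2 * (1 + x ^ 2)⁻¹ := by
  obtain ⟨z, hz, e⟩ := exists_secondDiff_eq (hasDerivAt_bandCos p)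
    (fun x => (hasDerivAt_bandSin (p + 1) x).neg) hη x
  rw [e, mul_div_cancel_right₀ _ (by positivity), abs_neg]
  refine (abs_bandCos_le _ z).trans ?_
  have h := inv_one_add_sq_le (z := z) (y := x) (abs_le.2 ⟨by linarith [hz.1], by linarith [hz.2]⟩)
  have h0 : (0 : ℝ) ≤ 7 * (p + 3 : ℝ) ^ 2 := by positivity
  have := mul_le_mul_of_nonneg_left h h0
  push_cast
  rw [show (p : ℝ) + 1 + 1 + 1 = p + 3 by ring]
  linarith

theorem integrable_bandCos_mul (p : ℕ) {f : ℝ → ℝ} (hf : Continuous f) {M : ℝ}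
    (hM : ∀ x, |f x| ≤ M) : Integrable fun y => bandCos p y * f y :=
  (integrable_bandCos p).mul_bdd (c := M) hf.aestronglyMeasurable (Eventually.of_forall hM)

/-- Discrete integration by parts, by translation invariance of the integral. -/
theorem integral_bandCos_mul_secondDiff (p : ℕ) {q : ℝ → ℝ} (hq : Continuous q) {M : ℝ}
    (hM : ∀ x, |q x| ≤ M) (η : ℝ) :
    ∫ y, bandCos p y * secondDiff q η y = ∫ y, secondDiff (bandCos p) η y * q y := by
  have i1 : ∀ s, Integrable fun y => bandCos p y * q (y + s) := fun s =>
    integrable_bandCos_mul p (f := fun y => q (y + s)) (by fun_prop) fun x => hM _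
  have i2 : ∀ s, Integrable fun y => bandCos p (y + s) * q y := fun s => by
    have := (i1 (-s)).comp_add_right s
    simpa using this
  have e : ∀ s, ∫ y, bandCos p y * q (y + s) = ∫ y, bandCos p (y + -s) * q y := fun s => by
    rw [← integral_add_right_eq_self (fun y => bandCos p y * q (y + s)) (-s)]
    simp
  have i0 := integrable_bandCos_mul p hq hM
  have i1' := (i1 η).fun_add (i1 (-η))
  have i2' := (i2 η).fun_add (i2 (-η))
  have l : ∀ y, bandCos p y * secondDiff q η y = bandCos p y * q (y + η)
      + bandCos p y * q (y + -η) - 2 * (bandCos p y * q y) := fun y => by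
    rw [secondDiff, sub_eq_add_neg y]
    ring
  have r : ∀ y, secondDiff (bandCos p) η y * q y = bandCos p (y + η) * q y
      + bandCos p (y + -η) * q y - 2 * (bandCos p y * q y) := fun y => by
    rw [secondDiff, sub_eq_add_neg y]
    ring
  simp only [l, r]
  rw [integral_sub i1' (i0.const_mul 2), integral_add (i1 _) (i1 _),
    integral_sub i2' (i0.const_mul 2), integral_add (i2 _) (i2 _), e, e, neg_neg,
    add_comm (∫ y, bandCos p (y + -η) * q y)]

/-- The second derivative, understood through second differences, may be moved onto the test
functions. -/
theorem integral_bandCos_mul_deriv_two (p : ℕ) {q r : ℝ → ℝ} (hq : Continuous q) {M M' : ℝ}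
    (hM : ∀ x, |q x| ≤ M) (hM' : ∀ x, ∀ η > 0, |secondDiff q η x| ≤ M' * η ^ 2)
    (hr : ∀ x, Tendsto (fun η => secondDiff q η x / η ^ 2) (𝓝[>] 0) (𝓝 (r x))) :
    ∫ y, bandCos p y * r y = -∫ y, bandCos (p + 2) y * q y := by
  have l : Tendsto (fun η => ∫ y, bandCos p y * (secondDiff q η y / η ^ 2)) (𝓝[>] 0)
      (𝓝 (∫ y, bandCos p y * r y)) := by
    refine tendsto_integral_filter_of_dominated_convergence (fun y => |bandCos p y| * M') ?_ ?_
      ((integrable_bandCos p).abs.mul_const M')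
      (Eventually.of_forall fun y => (hr y).const_mul _)
    · refine Eventually.of_forall fun η => ?_
      exact ((continuous_bandCos p).mul
        ((continuous_secondDiff hq η).div_const _)).aestronglyMeasurable
    · filter_upwards [self_mem_nhdsWithin] with η hη
      refine Eventually.of_forall fun y => ?_
      have hη0 : (0 : ℝ) < η := hη
      rw [norm_mul, Real.norm_eq_abs, Real.norm_eq_abs]
      refine mul_le_mul_of_nonneg_left ?_ (abs_nonneg _)
      rw [abs_div, abs_of_nonneg (sq_nonneg η), div_le_iff₀ (by positivity)]
      exact hM' y η hη0
  have h : Tendsto (fun η => ∫ y, secondDiff (bandCos p) η y / η ^ 2 * q y) (𝓝[>] 0)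
      (𝓝 (∫ y, -bandCos (p + 2) y * q y)) := by
    refine tendsto_integral_filter_of_dominated_convergence
      (fun y => 21 * (p + 3 : ℝ) ^ 2 * (1 + y ^ 2)⁻¹ * M) ?_ ?_
      ((integrable_inv_one_add_sq.const_mul _).mul_const M)
      (Eventually.of_forall fun y => ?_)
    · refine Eventually.of_forall fun η => ?_
      exact (((continuous_secondDiff (continuous_bandCos p) η).div_const _).mul
        hq).aestronglyMeasurable
    · filter_upwards [Ioc_mem_nhdsGT one_pos] with η hη
      refine Eventually.of_forall fun y => ?_
      rw [norm_mul]
      exact mul_le_mul (abs_secondDiff_bandCos_le p hη.1 hη.2 y) (hM y) (norm_nonneg _)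
        (by positivity)
    · exact (tendsto_secondDiff (hasDerivAt_bandCos p)
        (fun x => (hasDerivAt_bandSin (p + 1) x).neg) (continuous_bandCos (p + 2)).neg y).mul_const _
  have e : (fun η => ∫ y, bandCos p y * (secondDiff q η y / η ^ 2))
      = fun η => ∫ y, secondDiff (bandCos p) η y / η ^ 2 * q y := by
    ext η
    have := integral_bandCos_mul_secondDiff p hq hM η
    simp only [mul_div_assoc', div_mul_eq_mul_div]
    rw [integral_div, integral_div, this]
  rw [e] at l
  rw [tendsto_nhds_unique l h, ← integral_neg]
  simp only [neg_mul]

/-- `Q` is bounded and continuous, `R` is its second derivative in space, and `Q = κ * R`. -/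
structure IsVolterraPair (κ : ℝ → ℝ) (Q R : ℝ → ℝ → ℝ) : Prop where
  continuousOn_fst : ContinuousOn (fun q : ℝ × ℝ => Q q.1 q.2) (univ ×ˢ Ioi 0)
  continuousOn_snd : ContinuousOn (fun q : ℝ × ℝ => R q.1 q.2) (univ ×ˢ Ioi 0)
  bound : ∀ T > 0, ∃ M, ∀ t ∈ Ioc 0 T, ∀ x, |Q x t| ≤ M ∧ |R x t| ≤ M
  secondDiff_le : ∀ t > 0, ∃ M, ∀ x, ∀ η > 0, |secondDiff (fun y => Q y t) η x| ≤ M * η ^ 2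
  tendsto : ∀ t > 0, ∀ x,
    Tendsto (fun η => secondDiff (fun y => Q y t) η x / η ^ 2) (𝓝[>] 0) (𝓝 (R x t))
  volterra : ∀ x, ∀ t > 0, Q x t = halfConv κ (R x) t

namespace IsVolterraPair

variable {κ : ℝ → ℝ} {Q R : ℝ → ℝ → ℝ}

/-- Translation and dilation preserve the class, the factor `l ^ 2` from two derivatives being
compensated in the kernel. Every centre and scale is thereby reduced to the single test function
`bandCos 0`. -/
theorem rescale (h : IsVolterraPair κ Q R) (x₀ : ℝ) {l : ℝ} (hl : 0 < l) :
    IsVolterraPair (fun s => (l ^ 2)⁻¹ * κ s) (fun y t => Q (x₀ + l * y) t)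
      (fun y t => l ^ 2 * R (x₀ + l * y) t) := by
  have hmap : MapsTo (fun q : ℝ × ℝ => (x₀ + l * q.1, q.2)) (univ ×ˢ Ioi 0) (univ ×ˢ Ioi 0) :=
    fun q hq => ⟨mem_univ _, hq.2⟩
  have hcm : ContinuousOn (fun q : ℝ × ℝ => (x₀ + l * q.1, q.2)) (univ ×ˢ Ioi 0) :=
    Continuous.continuousOn (by fun_prop)
  refine ⟨h.continuousOn_fst.comp hcm hmap, (h.continuousOn_snd.comp hcm hmap).const_mul _,
    fun T hT => ?_, fun t ht => ?_, fun t ht x => ?_, fun x t ht => ?_⟩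
  · obtain ⟨M, hM⟩ := h.bound T hT
    refine ⟨max M (l ^ 2 * M), fun t ht x => ⟨(hM t ht _).1.trans (le_max_left _ _), ?_⟩⟩
    rw [abs_mul, abs_of_nonneg (sq_nonneg l)]
    exact (mul_le_mul_of_nonneg_left (hM t ht _).2 (sq_nonneg l)).trans (le_max_right _ _)
  · obtain ⟨M, hM⟩ := h.secondDiff_le t ht
    refine ⟨M * l ^ 2, fun x η hη => ?_⟩
    rw [secondDiff_comp_affine (fun y => Q y t)]
    exact (hM _ _ (mul_pos hl hη)).trans (by ring : _ = _).le
  · have h1 : Tendsto (fun η : ℝ => l * η) (𝓝[>] 0) (𝓝[>] 0) := by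
      refine tendsto_nhdsWithin_iff.2 ⟨?_, ?_⟩
      · have : Tendsto (fun η : ℝ => l * η) (𝓝 0) (𝓝 (l * 0)) := by
          exact (continuous_const_mul l).tendsto 0
        rw [mul_zero] at this
        exact this.mono_left nhdsWithin_le_nhds
      · filter_upwards [self_mem_nhdsWithin] with η hη using mul_pos hl hη
    refine (((h.tendsto t ht (x₀ + l * x)).comp h1).const_mul (l ^ 2)).congr fun η => ?_
    rw [secondDiff_comp_affine (fun y => Q y t), Function.comp_apply, mul_pow]
    field_simp
  · rw [h.volterra _ t ht, halfConv_const_mul_left, halfConv_const_mul_right,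
      inv_mul_cancel_left₀ (by positivity)]

theorem unifGood_snd (h : IsVolterraPair κ Q R) : UnifGood R := by
  have hc : ∀ x, ContinuousOn (R x) (Ioi 0) := fun x =>
    h.continuousOn_snd.comp (f := fun t : ℝ => (x, t)) (by fun_prop) fun t ht => ⟨mem_univ _, ht⟩
  have hb : ∀ T > 0, ∃ M, 0 ≤ M ∧ ∀ x, ∀ t ∈ Ioc 0 T, |R x t| ≤ M := fun T hT => by
    obtain ⟨M, hM⟩ := h.bound T hT
    exact ⟨max M 0, le_max_right _ _, fun x t ht => (hM t ht x).2.trans (le_max_left _ _)⟩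
  have hl : ∀ x, LocInt (R x) := fun x T => by
    rcases le_or_gt T 0 with hT | hT
    · simp [Ioc_eq_empty (not_lt.2 hT)]
    obtain ⟨M, _, hM⟩ := hb T hT
    exact IntegrableOn.of_bound (by simp)
      (((hc x).mono Ioc_subset_Ioi_self).aestronglyMeasurable measurableSet_Ioc) M
      ((ae_restrict_iff' measurableSet_Ioc).2 (Eventually.of_forall fun t ht => hM x t ht))
  refine ⟨fun x => ⟨hl x, fun T => ?_⟩, fun T hT => ?_⟩
  · rcases le_or_gt T 0 with hT | hT
    · exact ⟨0, fun t ht => absurd ht.1 (not_lt.2 (ht.2.trans hT))⟩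
    obtain ⟨M, _, hM⟩ := hb T hT
    exact ⟨T * M, fun t ht => mul_le_mul ht.2 (hM x t ht) (abs_nonneg _) hT.le⟩
  · obtain ⟨M, hM0, hM⟩ := hb T hT
    refine ⟨T * M, by positivity, fun x => ⟨?_, fun t ht =>
      mul_le_mul ht.2 (hM x t ht) (abs_nonneg _) hT.le⟩⟩
    have := intervalIntegral.norm_integral_le_of_norm_le_const (a := 0) (b := T) (C := M)
      (f := fun t => |R x t|) fun t ht => by
        rw [uIoc_of_le hT.le] at ht
        simpa using hM x t ht
    rw [sub_zero, abs_of_pos hT, mul_comm] at this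
    exact (le_abs_self _).trans this

theorem continuous_fst (h : IsVolterraPair κ Q R) {t : ℝ} (ht : 0 < t) :
    Continuous fun y => Q y t := continuous_slice h.continuousOn_fst ht

/-- Test `Q = κ * R` with `bandCos p`, exchange the integrals, and move the two space derivatives
onto the test function. Here the space variable is the superposition index. -/
theorem superpose_eq (h : IsVolterraPair κ Q R) (hκ : Good κ) (p : ℕ) {t : ℝ} (ht : 0 < t) :
    superpose (bandCos p) Q t = -halfConv κ (superpose (bandCos (p + 2)) Q) t := by
  have h1 : superpose (bandCos p) Q t = superpose (bandCos p) (fun y => halfConv κ (R y)) t := by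
    simp only [superpose, h.volterra _ t ht]
  rw [h1, ← halfConv_superpose hκ (integrable_bandCos p) h.unifGood_snd h.continuousOn_snd ht,
    neg_eq_neg_one_mul, ← halfConv_const_mul_right]
  refine halfConv_congr ht.le (fun _ _ => rfl) fun s hs => ?_
  obtain ⟨M, hM⟩ := h.bound s hs.1
  obtain ⟨M', hM'⟩ := h.secondDiff_le s hs.1
  simp only [superpose]
  rw [integral_bandCos_mul_deriv_two p (h.continuous_fst hs.1)
    (fun x => (hM s ⟨hs.1, le_rfl⟩ x).1) hM' (h.tendsto s hs.1), neg_one_mul]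

theorem superpose_bandCos_eq_zero (h : IsVolterraPair κ Q R) (hκ : Good κ) {t : ℝ} (ht : 0 < t) :
    superpose (bandCos 0) Q t = 0 := by
  obtain ⟨M, hM⟩ := h.bound t ht
  have hM0 : 0 ≤ M := (abs_nonneg _).trans (hM t ⟨ht, le_rfl⟩ 0).1
  obtain ⟨σ, hσ, hw⟩ := exists_exp_weight hκ.locInt ht (show (0 : ℝ) < 1 / 2 by norm_num)
  set B := 7 * Real.pi * M with hB
  have hB0 : 0 ≤ B := by positivity
  -- After `j` uses of the equation, each contributing `1/2` through the weighted mass of `κ`, the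
  -- test function is `bandCos (p + 2 * j)`. The induction on `j` must hold for all `p`, since a
  -- step replaces `p` by `p + 2`.
  have key : ∀ j p : ℕ, ∀ s ∈ Ioc 0 t,
      |Real.exp (-σ * s) * superpose (bandCos p) Q s|
        ≤ B * (p + 2 * j + 1 : ℝ) ^ 2 * (1 / 2) ^ j := by
    intro j
    induction j with
    | zero =>
      intro p s hs
      have h1 : |superpose (bandCos p) Q s| ≤ ∫ y, |bandCos p y| * M := by
        refine norm_integral_le_of_norm_le (f := fun y => bandCos p y * Q y s)
          ((integrable_bandCos p).abs.mul_const M) (Eventually.of_forall fun y => ?_)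
        rw [norm_mul]
        exact mul_le_mul_of_nonneg_left (hM s hs y).1 (abs_nonneg _)
      rw [integral_mul_const] at h1
      have h2 := mul_le_mul_of_nonneg_right (integral_abs_bandCos_le p) hM0
      have h3 : Real.exp (-σ * s) ≤ 1 := Real.exp_le_one_iff.2 (by nlinarith [hs.1])
      rw [abs_mul, abs_of_pos (Real.exp_pos _)]
      refine (mul_le_of_le_one_left (abs_nonneg _) h3).trans ?_
      simp only [CharP.cast_eq_zero, mul_zero, add_zero, pow_zero, mul_one]
      linarith
    | succ j ih =>
      intro p s hs
      have hl := hκ.locInt.continuous_mul (g := fun r => Real.exp (-σ * r)) (by fun_prop)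
      rw [h.superpose_eq hκ p hs.1, mul_neg, abs_neg, ← halfConv_exp_mul, halfConv]
      have hb := intervalIntegral.norm_integral_le_of_norm_le (a := 0) (b := s) (μ := volume)
        (f := fun y => Real.exp (-σ * (s - y)) * κ (s - y)
          * (Real.exp (-σ * y) * superpose (bandCos (p + 2)) Q y))
        (g := fun y => |Real.exp (-σ * (s - y)) * κ (s - y)|
          * (B * ((p + 2 : ℕ) + 2 * j + 1 : ℝ) ^ 2 * (1 / 2) ^ j)) hs.1.le
        (Eventually.of_forall fun y hy => by
          rw [norm_mul]
          exact mul_le_mul_of_nonneg_left (ih (p + 2) y ⟨hy.1, hy.2.trans hs.2⟩) (abs_nonneg _))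
        ((hl.abs.comp_sub hs.1.le).mul_const _)
      refine hb.trans ?_
      rw [intervalIntegral.integral_mul_const]
      have hc := intervalIntegral.integral_comp_sub_left (a := 0) (b := s)
        (fun r => |Real.exp (-σ * r) * κ r|) s
      rw [sub_self, sub_zero] at hc
      rw [hc]
      have hle := (hl.integral_abs_mono hs.1.le hs.2).trans hw
      refine (mul_le_mul_of_nonneg_right hle (by positivity)).trans (le_of_eq ?_)
      push_cast
      ring
  have hlim : Tendsto (fun j : ℕ => B * (((0 : ℕ) : ℝ) + 2 * j + 1) ^ 2 * (1 / 2) ^ j) atTop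
      (𝓝 0) := by
    have hp : ∀ m : ℕ, Tendsto (fun j : ℕ => (j : ℝ) ^ m * (1 / 2 : ℝ) ^ j) atTop (𝓝 0) :=
      fun m => tendsto_pow_const_mul_const_pow_of_abs_lt_one m (by norm_num [abs_of_pos])
    have := (((hp 2).const_mul 4).add (((hp 1).const_mul 4).add (hp 0))).const_mul B
    simp only [mul_zero, add_zero] at this
    refine this.congr fun j => ?_
    push_cast
    ring
  have h0 := ge_of_tendsto hlim (Eventually.of_forall fun j => key j 0 t ⟨ht, le_rfl⟩)
  have h1 := abs_eq_zero.1 (le_antisymm h0 (abs_nonneg _))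
  exact (mul_eq_zero.1 h1).resolve_left (Real.exp_ne_zero _)

/-- The vanishing averages at scale `l` concentrate at `x` as `l → 0`, and `bandCos 0` has positive
integral. -/
theorem eq_zero (h : IsVolterraPair κ Q R) (hκ : Good κ) (x : ℝ) {t : ℝ} (ht : 0 < t) :
    Q x t = 0 := by
  have h0 : ∀ l > 0, ∫ y, bandCos 0 y * Q (x + l * y) t = 0 := fun l hl =>
    (h.rescale x hl).superpose_bandCos_eq_zero (hκ.const_mul _) ht
  obtain ⟨M, hM⟩ := h.bound t ht
  have hc := h.continuous_fst ht
  have hlim : Tendsto (fun l : ℝ => ∫ y, bandCos 0 y * Q (x + l * y) t) (𝓝[>] 0)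
      (𝓝 (∫ y, bandCos 0 y * Q x t)) := by
    refine tendsto_integral_filter_of_dominated_convergence (fun y => |bandCos 0 y| * M) ?_ ?_
      ((integrable_bandCos 0).abs.mul_const M) (Eventually.of_forall fun y => ?_)
    · refine Eventually.of_forall fun l => ?_
      exact ((continuous_bandCos 0).mul
        (hc.comp (f := fun y => x + l * y) (by fun_prop))).aestronglyMeasurable
    · refine Eventually.of_forall fun l => Eventually.of_forall fun y => ?_
      rw [norm_mul]
      exact mul_le_mul_of_nonneg_left (hM t ⟨ht, le_rfl⟩ _).1 (abs_nonneg _)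
    · have h1 := (hc.comp (f := fun l => x + l * y) (by fun_prop)).tendsto 0
      simp only [Function.comp_apply, zero_mul, add_zero] at h1
      exact (h1.mono_left nhdsWithin_le_nhds).const_mul _
  have hz : Tendsto (fun l : ℝ => ∫ y, bandCos 0 y * Q (x + l * y) t) (𝓝[>] 0) (𝓝 0) := by
    refine tendsto_const_nhds.congr' ?_
    filter_upwards [self_mem_nhdsWithin] with l hl using (h0 l hl).symm
  have h2 := tendsto_nhds_unique hlim hz
  rw [integral_mul_const] at h2
  exact (mul_eq_zero.1 h2).resolve_left integral_bandCos_zero_pos.ne'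

end IsVolterraPair



/-! ### Uniqueness -/

theorem hasDerivAt_of_contDiff_two {f : ℝ → ℝ} (hf : ContDiff ℝ 2 f) :
    (∀ x, HasDerivAt f (deriv f x) x) ∧ (∀ x, HasDerivAt (deriv f) (iteratedDeriv 2 f x) x) ∧
      Continuous (iteratedDeriv 2 f) := by
  refine ⟨fun x => (hf.differentiable (by norm_num) x).hasDerivAt, fun x => ?_,
    hf.continuous_iteratedDeriv 2 le_rfl⟩
  have h := hf.differentiable_iteratedDeriv 1 (by norm_num) x
  rw [iteratedDeriv_one] at h
  rw [iteratedDeriv_succ, iteratedDeriv_one]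
  exact h.hasDerivAt

/-! ### Time primitives of dominated families. -/

/-- A family of functions of time, continuous in space and dominated by an integrable function of
time. -/
structure DominatedFamily (D : ℝ → ℝ → ℝ) : Prop where
  locInt : ∀ x, LocInt (D x)
  bound : ∀ T > 0, ∃ h : ℝ → ℝ, IntervalIntegrable h volume 0 T ∧
    ∀ t ∈ Ioc 0 T, ∀ x, |D x t| ≤ h t
  continuous : ∀ t > 0, Continuous fun x => D x t

namespace DominatedFamily

variable {D : ℝ → ℝ → ℝ}

theorem continuousOn_primitive (hD : DominatedFamily D) :
    ContinuousOn (fun q : ℝ × ℝ => ∫ s in (0 : ℝ)..q.2, D q.1 s) (univ ×ˢ Ioi 0) := by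
  rintro ⟨x, t⟩ ⟨-, ht⟩
  have ht0 : (0 : ℝ) < t := ht
  refine ContinuousAt.continuousWithinAt ?_
  obtain ⟨h, hi, hh⟩ := hD.bound (t + 1) (by linarith)
  -- The family is extended by zero to negative times so that the base point `0` becomes interior to
  -- the interval.
  have hsub : ∀ f : ℝ → ℝ, IntegrableOn f (Ioc 0 (t + 1)) →
      IntervalIntegrable (indicator (Ioi 0) f) volume (-1) (t + 1) := fun f hf => by
    rw [intervalIntegrable_iff_integrableOn_Ioc_of_le (by linarith), IntegrableOn,
      integrable_indicator_iff measurableSet_Ioi, IntegrableOn,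
      Measure.restrict_restrict measurableSet_Ioi]
    exact hf.mono_set fun s hs => ⟨hs.1, hs.2.2⟩
  have hc := intervalIntegral.continuousAt_parametric_primitive_of_dominated (μ := volume)
    (F := fun x => indicator (Ioi 0) (D x)) (indicator (Ioi 0) h) (-1) (t + 1) (a₀ := 0) (b₀ := t)
    (x₀ := x) (fun x => (hsub _ (hD.locInt x (t + 1))).def'.aestronglyMeasurable)
    (Eventually.of_forall fun x => by
      rw [uIoc_of_le (by linarith), ae_restrict_iff' measurableSet_Ioc]
      refine Eventually.of_forall fun s hs => ?_
      by_cases h0 : s ∈ Ioi (0 : ℝ)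
      · simpa only [indicator_of_mem h0, Real.norm_eq_abs] using hh s ⟨h0, hs.2⟩ x
      · simp [indicator_of_notMem h0])
    (hsub h ((intervalIntegrable_iff_integrableOn_Ioc_of_le (by linarith)).1 hi))
    (Eventually.of_forall fun s => by
      by_cases h0 : s ∈ Ioi (0 : ℝ)
      · simpa only [indicator_of_mem h0] using (hD.continuous s h0).continuousAt
      · simpa only [indicator_of_notMem h0] using continuousAt_const)
    ⟨by norm_num, by linarith⟩ ⟨by linarith, by linarith⟩ (by simp)
  refine hc.congr ?_
  filter_upwards [continuousAt_snd.preimage_mem_nhds (Ioi_mem_nhds ht0)] with q hq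
  have hq0 : (0 : ℝ) < q.2 := hq
  refine intervalIntegral.integral_congr_uIoo fun s hs => ?_
  rw [uIoo_of_le hq0.le] at hs
  exact indicator_of_mem (show s ∈ Ioi (0 : ℝ) from hs.1) _

theorem abs_primitive_le (hD : DominatedFamily D) {T : ℝ} {h : ℝ → ℝ}
    (hi : IntervalIntegrable h volume 0 T) (hh : ∀ t ∈ Ioc 0 T, ∀ x, |D x t| ≤ h t) {t : ℝ}
    (ht : t ∈ Ioc 0 T) (x : ℝ) : |∫ s in (0 : ℝ)..t, D x s| ≤ ∫ s in (0 : ℝ)..T, h s := by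
  have hT := ht.1.le.trans ht.2
  refine ((hD.locInt x).abs_integral_le ht.1.le ht.2).trans ?_
  refine intervalIntegral.integral_mono_on_of_le_Ioo hT
    ((hD.locInt x).abs.intervalIntegrable le_rfl hT) hi fun s hs => ?_
  exact hh s ⟨hs.1, hs.2.le⟩ x

theorem secondDiff_primitive (hD : DominatedFamily D) {t : ℝ} (ht : 0 < t) (η x : ℝ) :
    secondDiff (fun y => ∫ s in (0 : ℝ)..t, D y s) η x
      = ∫ s in (0 : ℝ)..t, secondDiff (fun y => D y s) η x := by
  have hi := fun y => (hD.locInt y).intervalIntegrable le_rfl ht.le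
  simp only [secondDiff]
  rw [intervalIntegral.integral_sub ((hi _).add (hi _)) ((hi _).const_mul 2),
    intervalIntegral.integral_add (hi _) (hi _), intervalIntegral.integral_const_mul]

end DominatedFamily

/-- Differentiation under the time integral is replaced by dominated convergence of second
difference quotients, which are bounded by the integrable majorant of `E`. -/
theorem isVolterraPair_primitive {κ : ℝ → ℝ} {D D' E : ℝ → ℝ → ℝ} (hD : DominatedFamily D)
    (hE : DominatedFamily E) (h1 : ∀ t > 0, ∀ x, HasDerivAt (fun y => D y t) (D' x t) x)
    (h2 : ∀ t > 0, ∀ x, HasDerivAt (fun y => D' y t) (E x t) x)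
    (hv : ∀ x, ∀ t > 0, ∫ s in (0 : ℝ)..t, D x s
      = halfConv κ (fun t => ∫ s in (0 : ℝ)..t, E x s) t) :
    IsVolterraPair κ (fun x t => ∫ s in (0 : ℝ)..t, D x s)
      (fun x t => ∫ s in (0 : ℝ)..t, E x s) := by
  have hsd : ∀ {t : ℝ} {h : ℝ → ℝ}, (∀ s ∈ Ioc 0 t, ∀ x, |E x s| ≤ h s) → ∀ x, ∀ η > 0,
      ∀ s ∈ Ioc 0 t, |secondDiff (fun y => D y s) η x| ≤ h s * η ^ 2 := by
    intro t h hh x η hη s hs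
    obtain ⟨z, -, e⟩ := exists_secondDiff_eq (h1 s hs.1) (h2 s hs.1) hη x
    rw [e, abs_mul, abs_of_nonneg (sq_nonneg η)]
    exact mul_le_mul_of_nonneg_right (hh s hs z) (sq_nonneg η)
  have hsm : ∀ (t η x : ℝ), 0 < t →
      IntervalIntegrable (fun s => secondDiff (fun y => D y s) η x) volume 0 t := by
    intro t η x ht
    have hi := fun y => (hD.locInt y).intervalIntegrable le_rfl ht.le
    exact ((hi _).add (hi _)).sub ((hi _).const_mul 2)
  refine ⟨hD.continuousOn_primitive, hE.continuousOn_primitive, fun T hT => ?_, fun t ht => ?_,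
    fun t ht x => ?_, hv⟩
  · obtain ⟨h, hi, hh⟩ := hD.bound T hT
    obtain ⟨h', hi', hh'⟩ := hE.bound T hT
    exact ⟨max (∫ s in (0 : ℝ)..T, h s) (∫ s in (0 : ℝ)..T, h' s), fun t ht x =>
      ⟨(hD.abs_primitive_le hi hh ht x).trans (le_max_left _ _),
        (hE.abs_primitive_le hi' hh' ht x).trans (le_max_right _ _)⟩⟩
  · obtain ⟨h, hi, hh⟩ := hE.bound t ht
    refine ⟨∫ s in (0 : ℝ)..t, h s, fun x η hη => ?_⟩
    rw [hD.secondDiff_primitive ht, ← intervalIntegral.integral_mul_const]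
    exact intervalIntegral.norm_integral_le_of_norm_le
      (f := fun s => secondDiff (fun y => D y s) η x) (g := fun s => h s * η ^ 2) ht.le
      (Eventually.of_forall fun s hs => hsd hh x η hη s hs) (hi.mul_const _)
  · obtain ⟨h, hi, hh⟩ := hE.bound t ht
    simp only [hD.secondDiff_primitive ht, ← intervalIntegral.integral_div]
    refine intervalIntegral.tendsto_integral_filter_of_dominated_convergence h ?_ ?_ hi ?_
    · exact Eventually.of_forall fun η =>
        ((hsm t η x ht).div_const _).def'.aestronglyMeasurable
    · filter_upwards [self_mem_nhdsWithin] with η hη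
      refine Eventually.of_forall fun s hs => ?_
      rw [uIoc_of_le ht.le] at hs
      have hη0 : (0 : ℝ) < η := hη
      rw [Real.norm_eq_abs, abs_div, abs_of_nonneg (sq_nonneg η), div_le_iff₀ (by positivity)]
      exact hsd hh x η hη0 s hs
    · refine Eventually.of_forall fun s hs => ?_
      rw [uIoc_of_le ht.le] at hs
      exact tendsto_secondDiff (h1 s hs.1) (h2 s hs.1) (hE.continuous s hs.1) x

/-- Time integration commutes with the kernel, so equality of primitives passes through the
Prabhakar integral. -/
theorem integral_prabhakarIntegral_congr {ε ρ α ω : ℝ} (hρ : 0 < ρ) (h : Admissible ε α)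
    {f f' : ℝ → ℝ} (hf : LocInt f) (hf' : LocInt f')
    (e : ∀ t > 0, ∫ s in (0 : ℝ)..t, f s = ∫ s in (0 : ℝ)..t, f' s) {t : ℝ} (ht : 0 < t) :
    ∫ s in (0 : ℝ)..t, prabhakarIntegral ε ρ α ω f s
      = ∫ s in (0 : ℝ)..t, prabhakarIntegral ε ρ α ω f' s := by
  rcases h with hα | h
  · have hg := good_prabhakarKernel hρ ε ω hα
    rw [prabhakarIntegral_of_pos hα, prabhakarIntegral_of_pos hα, hg.integral_halfConv hf ht,
      hg.integral_halfConv hf' ht]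
    exact halfConv_congr ht.le (fun _ _ => rfl) fun s hs => e s hs.1
  · rw [prabhakarIntegral_of_zero h, prabhakarIntegral_of_zero h, e t ht]

theorem eqOn_of_integral_eq {v v' : ℝ → ℝ} (hv : LocInt v) (hv' : LocInt v')
    (hc : ContinuousOn v (Ioi 0)) (hc' : ContinuousOn v' (Ioi 0))
    (e : ∀ t > 0, ∫ s in (0 : ℝ)..t, v s = ∫ s in (0 : ℝ)..t, v' s) : EqOn v v' (Ioi 0) := by
  intro t ht
  have ht0 : (0 : ℝ) < t := ht
  have hd : ∀ {w : ℝ → ℝ}, LocInt w → ContinuousOn w (Ioi 0) →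
      HasDerivAt (fun t => ∫ s in (0 : ℝ)..t, w s) (w t) t := fun hw hcw =>
    intervalIntegral.integral_hasDerivAt_right (hw.intervalIntegrable le_rfl ht0.le)
      (hcw.stronglyMeasurableAtFilter isOpen_Ioi t ht) (hcw.continuousAt (Ioi_mem_nhds ht0))
  refine (hd hv hc).unique ((hd hv' hc').congr_of_eventuallyEq ?_)
  filter_upwards [Ioi_mem_nhds ht0] with s hs using e s hs

/-- Second differences vanish, so `2 φ x = φ (x + η) + φ (x - η)`, which tends to `0` as `η → ∞`. -/
theorem eq_zero_of_deriv_two_eq_zero {φ φ' : ℝ → ℝ} (h : ∀ x, HasDerivAt φ (φ' x) x)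
    (h' : ∀ x, HasDerivAt φ' 0 x) (ht : Tendsto φ atTop (𝓝 0)) (hb : Tendsto φ atBot (𝓝 0))
    (x : ℝ) : φ x = 0 := by
  have h1 := ht.comp (tendsto_atTop_add_const_left atTop x tendsto_id)
  have h2 := hb.comp (tendsto_atBot_add_const_left atTop x tendsto_neg_atTop_atBot)
  have h3 := h1.add h2
  rw [add_zero] at h3
  have h4 : Tendsto (fun _ : ℝ => 2 * φ x) atTop (𝓝 0) := by
    refine h3.congr' ?_
    filter_upwards [eventually_gt_atTop 0] with η hη
    obtain ⟨z, -, e⟩ := exists_secondDiff_eq h (φ'' := fun _ => 0) h' hη x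
    rw [zero_mul, secondDiff, sub_eq_zero] at e
    rw [← e]
    simp [sub_eq_add_neg]
  have := tendsto_nhds_unique tendsto_const_nhds h4
  linarith

variable {γ μ ν ρ ω K : ℝ} {g : ℝ → ℝ} {u u' : ℝ → ℝ → ℝ}

namespace IsSolution

/-- The majorant gives no measurability in time; that comes from the equation, whose left side is a
Prabhakar integral of a locally integrable function. -/
theorem locInt_deriv_two (h : IsSolution γ μ ν ρ ω K g u) (hμ : μ ∈ Ioo (0 : ℝ) 1)
    (hν : ν ∈ Icc (0 : ℝ) 1) (hρ : 0 < ρ) (hK : 0 < K) (x : ℝ) :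
    LocInt fun t => iteratedDeriv 2 (fun y => u y t) x := by
  have := (integral_eq_of_hilferPrabhakarDeriv hμ hν hρ (h.time_regular x) (h.initial x)
    fun t ht => h.equation t ht x).1.const_mul K⁻¹
  simpa only [inv_mul_cancel_left₀ hK.ne'] using this

theorem volterra (h : IsSolution γ μ ν ρ ω K g u) (hμ : μ ∈ Ioo (0 : ℝ) 1)
    (hν : ν ∈ Icc (0 : ℝ) 1) (hρ : 0 < ρ) (x : ℝ) {t : ℝ} (ht : 0 < t) :
    ∫ s in (0 : ℝ)..t, u x s
      = g x * (∫ s in (0 : ℝ)..t, prabhakarKernel (γ * (1 - ν)) ρ (μ + ν * (1 - μ)) ω s)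
        + halfConv (fun s => K * prabhakarKernel γ ρ μ ω s)
          (fun t => ∫ s in (0 : ℝ)..t, iteratedDeriv 2 (fun y => u y s) x) t := by
  rw [(integral_eq_of_hilferPrabhakarDeriv hμ hν hρ (h.time_regular x) (h.initial x)
    fun t ht => h.equation t ht x).2 t ht, halfConv_const_mul_left, ← halfConv_const_mul_right]
  simp only [intervalIntegral.integral_const_mul]

theorem exists_majorant (h : IsSolution γ μ ν ρ ω K g u) {T : ℝ} (hT : 0 < T) :
    ∃ m : ℝ → ℝ, IntervalIntegrable m volume 0 T ∧ ∀ t ∈ Ioc 0 T, ∀ x,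
      |u x t| ≤ m t ∧ |iteratedDeriv 2 (fun y => u y t) x| ≤ m t := by
  obtain ⟨m, hm, H⟩ := h.majorant (T + 1) (by linarith)
  refine ⟨m, ?_, fun t ht => H t ⟨ht.1, by linarith [ht.2]⟩⟩
  rw [intervalIntegrable_iff_integrableOn_Ioc_of_le hT.le]
  exact hm.mono_set fun s hs => ⟨hs.1, by linarith [hs.2]⟩

/-- The datum `g` enters both integrated Volterra equations through the same term and cancels, so
the primitive of the difference is a Volterra pair with kernel `K a`. -/
theorem integral_eq (h : IsSolution γ μ ν ρ ω K g u) (h' : IsSolution γ μ ν ρ ω K g u')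
    (hμ : μ ∈ Ioo (0 : ℝ) 1) (hν : ν ∈ Icc (0 : ℝ) 1) (hρ : 0 < ρ) (hK : 0 < K) (x : ℝ) {t : ℝ}
    (ht : 0 < t) : ∫ s in (0 : ℝ)..t, u x s = ∫ s in (0 : ℝ)..t, u' x s := by
  have hu := fun x => (h.time_regular x).locInt
  have hu' := fun x => (h'.time_regular x).locInt
  have hd := h.locInt_deriv_two hμ hν hρ hK
  have hd' := h'.locInt_deriv_two hμ hν hρ hK
  have hκ := (good_prabhakarKernel hρ γ ω hμ.1).const_mul K
  have hD : DominatedFamily fun x t => u x t - u' x t := by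
    refine ⟨fun x => (hu x).sub (hu' x), fun T hT => ?_, fun t ht =>
      (h.space_regular t ht).continuous.sub (h'.space_regular t ht).continuous⟩
    obtain ⟨m, hm, H⟩ := h.exists_majorant hT
    obtain ⟨m', hm', H'⟩ := h'.exists_majorant hT
    exact ⟨fun t => m t + m' t, hm.add hm', fun t ht x =>
      (abs_sub _ _).trans (add_le_add (H t ht x).1 (H' t ht x).1)⟩
  have hE : DominatedFamily fun x t => iteratedDeriv 2 (fun y => u y t) x
      - iteratedDeriv 2 (fun y => u' y t) x := by
    refine ⟨fun x => (hd x).sub (hd' x), fun T hT => ?_, fun t ht =>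
      (hasDerivAt_of_contDiff_two (h.space_regular t ht)).2.2.sub
        (hasDerivAt_of_contDiff_two (h'.space_regular t ht)).2.2⟩
    obtain ⟨m, hm, H⟩ := h.exists_majorant hT
    obtain ⟨m', hm', H'⟩ := h'.exists_majorant hT
    exact ⟨fun t => m t + m' t, hm.add hm', fun t ht x =>
      (abs_sub _ _).trans (add_le_add (H t ht x).2 (H' t ht x).2)⟩
  have hp := isVolterraPair_primitive (κ := fun s => K * prabhakarKernel γ ρ μ ω s)
    (D' := fun x t => deriv (fun y => u y t) x - deriv (fun y => u' y t) x) hD hE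
    (fun t ht x => ((hasDerivAt_of_contDiff_two (h.space_regular t ht)).1 x).sub
      ((hasDerivAt_of_contDiff_two (h'.space_regular t ht)).1 x))
    (fun t ht x => ((hasDerivAt_of_contDiff_two (h.space_regular t ht)).2.1 x).sub
      ((hasDerivAt_of_contDiff_two (h'.space_regular t ht)).2.1 x))
    (fun x t ht => by
      rw [intervalIntegral.integral_sub ((hu x).intervalIntegrable le_rfl ht.le)
        ((hu' x).intervalIntegrable le_rfl ht.le), h.volterra hμ hν hρ x ht,
        h'.volterra hμ hν hρ x ht, add_sub_add_left_eq_sub,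
        ← halfConv_sub_right (hκ.halfConvAt (hd x).good_primitive ht)
          (hκ.halfConvAt (hd' x).good_primitive ht)]
      refine halfConv_congr ht.le (fun _ _ => rfl) fun s hs => ?_
      exact (intervalIntegral.integral_sub ((hd x).intervalIntegrable le_rfl hs.1.le)
        ((hd' x).intervalIntegrable le_rfl hs.1.le)).symm)
  have h0 := hp.eq_zero hκ x ht
  rw [intervalIntegral.integral_sub ((hu x).intervalIntegrable le_rfl ht.le)
    ((hu' x).intervalIntegrable le_rfl ht.le)] at h0
  exact sub_eq_zero.1 h0

/-- Equal primitives give equality only for almost every `t`. The inner integrals are continuous,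
hence equal at every `t > 0`; the equation then equates the second space derivatives at the given
`t`, and decay at `±∞` removes the remaining affine function. -/
theorem unique (h : IsSolution γ μ ν ρ ω K g u) (h' : IsSolution γ μ ν ρ ω K g u')
    (hμ : μ ∈ Ioo (0 : ℝ) 1) (hν : ν ∈ Icc (0 : ℝ) 1) (hρ : 0 < ρ) (hK : 0 < K) (x : ℝ) {t : ℝ}
    (ht : 0 < t) : u x t = u' x t := by
  have hinner : ∀ x, EqOn (innerIntegral γ μ ν ρ ω (u x)) (innerIntegral γ μ ν ρ ω (u' x))
      (Ioi 0) := fun x =>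
    eqOn_of_integral_eq
      ((h.time_regular x).locInt.prabhakarIntegral hρ (admissible_inner hμ hν γ) ω)
      ((h'.time_regular x).locInt.prabhakarIntegral hρ (admissible_inner hμ hν γ) ω)
      (fun t ht => ((h.time_regular x).inner_diff t ht).continuousAt.continuousWithinAt)
      (fun t ht => ((h'.time_regular x).inner_diff t ht).continuousAt.continuousWithinAt)
      fun t ht => integral_prabhakarIntegral_congr hρ (admissible_inner hμ hν γ)
        (h.time_regular x).locInt (h'.time_regular x).locInt
        (fun t ht => h.integral_eq h' hμ hν hρ hK x ht) ht
  have hxx : ∀ x, iteratedDeriv 2 (fun y => u y t) x = iteratedDeriv 2 (fun y => u' y t) x := by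
    intro x
    refine mul_left_cancel₀ hK.ne' ?_
    rw [← h.equation t ht x, ← h'.equation t ht x]
    refine prabhakarIntegral_congr (admissible_outer hμ hν γ) ht fun s hs => ?_
    refine EventuallyEq.deriv_eq ?_
    filter_upwards [isOpen_Ioi.mem_nhds hs] with r hr using hinner x hr
  obtain ⟨a1, a2, -⟩ := hasDerivAt_of_contDiff_two (h.space_regular t ht)
  obtain ⟨b1, b2, -⟩ := hasDerivAt_of_contDiff_two (h'.space_regular t ht)
  refine sub_eq_zero.1 (eq_zero_of_deriv_two_eq_zero (φ := fun x => u x t - u' x t)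
    (fun x => (a1 x).sub (b1 x)) (fun x => ((a2 x).sub (b2 x)).congr_deriv ?_) ?_ ?_ x)
  · rw [hxx, sub_self]
  · simpa using (h.decay_top t ht).sub (h'.decay_top t ht)
  · simpa using (h.decay_bot t ht).sub (h'.decay_bot t ht)

end IsSolution

end HilferPrabhakar

end

/-! ### Assembly: the formula holds for the constructed solution, and uniqueness carries it to every
solution. -/

theorem mainTheorem4 (γ μ ν ρ ω K : ℝ) (hμ : μ ∈ Set.Ioo (0 : ℝ) 1) (hν : ν ∈ Set.Icc (0 : ℝ) 1)
    (hρ : 0 < ρ) (hK : 0 < K) (hγ : 0 ≤ γ) :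
    (∀ k t : ℝ, 0 < t →
      Summable (fun p : ℕ × ℕ => |HilferPrabhakar.doubleSeriesTerm γ μ ν ρ ω K k t p|) ∧
      Summable (fun n : ℕ => |HilferPrabhakar.seriesTerm γ μ ν ρ ω K k t n|)) ∧
    ∀ g : ℝ → ℝ, Continuous g → MeasureTheory.Integrable g →
      MeasureTheory.Integrable (HilferPrabhakar.fourierHat g) →
      (∀ x t : ℝ, 0 < t →
        MeasureTheory.Integrable (HilferPrabhakar.solutionIntegrand γ μ ν ρ ω K g x t)) ∧
      (∃ u : ℝ → ℝ → ℝ, HilferPrabhakar.IsSolution γ μ ν ρ ω K g u) ∧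
      ∀ u : ℝ → ℝ → ℝ, HilferPrabhakar.IsSolution γ μ ν ρ ω K g u →
        ∀ x t : ℝ, 0 < t →
          (u x t : ℂ) = ∫ k : ℝ, HilferPrabhakar.solutionIntegrand γ μ ν ρ ω K g x t k := by
  refine ⟨fun k t ht =>
    ⟨HilferPrabhakar.summable_abs_doubleSeriesTerm hμ hν hρ hγ k ht,
      HilferPrabhakar.summable_abs_seriesTerm hμ hν hρ hγ k ht⟩, fun g hc hg hĝ => ?_⟩
  have hsol := HilferPrabhakar.isSolution_solution (ω := ω) hμ hν hρ hγ hK hc hg hĝ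
  have hform := fun (x t : ℝ) (ht : 0 < t) =>
    HilferPrabhakar.solution_eq_integral (ω := ω) hμ hν hρ hγ hK hĝ x ht
  refine ⟨fun x t ht => (hform x t ht).1, ⟨_, hsol⟩, fun u hu x t ht => ?_⟩
  rw [hu.unique hsol hμ hν hρ hK x ht, (hform x t ht).2]
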